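/- A walk on the square lattice $\mathbb Z^2$ starts at $(0,0)$ and takes unit steps North, South, East, West. It is *prudent* if it never takes a step pointing towards a vertex it has already visited (the open half-line issued from the current vertex in the direction of the step contains no visited vertex). Its *box* is the smallest axis-parallel rectangle containing it. A prudent walk is *2-sided* if its endpoint, as the walk grows, always lies on the top edge or on the right edge of the current box. Let $p_n$ be the number of $n$-step 2-sided walks, and let a *random* $n$-step 2-sided walk be chosen uniformly among these $p_n$ walks. Below, $x\approx d$ means that the decimal $d$ is $x$ truncated to the displayed digits. **Proposition.** There is a real number $\rho\approx 0.403$ satisfying $1-2\rho-2\rho^2+2\rho^3=0$ such that the following hold. 1. The length generating function $\sum_{n\ge 0}p_nt^n$ has a unique singularity of minimal modulus, which is $\rho$, and it is a simple pole: the series converges for $|t|<\rho$, and for some $R>\rho$ its sum extends to a function that is analytic on $\{|t|<R\}\setminus\{\rho\}$ and has a simple pole at $\rho$. 2. As $n\to\infty$, $p_n\sim\kappa\mu^n$ with $$\mu=\frac1\rho\approx 2.48,\qquad \kappa=\frac{\rho(3\rho-1)}{(3\rho+1)(5\rho-2)}\approx 2.51.$$ 3. Let $D_n$ be the distance between the endpoint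 and the North-East corner of the box in a random $n$-step 2-sided walk. Then $D_n$ follows asymptotically a geometric law of parameter $2\rho$: for every integer $k\ge0$, $\mathbb P(D_n=k)\to(1-2\rho)(2\rho)^k$. Moreover $\mathbb E(D_n)\to\frac{2\rho}{1-2\rho}\approx 4.15$. 4. Let $X_n$ and $Y_n$ be the abscissa and the ordinate of the endpoint of a random $n$-step 2-sided walk. Then $$\mathbb E(X_n+Y_n)\sim \mathfrak m\,n,\qquad \mathbb V(X_n+Y_n)\sim\mathfrak s^2 n,$$ where $$\mathfrak m=\frac{\rho+1}{3\rho+1}\approx 0.63,\qquad \mathfrak s^2=\frac{4(\rho+1)^2\rho}{(3\rho+1)^3(1-\rho)}\approx 0.49,$$ and $\dfrac{X_n+Y_n-\mathfrak m\,n}{\mathfrak s\sqrt n}$ converges in law to a standard normal distribution. 5. For every $n$, $\mathbb E(X_n-Y_n)=0$. Moreover $\mathbb V(X_n-Y_n)\sim\mathfrak t^2 n$, where $$\mathfrak t^2=\frac{\rho(\rho^2-2)(1+\rho)}{(\rho^2+\rho-1)(3\rho-1)(1+3\rho)}\approx 5.17,$$ and $\dfrac{X_n-Y_n}{\mathfrak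 t\sqrt n}$ converges in law to a standard normal distribution. -/

import Mathlib

open MeasureTheory ProbabilityTheory Filter Topology Asymptotics

namespace SquareWalk

/-- The four unit steps of the square lattice. -/
inductive Step where
  | north
  | south
  | east
  | west
  deriving DecidableEq

instance : Fintype Step := ⟨{.north, .south, .east, .west}, fun s => by cases s <;> decide⟩

/-- The lattice vector of a step. -/
def Step.vec : Step → ℤ × ℤ
  | .north => (0, 1)
  | .south => (0, -1)
  | .east => (1, 0)
  | .west => (-1, 0)

variable {n : ℕ}

/-- The vertex reached after the first `i` steps of the walk `w`, which starts at the origin. -/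
def vertex (w : Fin n → Step) (i : ℕ) : ℤ × ℤ :=
  ∑ j ∈ Finset.univ.filter (fun j : Fin n => (j : ℕ) < i), (w j).vec

/-- A walk is prudent if no step points towards an already visited vertex: the half-line that
starts at the current vertex (this vertex excluded) and follows the direction of the new step
contains no visited vertex. -/
def IsPrudent (w : Fin n → Step) : Prop :=
  ∀ i : Fin n, ∀ j : ℕ, j ≤ i → ∀ k : ℕ, 0 < k →
    vertex w j ≠ vertex w i + k • (w i).vec

/-- The north-east corner of the box (smallest bounding rectangle with sides parallel to the axes)
of the first `m` steps of `w`. Its coordinates are the abscissa of the right edge and the ordinate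
of the top edge of the box. -/
def neCorner (w : Fin n → Step) (m : ℕ) : ℤ × ℤ :=
  ((Finset.range (m + 1)).sup' Finset.nonempty_range_add_one (fun j => (vertex w j).1),
   (Finset.range (m + 1)).sup' Finset.nonempty_range_add_one (fun j => (vertex w j).2))

/-- A prudent walk is 2-sided if its endpoint, as the walk grows, always lies on the top edge or on
the right edge of the current box. -/
def IsTwoSided (w : Fin n → Step) : Prop :=
  IsPrudent w ∧ ∀ m : ℕ, m ≤ n →
    (vertex w m).2 = (neCorner w m).2 ∨ (vertex w m).1 = (neCorner w m).1

/-- The 2-sided walks with `n` steps. -/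
def TwoSidedWalk (n : ℕ) : Type := {w : Fin n → Step // IsTwoSided w}

/-- The number of 2-sided walks with `n` steps. -/
noncomputable def numTwoSided (n : ℕ) : ℕ := Nat.card (TwoSidedWalk n)

/-- The abscissa of the endpoint. -/
def TwoSidedWalk.X (w : TwoSidedWalk n) : ℤ := (vertex w.1 n).1

/-- The ordinate of the endpoint. -/
def TwoSidedWalk.Y (w : TwoSidedWalk n) : ℤ := (vertex w.1 n).2

/-- The distance between the endpoint and the north-east corner of the box. The endpoint lies on
the top or on the right edge, so one of the two nonnegative summands is zero. -/
def TwoSidedWalk.neDist (w : TwoSidedWalk n) : ℤ :=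
  ((neCorner w.1 n).1 - (vertex w.1 n).1) + ((neCorner w.1 n).2 - (vertex w.1 n).2)

instance : MeasurableSpace (TwoSidedWalk n) := ⊤

instance : DiscreteMeasurableSpace (TwoSidedWalk n) := ⟨fun _ => trivial⟩

instance : Finite (TwoSidedWalk n) := inferInstanceAs (Finite {w : Fin n → Step // IsTwoSided w})

theorem vertex_const_east (i : ℕ) :
    vertex (fun _ : Fin n => Step.east) i =
      (((Finset.univ.filter fun j : Fin n => (j : ℕ) < i).card : ℤ), 0) := by
  simp [vertex, Step.vec]

instance : Nonempty (TwoSidedWalk n) := by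
  refine ⟨⟨fun _ => Step.east, ?_, ?_⟩⟩
  · intro i j hj k hk h
    have h1 := congrArg Prod.fst h
    rw [vertex_const_east, vertex_const_east, Prod.fst_add, Prod.smul_fst] at h1
    simp only [Step.vec, nsmul_eq_mul, mul_one] at h1
    have h2 : (Finset.univ.filter fun a : Fin n => (a : ℕ) < j).card ≤
        (Finset.univ.filter fun a : Fin n => (a : ℕ) < i).card :=
      Finset.card_le_card fun a ha => by
        simp only [Finset.mem_filter, Finset.mem_univ, true_and] at ha ⊢
        omega
    omega
  · intro m _
    left
    simp [neCorner, vertex_const_east]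

/-- The law of a uniformly random 2-sided walk with `n` steps. -/
noncomputable def unif (n : ℕ) : Measure (TwoSidedWalk n) := uniformOn Set.univ

instance (n : ℕ) : IsProbabilityMeasure (unif n) :=
  inferInstanceAs (IsProbabilityMeasure (uniformOn (Set.univ : Set (TwoSidedWalk n))))

end SquareWalk

/-! A 2-sided walk either pushes an edge of its box outwards or moves along the top or right edge.
What may follow depends only on that edge, on the direction of motion since the last outward step,
and on the distance d to the north-east corner. `stateOf_spec` shows that this automaton accepts
exactly the 2-sided walks. `hasSum_weightSum` turns a solution of its linear transfer equation, of
at most exponential growth in d, into the generating function.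

Along one edge the transfer equation is a recurrence in d with constant coefficients. Its solution
combines P^d, which comes from the weight of the final distance, with (tV)^d, where V = `growth u t`
solves the kernel quadratic (`exists_edge_solution`). The edges communicate only through the corner,
by a 2×2 linear system of determinant 1 - (V_a - 1)(V_b - 1) = `walkDen a b t`. Hence the generating
function is `walkNum / walkDen` (`eventually_hasSum_weightSum`).

For unit weights the determinant is V(2 - V), and V = 2 in the kernel is the cubic for ρ. In the
disc of radius 81/200, which stops short of the branch point √2 - 1 of V, ρ is the only zero of the
determinant and it is simple (`walkDen_one_eq_zero_iff`, `deriv_walkDen_one_ne_zero`). This gives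
the pole and the growth of p_n. At the pole tV = 2ρ, so the residue depends on the weight q of d
only through 1/(1 - 2ρq) (`residue_eq`), which is the geometric law.

Exponential weights on the coordinates move the pole analytically to r(s), and the coefficients are
c(s) r(s)^(-n) with a uniformly small relative error (`exists_tendstoUniformlyOn_coeff`). The
quasi-powers principle then gives mean, variance and Gaussian limit from the first two derivatives
of log(ρ / r(s)). These come from implicit differentiation (`derivatives_sum`,
`derivatives_difference`). -/

namespace SquareWalk

/-! ### The automaton of 2-sided walks and its geometric invariant -/

/-- The reflection of a step in the first diagonal. -/
def Step.swap : Step → Step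
  | .north => .east
  | .south => .west
  | .east => .north
  | .west => .south

@[simp] theorem Step.swap_swap (s : Step) : s.swap.swap = s := by cases s <;> rfl

theorem Step.vec_swap (s : Step) : s.swap.vec = s.vec.swap := by cases s <;> rfl

/-- How a walk moved along the edge of its box since the edge was last pushed outwards: not at
all, away from the north-east corner, or towards it. -/
inductive Mode where
  | free
  | away
  | toward

/-- The information on a 2-sided walk that determines which steps may follow: the edge along which
it moves, the mode, and the distance to the north-east corner. -/
inductive State where
  | start
  | edge (top : Bool) (m : Mode) (d : ℕ)

/-- The reflection of a state in the first diagonal. -/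
def State.swap : State → State
  | .start => .start
  | .edge top m d => .edge (!top) m d

/-- The distance to the north-east corner. -/
def State.dist : State → ℕ
  | .start => 0
  | .edge _ _ d => d

/-- The state after a step from the top edge, if the step is allowed. -/
def topNext : Mode → ℕ → Step → Option State
  | _, d, .north => some (.edge true .free d)
  | .toward, _, .west => none
  | .free, d, .west => some (.edge true .away (d + 1))
  | .away, d, .west => some (.edge true .away (d + 1))
  | .away, _, .east => none
  | .free, 0, .east => some (.edge false .free 0)
  | .free, d + 1, .east => some (.edge true .toward d)
  | .toward, 0, .east => some (.edge false .free 0)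
  | .toward, d + 1, .east => some (.edge true .toward d)
  | _, _, .south => none

/-- The state after a step, if the step is allowed. -/
def State.next : State → Step → Option State
  | .start, .north => some (.edge true .free 0)
  | .start, .east => some (.edge false .free 0)
  | .start, .west => some (.edge true .away 1)
  | .start, .south => some (.edge false .away 1)
  | .edge true m d, s => topNext m d s
  | .edge false m d, s => (topNext m d s.swap).map State.swap

/-- `V` is a set of vertices containing `P`, whose bounding box has north-east corner `(X, Y)`. -/
structure IsBox (V : Set (ℤ × ℤ)) (P : ℤ × ℤ) (X Y : ℤ) : Prop where
  mem : P ∈ V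
  le : ∀ v ∈ V, v.1 ≤ X ∧ v.2 ≤ Y
  right : ∃ v ∈ V, v.1 = X
  top : ∃ v ∈ V, v.2 = Y

/-- The geometric meaning of a mode and a distance on the top edge. -/
def TopInv (m : Mode) (d : ℕ) (V : Set (ℤ × ℤ)) (P : ℤ × ℤ) (X Y : ℤ) : Prop :=
  P.2 = Y ∧ P.1 + d = X ∧
  match m with
  -- The last clause, kept in mode `toward`, supplies a vertex of the right edge below the current
  -- row: it blocks the step South once the walk has come back to the corner.
  | .free => (P.1, P.2 - 1) ∈ V ∧ (∀ v ∈ V, v.2 = P.2 → v.1 = P.1) ∧ ∃ v ∈ V, v.1 = X ∧ v.2 < Y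
  | .away => 1 ≤ d ∧ (P.1 + 1, P.2) ∈ V ∧ ∀ v ∈ V, v.2 = P.2 → P.1 ≤ v.1
  | .toward => (P.1 - 1, P.2) ∈ V ∧ (∀ v ∈ V, v.2 = P.2 → v.1 ≤ P.1) ∧
      ∃ v ∈ V, v.1 = X ∧ v.2 < Y

/-- The geometric meaning of a state. -/
def State.Inv : State → Set (ℤ × ℤ) → ℤ × ℤ → ℤ → ℤ → Prop
  | .start, V, P, X, Y => V = {0} ∧ P = 0 ∧ X = 0 ∧ Y = 0
  | .edge true m d, V, P, X, Y => TopInv m d V P X Y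
  | .edge false m d, V, P, X, Y => TopInv m d (Prod.swap ⁻¹' V) P.swap Y X

/-- The step `s` from `P` is prudent with respect to `V` and ends on the top or right edge. -/
def StepOk (V : Set (ℤ × ℤ)) (P : ℤ × ℤ) (X Y : ℤ) (s : Step) : Prop :=
  (∀ v ∈ V, ∀ k : ℕ, 0 < k → v ≠ P + k • s.vec) ∧ (Y ≤ (P + s.vec).2 ∨ X ≤ (P + s.vec).1)

/-- The automaton takes the step `s` if and only if it is allowed, and keeps the invariant. -/
def Sound (o : Option State) (V : Set (ℤ × ℤ)) (P : ℤ × ℤ) (X Y : ℤ) (s : Step) : Prop :=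
  match o with
  | none => ¬ StepOk V P X Y s
  | some σ => StepOk V P X Y s ∧
      σ.Inv (insert (P + s.vec) V) (P + s.vec) (max X (P + s.vec).1) (max Y (P + s.vec).2)

theorem IsBox.swap {V : Set (ℤ × ℤ)} {P : ℤ × ℤ} {X Y : ℤ} (h : IsBox V P X Y) :
    IsBox (Prod.swap ⁻¹' V) P.swap Y X where
  mem := by simpa using h.mem
  le v hv := ⟨(h.le _ hv).2, (h.le _ hv).1⟩
  right := by
    obtain ⟨v, hv, e⟩ := h.top
    exact ⟨v.swap, by simpa using hv, e⟩
  top := by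
    obtain ⟨v, hv, e⟩ := h.right
    exact ⟨v.swap, by simpa using hv, e⟩

theorem stepOk_swap {V : Set (ℤ × ℤ)} {P : ℤ × ℤ} {X Y : ℤ} {s : Step} :
    StepOk (Prod.swap ⁻¹' V) P.swap Y X s.swap ↔ StepOk V P X Y s := by
  unfold StepOk
  rw [Step.vec_swap]
  refine and_congr ⟨fun h v hv k hk e => ?_, fun h v hv k hk e => ?_⟩ ?_
  · refine h v.swap (by simpa using hv) k hk ?_
    rw [e]; rfl
  · refine h v.swap hv k hk ?_
    rw [e]; rfl
  · exact or_comm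

theorem State.inv_swap {σ : State} {V : Set (ℤ × ℤ)} {P : ℤ × ℤ} {X Y : ℤ}
    (h : σ.Inv (Prod.swap ⁻¹' V) P.swap Y X) : σ.swap.Inv V P X Y := by
  match σ with
  | .start =>
    obtain ⟨h1, h2, h3, h4⟩ := h
    refine ⟨?_, ?_, h4, h3⟩
    · ext v
      have := Set.ext_iff.1 h1 v.swap
      simpa [Prod.ext_iff, and_comm] using this
    · simpa [Prod.ext_iff, and_comm] using h2
  | .edge true m d => exact h
  | .edge false m d => simpa [State.Inv, State.swap, ← Set.preimage_comp] using h

theorem insert_swap (V : Set (ℤ × ℤ)) (Q : ℤ × ℤ) :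
    Prod.swap ⁻¹' (insert Q V) = insert Q.swap (Prod.swap ⁻¹' V) := by
  ext v
  simp [Prod.ext_iff, and_comm]

/-- Reflection in the diagonal exchanges the two edges, so the case analysis is needed for the top
edge only. -/
theorem sound_swap {o : Option State} {V : Set (ℤ × ℤ)} {P : ℤ × ℤ} {X Y : ℤ} {s : Step}
    (h : Sound o (Prod.swap ⁻¹' V) P.swap Y X s.swap) : Sound (o.map State.swap) V P X Y s := by
  match o with
  | none => exact fun h' => h (stepOk_swap.2 h')
  | some σ =>
    refine ⟨stepOk_swap.1 h.1, State.inv_swap ?_⟩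
    have := h.2
    rw [Step.vec_swap, show P.swap + s.vec.swap = (P + s.vec).swap from rfl] at this
    rw [insert_swap]
    exact this

/-- North is always free, since no vertex lies above the top edge. The visited neighbour recorded by
the mode blocks turning back along the row, and the bound on the visited part of the row frees the
other direction. South leaves both edges when d ≥ 1 and runs into a visited vertex when d = 0. -/
theorem sound_topNext {m : Mode} {d : ℕ} {V : Set (ℤ × ℤ)} {P : ℤ × ℤ} {X Y : ℤ}
    (hB : IsBox V P X Y) (h : TopInv m d V P X Y) (s : Step) :
    Sound (topNext m d s) V P X Y s := by
  obtain ⟨hmem, hle, ⟨r, hr, hrX⟩, -⟩ := hB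
  obtain ⟨x, y⟩ := P
  obtain ⟨hY, hX, hm⟩ := h
  simp only at hY hX hm
  subst hY hX
  have block : ∀ {k : ℕ} {v : ℤ × ℤ}, 0 < k → v ∈ V → v = (x, y) + k • s.vec →
      ¬ StepOk V (x, y) (x + d) y s := fun hk hv e h => h.1 _ hv _ hk e
  have north : s = .north → Sound (some (.edge true .free d)) V (x, y) (x + d) y s := by
    rintro rfl
    refine ⟨⟨fun v hv k hk e => ?_, Or.inl (by simp [Step.vec])⟩, ?_⟩
    · have := (hle v hv).2
      simp [e, Step.vec] at this
      omega
    · simp only [State.Inv, TopInv, Step.vec, Prod.mk_add_mk, add_zero]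
      refine ⟨by simp, by simp, by simp [hmem], ?_, ?_⟩
      · rintro v (rfl | hv) e
        · rfl
        · have := (hle v hv).2
          have e : v.2 = y + 1 := e
          omega
      · refine ⟨r, by simp [hr], by simp [hrX], ?_⟩
        have := (hle r hr).2
        simp
        omega
  have west (hrow : ∀ v ∈ V, v.2 = y → x ≤ v.1) : s = .west →
      Sound (some (.edge true .away (d + 1))) V (x, y) (x + d) y s := by
    rintro rfl
    refine ⟨⟨fun v hv k hk e => ?_, Or.inl (by simp [Step.vec])⟩, ?_⟩
    · have := hrow v hv (by simp [e, Step.vec])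
      simp [e, Step.vec] at this
      omega
    · simp only [State.Inv, TopInv, Step.vec, Prod.mk_add_mk, add_zero]
      refine ⟨by simp, by push_cast; omega, by omega, by simp [hmem], ?_⟩
      rintro v (rfl | hv) e
      · simp
      · have := hrow v hv e
        omega
  have east (hrow : ∀ v ∈ V, v.2 = y → v.1 ≤ x) (hcol : ∃ v ∈ V, v.1 = x + d ∧ v.2 < y) :
      s = .east → StepOk V (x, y) (x + d) y s ∧
        ∀ e : ℕ, d = e + 1 → Sound (some (.edge true .toward e)) V (x, y) (x + d) y s := by
    rintro rfl
    have ok : StepOk V (x, y) (x + d) y .east := by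
      refine ⟨fun v hv k hk e => ?_, Or.inl (by simp [Step.vec])⟩
      have := hrow v hv (by simp [e, Step.vec])
      simp [e, Step.vec] at this
      omega
    refine ⟨ok, ?_⟩
    rintro e rfl
    refine ⟨ok, ?_⟩
    simp only [State.Inv, TopInv, Step.vec, Prod.mk_add_mk, add_zero]
    refine ⟨by simp, by push_cast; omega, by simp [hmem], ?_, ?_⟩
    · rintro v (rfl | hv) e
      · simp
      · have := hrow v hv e
        omega
    · obtain ⟨v, hv, h1, h2⟩ := hcol
      refine ⟨v, by simp [hv], ?_, by simpa using h2⟩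
      push_cast at h1 ⊢
      omega
  have corner (hrow : ∀ v ∈ V, v.2 = y → v.1 ≤ x) (hcol : ∃ v ∈ V, v.1 = x + d ∧ v.2 < y) :
      s = .east → d = 0 → Sound (some (.edge false .free 0)) V (x, y) (x + d) y s := by
    intro hs hd
    refine ⟨(east hrow hcol hs).1, ?_⟩
    subst hs hd
    simp only [State.Inv, TopInv, Step.vec, Prod.mk_add_mk, add_zero, insert_swap, Prod.swap_prod_mk]
    -- In reflected coordinates `(y, x)` is the old endpoint: it lies on the top edge, strictly to
    -- the left of the new right edge.
    refine ⟨by simp, by simp, by simp [hmem], ?_, (y, x), by simp [hmem], by simp, by simp⟩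
    rintro v (rfl | hv) e
    · rfl
    · have := (hle _ hv).1
      simp at this e
      omega
  have south : s = .south →
      ((x, y - 1) ∈ V ∨ 1 ≤ d ∨ ∃ v ∈ V, v.1 = x + d ∧ v.2 < y) →
      ¬ StepOk V (x, y) (x + d) y s := by
    rintro rfl hh
    by_cases hd : 1 ≤ d
    · rintro ⟨-, h⟩
      simp [Step.vec] at h
      omega
    · rcases hh with hv | hd' | ⟨v, hv, h1, h2⟩
      · exact block one_pos hv (by simp [Step.vec, sub_eq_add_neg])
      · omega
      · refine block (k := (y - v.2).toNat) (by omega) hv ?_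
        ext
        · simp [Step.vec]
          omega
        · simp [Step.vec]
          omega
  cases m with
  | free =>
    obtain ⟨h1, h2, h3⟩ := hm
    have h2' : ∀ v ∈ V, v.2 = y → v.1 ≤ x := fun v hv e => (h2 v hv e).le
    cases s with
    | north => exact north rfl
    | south => exact south rfl (Or.inl h1)
    | west => exact west (fun v hv e => (h2 v hv e).ge) rfl
    | east =>
      cases d with
      | zero => exact corner h2' h3 rfl rfl
      | succ e => exact (east h2' h3 rfl).2 e rfl
  | away =>
    obtain ⟨h1, h2, h3⟩ := hm
    cases s with
    | north => exact north rfl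
    | south => exact south rfl (Or.inr (Or.inl h1))
    | west => exact west h3 rfl
    | east => exact block one_pos h2 (by simp [Step.vec])
  | toward =>
    obtain ⟨h1, h2, h3⟩ := hm
    cases s with
    | north => exact north rfl
    | south => exact south rfl (Or.inr (Or.inr h3))
    | west => exact block one_pos h1 (by simp [Step.vec, sub_eq_add_neg])
    | east =>
      cases d with
      | zero => exact corner h2 h3 rfl rfl
      | succ e => exact (east h2 h3 rfl).2 e rfl

theorem sound_next {σ : State} {V : Set (ℤ × ℤ)} {P : ℤ × ℤ} {X Y : ℤ}
    (hB : IsBox V P X Y) (h : σ.Inv V P X Y) (s : Step) : Sound (σ.next s) V P X Y s := by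
  match σ with
  | .edge true m d => exact sound_topNext hB h s
  | .edge false m d => exact sound_swap (sound_topNext hB.swap h s.swap)
  | .start =>
    obtain ⟨rfl, rfl, rfl, rfl⟩ := h
    cases s <;> refine ⟨⟨?_, by simp [Step.vec]⟩, ?_⟩
    all_goals
      first
      | rintro v rfl k hk e
        simp [Step.vec, Prod.ext_iff] at e
        omega
      | simp [State.Inv, TopInv, Step.vec]
        done
      | simp [State.Inv, TopInv, Step.vec]
        intro a b h1 h2
        omega

/-! ### Appending a step to a walk -/

/-- The vertices visited by a walk. -/
def visited {n : ℕ} (w : Fin n → Step) : Set (ℤ × ℤ) := {v | ∃ j ≤ n, vertex w j = v}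

theorem vertex_snoc_of_le {n : ℕ} (w : Fin (n + 1) → Step) {i : ℕ} (hi : i ≤ n) :
    vertex w i = vertex (Fin.init w) i := by
  unfold vertex
  rw [Finset.sum_filter, Finset.sum_filter, Fin.sum_univ_castSucc]
  simp [Fin.init, Nat.not_lt.2 hi]

theorem vertex_snoc_last {n : ℕ} (w : Fin (n + 1) → Step) :
    vertex w (n + 1) = vertex (Fin.init w) n + (w (Fin.last n)).vec := by
  unfold vertex
  rw [Finset.sum_filter, Finset.sum_filter, Fin.sum_univ_castSucc]
  simp [Fin.init]

theorem visited_succ {n : ℕ} (w : Fin (n + 1) → Step) :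
    visited w = insert (vertex w (n + 1)) (visited (Fin.init w)) := by
  ext v
  simp only [visited, Set.mem_ofPred_eq, Set.mem_insert_iff]
  constructor
  · rintro ⟨j, hj, rfl⟩
    rcases Nat.le_succ_iff.1 hj with h | rfl
    · exact Or.inr ⟨j, h, (vertex_snoc_of_le w h).symm⟩
    · exact Or.inl rfl
  · rintro (rfl | ⟨j, hj, rfl⟩)
    · exact ⟨_, le_rfl, rfl⟩
    · exact ⟨j, by omega, vertex_snoc_of_le w hj⟩

theorem neCorner_of_le {n : ℕ} (w : Fin (n + 1) → Step) {m : ℕ} (hm : m ≤ n) :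
    neCorner w m = neCorner (Fin.init w) m := by
  unfold neCorner
  congr 1 <;>
  · refine Finset.sup'_congr _ rfl fun j hj => ?_
    rw [vertex_snoc_of_le w (by simp at hj; omega)]

theorem neCorner_succ {n : ℕ} (w : Fin n → Step) (m : ℕ) :
    neCorner w (m + 1) = (max (neCorner w m).1 (vertex w (m + 1)).1,
      max (neCorner w m).2 (vertex w (m + 1)).2) := by
  unfold neCorner
  simp only [Finset.range_add_one (n := m + 1)]
  congr 1 <;>
  · rw [Finset.sup'_insert, max_comm]

theorem isBox_visited {n : ℕ} (w : Fin n → Step) :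
    IsBox (visited w) (vertex w n) (neCorner w n).1 (neCorner w n).2 where
  mem := ⟨n, le_rfl, rfl⟩
  le := by
    rintro v ⟨j, hj, rfl⟩
    have : j ∈ Finset.range (n + 1) := by simp; omega
    exact ⟨Finset.le_sup' (fun j => (vertex w j).1) this,
      Finset.le_sup' (fun j => (vertex w j).2) this⟩
  right := by
    obtain ⟨j, hj, e⟩ := Finset.exists_mem_eq_sup' (s := Finset.range (n + 1))
      Finset.nonempty_range_add_one (fun j => (vertex w j).1)
    exact ⟨_, ⟨j, by simp at hj; omega, rfl⟩, e.symm⟩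
  top := by
    obtain ⟨j, hj, e⟩ := Finset.exists_mem_eq_sup' (s := Finset.range (n + 1))
      Finset.nonempty_range_add_one (fun j => (vertex w j).2)
    exact ⟨_, ⟨j, by simp at hj; omega, rfl⟩, e.symm⟩

theorem isPrudent_succ {n : ℕ} (w : Fin (n + 1) → Step) :
    IsPrudent w ↔ IsPrudent (Fin.init w) ∧ ∀ v ∈ visited (Fin.init w), ∀ k : ℕ, 0 < k →
      v ≠ vertex (Fin.init w) n + k • (w (Fin.last n)).vec := by
  unfold IsPrudent
  rw [Fin.forall_fin_succ']
  refine and_congr ?_ ?_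
  · refine forall_congr' fun i => forall_congr' fun j => ?_
    refine forall_congr' fun hj => ?_
    have hj' : j ≤ n := hj.trans i.2.le
    rw [vertex_snoc_of_le w hj', Fin.val_castSucc, vertex_snoc_of_le w i.2.le]
    rfl
  · constructor
    · rintro h _ ⟨j, hj, rfl⟩ k hk
      have := h j hj k hk
      rwa [vertex_snoc_of_le w hj, Fin.val_last, vertex_snoc_of_le w le_rfl] at this
    · intro h j hj k hk
      rw [vertex_snoc_of_le w hj, Fin.val_last, vertex_snoc_of_le w le_rfl]
      exact h _ ⟨j, hj, rfl⟩ k hk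

/-- The new corner is the coordinatewise maximum of the old corner and the new vertex. So the new
vertex lies on an edge of the new box exactly when it reaches the corresponding edge of the old one,
which is the inequality in `StepOk`. -/
theorem isTwoSided_succ {n : ℕ} (w : Fin (n + 1) → Step) :
    IsTwoSided w ↔ IsTwoSided (Fin.init w) ∧
      StepOk (visited (Fin.init w)) (vertex (Fin.init w) n) (neCorner (Fin.init w) n).1
        (neCorner (Fin.init w) n).2 (w (Fin.last n)) := by
  have key : (∀ m ≤ n + 1, (vertex w m).2 = (neCorner w m).2 ∨ (vertex w m).1 = (neCorner w m).1) ↔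
      (∀ m ≤ n, (vertex (Fin.init w) m).2 = (neCorner (Fin.init w) m).2 ∨
        (vertex (Fin.init w) m).1 = (neCorner (Fin.init w) m).1) ∧
      ((neCorner (Fin.init w) n).2 ≤ (vertex (Fin.init w) n + (w (Fin.last n)).vec).2 ∨
        (neCorner (Fin.init w) n).1 ≤ (vertex (Fin.init w) n + (w (Fin.last n)).vec).1) := by
    have last : ((vertex w (n + 1)).2 = (neCorner w (n + 1)).2 ∨
        (vertex w (n + 1)).1 = (neCorner w (n + 1)).1) ↔
        ((neCorner (Fin.init w) n).2 ≤ (vertex (Fin.init w) n + (w (Fin.last n)).vec).2 ∨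
        (neCorner (Fin.init w) n).1 ≤ (vertex (Fin.init w) n + (w (Fin.last n)).vec).1) := by
      rw [neCorner_succ, neCorner_of_le w le_rfl, vertex_snoc_last]
      simp only [right_eq_sup]
    rw [← last]
    constructor
    · intro h
      refine ⟨fun m hm => ?_, h _ le_rfl⟩
      have := h m (by omega)
      rwa [neCorner_of_le w hm, vertex_snoc_of_le w hm] at this
    · rintro ⟨h1, h2⟩ m hm
      rcases Nat.le_succ_iff.1 hm with h | rfl
      · rw [neCorner_of_le w h, vertex_snoc_of_le w h]
        exact h1 m h
      · exact h2
  unfold IsTwoSided StepOk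
  rw [key, isPrudent_succ]
  tauto

/-- The state of a walk, if the automaton accepts it. -/
def stateOf : {n : ℕ} → (Fin n → Step) → Option State
  | 0, _ => some .start
  | n + 1, w => (stateOf (Fin.init w)).bind fun σ => σ.next (w (Fin.last n))

/-- Acceptance of one more step relies on the invariant of the shorter walk, so the two claims go
through one induction. -/
theorem stateOf_spec {n : ℕ} (w : Fin n → Step) :
    (IsTwoSided w ↔ (stateOf w).isSome) ∧ ∀ σ, stateOf w = some σ →
      σ.Inv (visited w) (vertex w n) (neCorner w n).1 (neCorner w n).2 := by
  induction n with
  | zero =>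
    have hv : ∀ i, vertex w i = 0 := fun i => by simp [vertex]
    refine ⟨?_, ?_⟩
    · simp only [stateOf, Option.isSome_some, iff_true]
      exact ⟨fun i => i.elim0, fun m hm => by
        obtain rfl : m = 0 := by omega
        simp [neCorner, hv]⟩
    · rintro σ h
      simp only [stateOf, Option.some.injEq] at h
      subst h
      refine ⟨?_, hv _, by simp [neCorner, hv], by simp [neCorner, hv]⟩
      ext v
      simp [visited, hv, eq_comm]
  | succ n ih =>
    obtain ⟨ih1, ih2⟩ := ih (Fin.init w)
    rw [isTwoSided_succ, ih1]
    cases hσ : stateOf (Fin.init w) with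
    | none => simp [stateOf, hσ]
    | some τ =>
      have h := sound_next (isBox_visited _) (ih2 τ hσ) (w (Fin.last n))
      cases hτ : τ.next (w (Fin.last n)) with
      | none =>
        rw [hτ] at h
        simp only [stateOf, hσ, hτ, Option.bind_some, Option.isSome_some, true_and,
          Option.isSome_none, Bool.false_eq_true, iff_false, reduceCtorEq, false_imp_iff,
          implies_true, and_true]
        exact h
      | some τ' =>
        rw [hτ] at h
        simp only [stateOf, hσ, hτ, Option.bind_some, Option.isSome_some, true_and, iff_true,
          Option.some.injEq]
        refine ⟨h.1, ?_⟩
        rintro σ rfl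
        rw [visited_succ, vertex_snoc_last, neCorner_succ, vertex_snoc_last,
          neCorner_of_le w le_rfl]
        exact h.2

theorem State.Inv.dist_eq {σ : State} {V : Set (ℤ × ℤ)} {P : ℤ × ℤ} {X Y : ℤ}
    (h : σ.Inv V P X Y) : (X - P.1) + (Y - P.2) = σ.dist := by
  match σ with
  | .start =>
    obtain ⟨rfl, rfl, rfl, rfl⟩ := h
    rfl
  | .edge true m d =>
    obtain ⟨h1, h2, -⟩ := h
    simp only [State.dist]
    omega
  | .edge false m d =>
    obtain ⟨h1, h2, -⟩ := h
    simp only [State.dist, Prod.fst_swap, Prod.snd_swap] at *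
    omega

theorem State.dist_next_le {σ τ : State} {s : Step} (h : σ.next s = some τ) :
    τ.dist ≤ σ.dist + 1 := by
  have top : ∀ (m : Mode) (d : ℕ) (s : Step) (τ : State), topNext m d s = some τ →
      τ.dist ≤ d + 1 := by
    intro m d s τ h
    cases m <;> cases s <;> cases d <;> simp [topNext] at h <;> subst h <;>
      simp only [State.dist] <;> omega
  match σ, s with
  | .edge true m d, s => exact top m d s τ h
  | .edge false m d, s =>
    simp only [State.next, Option.map_eq_some_iff] at h
    obtain ⟨ρ, h, rfl⟩ := h
    have := top _ _ _ _ h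
    cases ρ <;> exact this
  | .start, .north | .start, .south | .start, .east | .start, .west =>
    simp [State.next] at h
    subst h
    simp [State.dist]

theorem dist_stateOf_le {n : ℕ} (w : Fin n → Step) {σ : State} (h : stateOf w = some σ) :
    σ.dist ≤ n := by
  induction n generalizing σ with
  | zero =>
    simp only [stateOf, Option.some.injEq] at h
    subst h
    rfl
  | succ n ih =>
    simp only [stateOf, Option.bind_eq_some_iff] at h
    obtain ⟨τ, h1, h2⟩ := h
    have := ih _ h1
    have := State.dist_next_le h2
    omega

end SquareWalk

/-! ### Transfer operator and generating function -/

namespace SquareWalk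

noncomputable instance (n : ℕ) : Fintype (TwoSidedWalk n) := Fintype.ofFinite _

/-- The sum over the words accepted by the automaton of the product of the step weights `z` and of
the weight `φ` of the final state. -/
noncomputable def weightSum (z : Step → ℂ) (φ : State → ℂ) (n : ℕ) : ℂ :=
  ∑ w : Fin n → Step, (∏ j, z (w j)) * (stateOf w).elim 0 φ

/-- The transfer operator of the automaton. -/
noncomputable def transfer (z : Step → ℂ) (φ : State → ℂ) (σ : State) : ℂ :=
  ∑ s, z s * (σ.next s).elim 0 φ

theorem weightSum_zero (z : Step → ℂ) (φ : State → ℂ) : weightSum z φ 0 = φ .start := by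
  simp [weightSum, stateOf]

/-- The last step is split off, so the operator acts on the weight of the final state. -/
theorem weightSum_succ (z : Step → ℂ) (φ : State → ℂ) (n : ℕ) :
    weightSum z φ (n + 1) = weightSum z (transfer z φ) n := by
  unfold weightSum
  rw [← (Fin.snocEquiv fun _ : Fin (n + 1) => Step).sum_comp, Fintype.sum_prod_type,
    Finset.sum_comm]
  refine Finset.sum_congr rfl fun w _ => ?_
  have h : ∀ s : Step, (Fin.snocEquiv fun _ : Fin (n + 1) => Step) (s, w) =
      Fin.snoc (α := fun _ => Step) w s := fun s => rfl
  simp only [h, Fin.prod_univ_castSucc, Fin.snoc_castSucc, Fin.snoc_last, stateOf, Fin.init_snoc]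
  cases stateOf w with
  | none => simp
  | some σ => simp [transfer, Finset.mul_sum, mul_assoc]

theorem weightSum_add_mul (z : Step → ℂ) (φ χ : State → ℂ) (t : ℂ) (n : ℕ) :
    weightSum z (fun σ => φ σ + t * χ σ) n = weightSum z φ n + t * weightSum z χ n := by
  unfold weightSum
  rw [Finset.mul_sum, ← Finset.sum_add_distrib]
  refine Finset.sum_congr rfl fun w _ => ?_
  cases stateOf w with
  | none => simp
  | some σ =>
    simp only [Option.elim_some]
    ring

/-- There are 4^n words, and the distance after n steps is at most n. -/
theorem norm_weightSum_le {z : Step → ℂ} {φ : State → ℂ} {K Q B : ℝ} (hQ : 1 ≤ Q) (hK : 0 ≤ K)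
    (hφ : ∀ σ, ‖φ σ‖ ≤ K * Q ^ σ.dist) (hz : ∀ s, ‖z s‖ ≤ B) (n : ℕ) :
    ‖weightSum z φ n‖ ≤ K * (4 * B * Q) ^ n := by
  have hB : 0 ≤ B := (norm_nonneg _).trans (hz .north)
  have card : Fintype.card Step = 4 := rfl
  calc ‖weightSum z φ n‖ ≤ ∑ w : Fin n → Step, B ^ n * (K * Q ^ n) := by
        refine (norm_sum_le _ _).trans (Finset.sum_le_sum fun w _ => ?_)
        rw [norm_mul, norm_prod]
        refine mul_le_mul ?_ ?_ (norm_nonneg _) (by positivity)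
        · refine (Finset.prod_le_prod (fun j _ => norm_nonneg _) fun j _ => hz (w j)).trans ?_
          simp
        · cases h : stateOf w with
          | none => simpa using by positivity
          | some σ =>
            refine (hφ σ).trans ?_
            have := dist_stateOf_le w h
            gcongr
    _ = K * (4 * B * Q) ^ n := by
        simp only [Finset.sum_const, Finset.card_univ, Fintype.card_fun, Fintype.card_fin, card,
          nsmul_eq_mul, Nat.cast_pow, Nat.cast_ofNat, mul_pow]
        ring

/-- A bounded solution of the transfer equation gives the generating function. -/
theorem hasSum_weightSum {z : Step → ℂ} {ψ c : State → ℂ} {t : ℂ} {K Q B : ℝ} (hQ : 1 ≤ Q)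
    (hK : 0 ≤ K) (hψ : ∀ σ, ‖ψ σ‖ ≤ K * Q ^ σ.dist) (hc : ∀ σ, ‖c σ‖ ≤ K * Q ^ σ.dist)
    (hz : ∀ s, ‖z s‖ ≤ B) (ht : 4 * B * Q * ‖t‖ < 1)
    (h : ∀ σ, c σ = ψ σ + t * transfer z c σ) :
    HasSum (fun n => weightSum z ψ n * t ^ n) (c .start) := by
  have hB : 0 ≤ B := (norm_nonneg _).trans (hz .north)
  have bound : ∀ {φ : State → ℂ}, (∀ σ, ‖φ σ‖ ≤ K * Q ^ σ.dist) → ∀ n,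
      ‖weightSum z φ n * t ^ n‖ ≤ K * (4 * B * Q * ‖t‖) ^ n := by
    intro φ hφ n
    rw [norm_mul, norm_pow, mul_pow (4 * B * Q), ← mul_assoc]
    exact mul_le_mul_of_nonneg_right (norm_weightSum_le hQ hK hφ hz n) (by positivity)
  have geom : Summable fun n : ℕ => K * (4 * B * Q * ‖t‖) ^ n :=
    (summable_geometric_of_lt_one (by positivity) ht).mul_left K
  -- Iterating c = ψ + t T c telescopes the partial sums; the remainder is geometrically small.
  have partialSum : ∀ N, ∑ n ∈ Finset.range N, weightSum z ψ n * t ^ n =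
      c .start - weightSum z c N * t ^ N := by
    intro N
    induction N with
    | zero => simp [weightSum_zero]
    | succ N ih =>
      have hN : weightSum z c N = weightSum z ψ N + t * weightSum z c (N + 1) := by
        rw [weightSum_succ, ← weightSum_add_mul]
        exact congrArg (fun φ => weightSum z φ N) (funext h)
      rw [Finset.sum_range_succ, ih, hN]
      ring
  rw [(Summable.of_norm_bounded geom (bound hψ)).hasSum_iff_tendsto_nat]
  simp only [partialSum]
  have := squeeze_zero_norm (bound hc) geom.tendsto_atTop_zero
  simpa using tendsto_const_nhds.sub this

theorem TwoSidedWalk.neDist_eq {n : ℕ} (w : TwoSidedWalk n) {σ : State}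
    (h : stateOf w.1 = some σ) : w.neDist = σ.dist :=
  ((stateOf_spec w.1).2 σ h).dist_eq

theorem TwoSidedWalk.exists_state {n : ℕ} (w : TwoSidedWalk n) :
    ∃ σ, stateOf w.1 = some σ :=
  Option.isSome_iff_exists.1 ((stateOf_spec w.1).1.1 w.2)

theorem TwoSidedWalk.neDist_nonneg {n : ℕ} (w : TwoSidedWalk n) : 0 ≤ w.neDist := by
  obtain ⟨σ, h⟩ := w.exists_state
  rw [w.neDist_eq h]
  positivity

theorem sum_twoSidedWalk (z : Step → ℂ) (q : ℂ) (n : ℕ) :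
    ∑ w : TwoSidedWalk n, (∏ j, z (w.1 j)) * q ^ w.neDist.toNat =
      weightSum z (fun σ => q ^ σ.dist) n := by
  classical
  unfold weightSum
  have h1 : ∀ w : TwoSidedWalk n, (∏ j, z (w.1 j)) * q ^ w.neDist.toNat =
      (∏ j, z (w.1 j)) * (stateOf w.1).elim 0 fun σ => q ^ σ.dist := by
    intro w
    obtain ⟨σ, h⟩ := w.exists_state
    rw [w.neDist_eq h, h]
    simp
  simp only [h1]
  refine (Finset.sum_subtype (Finset.univ.filter fun w : Fin n → Step => IsTwoSided w)
    (p := IsTwoSided) (by simp) fun w => (∏ j, z (w j)) *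
      (stateOf w).elim 0 fun σ => q ^ σ.dist).symm.trans ?_
  refine Finset.sum_filter_of_ne fun w _ hw => ?_
  rw [(stateOf_spec w).1]
  by_contra h
  rw [Option.not_isSome_iff_eq_none.1 h] at hw
  simp at hw

/-- Solution of the transfer equation along one edge of the box, up to a gauge factor. The
unknowns are the values in the three modes; `R` is the value after leaving the edge. -/
theorem exists_edge_solution {t a P V R : ℂ} (ht : t ≠ 0) (ha : a ≠ 0) (ht1 : t ^ 2 ≠ 1)
    (hV0 : V ≠ 0)
    (hV : (1 - t ^ 2 * V) * (V - 1) = a * t * V * (1 - t ^ 2))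
    (hPt : P ≠ t) (hP1 : 1 - t * P ≠ 0) (hPU : P ≠ t * V) (hU1 : 1 - t ^ 2 * V ≠ 0)
    (hPU1 : 1 - P * t * V ≠ 0) {Q : ℝ} (hPQ : ‖P‖ ≤ Q) (hUQ : ‖t * V‖ ≤ Q) :
    ∃ (F W E : ℕ → ℂ) (K : ℝ), 0 ≤ K ∧ (∀ d, ‖F d‖ ≤ K * Q ^ d) ∧ (∀ d, ‖W d‖ ≤ K * Q ^ d) ∧
      (∀ d, ‖E d‖ ≤ K * Q ^ d) ∧
      (∀ d, W d = P ^ d + a * t * F d + t * W (d + 1)) ∧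
      (∀ d, E (d + 1) = P ^ (d + 1) + a * t * F (d + 1) + t * E d) ∧
      E 0 = 1 + a * t * F 0 + t * R ∧
      (∀ d, F (d + 1) = P ^ (d + 1) + a * t * F (d + 1) + t * W (d + 2) + t * E d) ∧
      F 0 = 1 + a * t * F 0 + t * W 1 + t * R ∧
      F 0 = V * (1 - t ^ 2) / ((1 - t ^ 2 * V) * (1 - P * t * V)) + (V - 1) / a * R := by
  have h1t : 1 - t ^ 2 ≠ 0 := sub_ne_zero.2 (Ne.symm ht1)
  have hV1 : V - 1 ≠ 0 := by
    intro h
    rw [h, mul_zero, eq_comm] at hV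
    simp_all
  have hPt' : P - t ≠ 0 := sub_ne_zero.2 hPt
  have hPU' : P - t * V ≠ 0 := sub_ne_zero.2 hPU
  have geo : ∀ A B : ℂ, ∃ K : ℝ, 0 ≤ K ∧ ∀ d : ℕ, ‖A * P ^ d + B * (t * V) ^ d‖ ≤ K * Q ^ d := by
    intro A B
    refine ⟨‖A‖ + ‖B‖, by positivity, fun d => ?_⟩
    refine (norm_add_le _ _).trans ?_
    rw [norm_mul, norm_mul, norm_pow, norm_pow, add_mul]
    gcongr
  -- This is V times the kernel (1 - tP)(P - t) - atP(1 - t²), whose roots in P are tV and 1/(tV).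
  set N := (P - t * V) * (1 - P * t * V) with hN
  have hN0 : N ≠ 0 := mul_ne_zero hPU' hPU1
  -- the coefficients of the particular and of the homogeneous solution
  set α := (1 - t * P) * (P - t) * V / N with hα
  set C := P * V * (1 - t ^ 2) / N with hC
  have hαC : α = 1 + a * t * C := by
    rw [hα, hC, div_eq_iff hN0, add_mul, mul_div_assoc', div_mul_cancel₀ _ hN0, hN]
    linear_combination P * hV
  have hCα : C = α * (1 / (1 - t * P) + t / (P - t)) := by
    rw [div_add_div _ _ hP1 hPt', hα, hC, div_mul_div_comm,
      div_eq_div_iff hN0 (mul_ne_zero hN0 (mul_ne_zero hP1 hPt'))]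
    ring
  -- The coefficient of the homogeneous solution is fixed by the boundary condition: the formula for
  -- `E`, extended to d = -1, takes the value `R`.
  set β := t * (V - 1) * (R - (1 - t * P) * V / N) with hβ
  have hβα : R = α / (P - t) + β / (t * (V - 1)) := by
    rw [hβ, hα]
    field_simp
    ring
  set C' := β / (a * t) with hC'
  have hβC : β = a * t * C' := by
    rw [hC']
    field_simp
  -- The kernel equation `hV` is exactly what makes (tV)^d a homogeneous solution.
  have hCβ : C' = β * (1 / (1 - t ^ 2 * V) + t / (t * (V - 1))) := by
    rw [hC', div_eq_iff (mul_ne_zero ha ht)]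
    have : (1 / (1 - t ^ 2 * V) + t / (t * (V - 1))) * (a * t) = 1 := by
      field_simp
      linear_combination -hV
    linear_combination (-β) * this
  clear_value C C' α β
  obtain ⟨K1, hK1, h1⟩ := geo C C'
  obtain ⟨K2, hK2, h2⟩ := geo (α / (1 - t * P)) (β / (1 - t ^ 2 * V))
  obtain ⟨K3, hK3, h3⟩ := geo (α * P / (P - t)) (β * (t * V) / (t * (V - 1)))
  have hQ : 0 ≤ Q := (norm_nonneg _).trans hPQ
  have e1 : ∀ d : ℕ, α / (1 - t * P) * P ^ d + β / (1 - t ^ 2 * V) * (t * V) ^ d =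
      P ^ d + a * t * (C * P ^ d + C' * (t * V) ^ d) +
      t * (α / (1 - t * P) * P ^ (d + 1) + β / (1 - t ^ 2 * V) * (t * V) ^ (d + 1)) := by
    intro d
    have h1 : α / (1 - t * P) = α + t * P * (α / (1 - t * P)) := by
      field_simp
      ring
    have h2 : β / (1 - t ^ 2 * V) = β + t ^ 2 * V * (β / (1 - t ^ 2 * V)) := by
      field_simp
      ring
    rw [pow_succ, pow_succ]
    linear_combination P ^ d * h1 + (t * V) ^ d * h2 + P ^ d * hαC + (t * V) ^ d * hβC
  have e2 : ∀ d : ℕ, C * P ^ d + C' * (t * V) ^ d =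
      (α / (1 - t * P) * P ^ d + β / (1 - t ^ 2 * V) * (t * V) ^ d) +
      t * (α / (P - t) * P ^ d + β / (t * (V - 1)) * (t * V) ^ d) := by
    intro d
    linear_combination P ^ d * hCα + (t * V) ^ d * hCβ
  have e3 : ∀ d : ℕ, α * P / (P - t) * P ^ d + β * (t * V) / (t * (V - 1)) * (t * V) ^ d =
      α / (P - t) * P ^ (d + 1) + β / (t * (V - 1)) * (t * V) ^ (d + 1) := by
    intro d
    ring
  have e4 : ∀ d : ℕ, α * P / (P - t) * P ^ d + β * (t * V) / (t * (V - 1)) * (t * V) ^ d =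
      P ^ d + a * t * (C * P ^ d + C' * (t * V) ^ d) +
      t * (α / (P - t) * P ^ d + β / (t * (V - 1)) * (t * V) ^ d) := by
    intro d
    have h1 : α * P / (P - t) = α + t * (α / (P - t)) := by
      field_simp
      ring
    have h2 : β * (t * V) / (t * (V - 1)) = β + t * (β / (t * (V - 1))) := by
      field_simp
      ring
    linear_combination P ^ d * h1 + (t * V) ^ d * h2 + P ^ d * hαC + (t * V) ^ d * hβC
  refine ⟨fun d => C * P ^ d + C' * (t * V) ^ d,
    fun d => α / (1 - t * P) * P ^ d + β / (1 - t ^ 2 * V) * (t * V) ^ d,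
    fun d => α * P / (P - t) * P ^ d + β * (t * V) / (t * (V - 1)) * (t * V) ^ d,
    K1 + K2 + K3, by positivity, ?_, ?_, ?_, e1, ?_, ?_, ?_, ?_, ?_⟩
  · exact fun d => (h1 d).trans (by gcongr; linarith)
  · exact fun d => (h2 d).trans (by gcongr; linarith)
  · exact fun d => (h3 d).trans (by gcongr; linarith)
  · intro d
    exact (e4 (d + 1)).trans (by simp only [← e3 d])
  · have := e4 0
    rw [hβα]
    simpa using this
  · intro d
    have h := e2 (d + 1)
    rw [e1 (d + 1)] at h
    refine h.trans ?_
    rw [← e3 d]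
  · have h := e2 0
    rw [e1 0] at h
    rw [hβα]
    simpa using h
  · have hb : C' = (V - 1) / a * (R - α / (P - t)) := by
      rw [hC', hβα]
      field_simp
      ring
    have hα' : α / (P - t) = (1 - t * P) * V / N := by
      rw [hα]
      field_simp
    have key : C - (V - 1) / a * (α / (P - t)) =
        V * (1 - t ^ 2) / ((1 - t ^ 2 * V) * (1 - P * t * V)) := by
      have hva : (V - 1) / a = t * V * (1 - t ^ 2) / (1 - t ^ 2 * V) := by
        rw [div_eq_div_iff ha hU1]
        linear_combination hV
      rw [hva, hC, hα', hN]
      rw [div_mul_div_comm, div_sub_div _ _ hN0 (mul_ne_zero hU1 hN0), hN,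
        div_eq_div_iff (mul_ne_zero hN0 (mul_ne_zero hU1 hN0)) (mul_ne_zero hU1 hPU1)]
      ring
    simp only [pow_zero, mul_one]
    rw [← key, hb]
    ring

/-- The step weights for which a step in the direction of `(1, 0)` or `(0, 1)` and its reverse have
inverse weights. -/
noncomputable def stepWeight (a b : ℂ) : Step → ℂ
  | .north => a
  | .south => a⁻¹
  | .east => b
  | .west => b⁻¹

theorem transfer_eq (z : Step → ℂ) (φ : State → ℂ) (σ : State) :
    transfer z φ σ = z .north * (σ.next .north).elim 0 φ + z .south * (σ.next .south).elim 0 φ +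
      z .east * (σ.next .east).elim 0 φ + z .west * (σ.next .west).elim 0 φ := by
  unfold transfer
  rw [show (Finset.univ : Finset Step) = {.north, .south, .east, .west} from rfl,
    Finset.sum_insert (by decide), Finset.sum_insert (by decide), Finset.sum_insert (by decide),
    Finset.sum_singleton]
  ring

/-- The generating function of 2-sided walks, for small values of the length variable. -/
theorem hasSum_weightSum_stepWeight {t a b q V V' f r : ℂ} (ht : t ≠ 0) (ha : a ≠ 0) (hb : b ≠ 0)
    (ht1 : t ^ 2 ≠ 1) (hV0 : V ≠ 0) (hV0' : V' ≠ 0)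
    (hV : (1 - t ^ 2 * V) * (V - 1) = a * t * V * (1 - t ^ 2))
    (hV' : (1 - t ^ 2 * V') * (V' - 1) = b * t * V' * (1 - t ^ 2))
    (h1 : q / b ≠ t) (h1' : q / a ≠ t) (h2 : 1 - t * (q / b) ≠ 0) (h2' : 1 - t * (q / a) ≠ 0)
    (h3 : q / b ≠ t * V) (h3' : q / a ≠ t * V') (h4 : 1 - t ^ 2 * V ≠ 0) (h4' : 1 - t ^ 2 * V' ≠ 0)
    (h5 : 1 - q / b * t * V ≠ 0) (h5' : 1 - q / a * t * V' ≠ 0)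
    (hf : f = V * (1 - t ^ 2) / ((1 - t ^ 2 * V) * (1 - q / b * t * V)) + (V - 1) / a * (b * r))
    (hr : r = V' * (1 - t ^ 2) / ((1 - t ^ 2 * V') * (1 - q / a * t * V')) + (V' - 1) / b * (a * f))
    {B Q : ℝ} (hB : ∀ s, ‖stepWeight a b s‖ ≤ B) (hQb : ‖q / b‖ ≤ Q) (hQa : ‖q / a‖ ≤ Q)
    (hQV : ‖t * V‖ ≤ Q) (hQV' : ‖t * V'‖ ≤ Q) (hBQ : 1 ≤ B * Q)
    (hsmall : 4 * B * (B * Q) * ‖t‖ < 1) :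
    HasSum (fun n => weightSum (stepWeight a b) (fun σ => q ^ σ.dist) n * t ^ n)
      (-1 + (1 - a * t) * f + (1 - b * t) * r) := by
  obtain ⟨F, W, E, K, hK, bF, bW, bE, eW, eE, eE0, eF, eF0, hF0⟩ :=
    exists_edge_solution (R := b * r) ht ha ht1 hV0 hV h1 h2 h3 h4 h5 hQb hQV
  obtain ⟨F', W', E', K', hK', bF', bW', bE', eW', eE', eE0', eF', eF0', hF0'⟩ :=
    exists_edge_solution (R := a * f) ht hb ht1 hV0' hV' h1' h2' h3' h4' h5' hQa hQV'
  rw [← hf] at hF0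
  rw [← hr] at hF0'
  have hQ0 : 0 ≤ Q := (norm_nonneg _).trans hQb
  have hB0 : 0 ≤ B := (norm_nonneg _).trans (hB .north)
  have hqb : q = b * (q / b) := by field_simp
  have hqa : q = a * (q / a) := by field_simp
  set s := -1 + (1 - a * t) * f + (1 - b * t) * r with hs
  -- A step along an edge changes d by one, so the factors b^d and a^d absorb its weight. What
  -- remains is the edge system with P = q/b on the top edge and P = q/a on the right edge.
  let c : State → ℂ
    | .start => s
    | .edge true .free d => b ^ d * F d
    | .edge true .away d => b ^ d * W d
    | .edge true .toward d => b ^ d * E d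
    | .edge false .free d => a ^ d * F' d
    | .edge false .away d => a ^ d * W' d
    | .edge false .toward d => a ^ d * E' d
  have bound : ∀ {x : ℂ} {G : ℕ → ℂ} {L : ℝ}, ‖x‖ ≤ B → 0 ≤ L → L ≤ 1 + ‖s‖ + K + K' →
      (∀ d, ‖G d‖ ≤ L * Q ^ d) →
      ∀ d, ‖x ^ d * G d‖ ≤ (1 + ‖s‖ + K + K') * (B * Q) ^ d := by
    intro x G L hx hL hL' hG d
    rw [norm_mul, norm_pow, mul_pow, mul_left_comm]
    exact mul_le_mul (by gcongr) ((hG d).trans (by gcongr)) (norm_nonneg _) (by positivity)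
  have hKs := norm_nonneg s
  have hc : c .start = s := rfl
  rw [← hc]
  refine hasSum_weightSum (K := 1 + ‖s‖ + K + K') (Q := B * Q) (B := B) hBQ (by positivity)
    (fun σ => ?_) (fun σ => ?_) hB hsmall fun σ => ?_
  · rw [norm_pow]
    have : ‖q‖ ≤ B * Q := by
      rw [hqb, norm_mul]
      exact mul_le_mul (hB .east) hQb (norm_nonneg _) hB0
    calc ‖q‖ ^ σ.dist ≤ 1 * (B * Q) ^ σ.dist := by rw [one_mul]; gcongr
      _ ≤ _ := by gcongr; linarith
  · match σ with
    | .start => simp only [c, State.dist, pow_zero]; linarith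
    | .edge true .free d => exact bound (hB .east) hK (by linarith) bF d
    | .edge true .away d => exact bound (hB .east) hK (by linarith) bW d
    | .edge true .toward d => exact bound (hB .east) hK (by linarith) bE d
    | .edge false .free d => exact bound (hB .north) hK' (by linarith) bF' d
    | .edge false .away d => exact bound (hB .north) hK' (by linarith) bW' d
    | .edge false .toward d => exact bound (hB .north) hK' (by linarith) bE' d
  · rw [transfer_eq]
    have pb : ∀ d : ℕ, q ^ d = b ^ d * (q / b) ^ d := fun d => by rw [← mul_pow, ← hqb]
    have pa : ∀ d : ℕ, q ^ d = a ^ d * (q / a) ^ d := fun d => by rw [← mul_pow, ← hqa]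
    have ib : ∀ d : ℕ, b⁻¹ * b ^ (d + 1) = b ^ d := fun d => by
      rw [pow_succ', inv_mul_cancel_left₀ hb]
    have ia : ∀ d : ℕ, a⁻¹ * a ^ (d + 1) = a ^ d := fun d => by
      rw [pow_succ', inv_mul_cancel_left₀ ha]
    match σ with
    -- The values `W 1` and `W' 1` are eliminated by means of `eF0` and `eF0'`, whence the form of
    -- `s`.
    | .start =>
      simp only [c, State.next, State.dist, Option.elim_some, stepWeight, pow_zero, pow_one,
        one_mul, inv_mul_cancel_left₀ ha, inv_mul_cancel_left₀ hb]
      rw [hF0, hF0', hs]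
      rw [hF0] at eF0
      rw [hF0'] at eF0'
      linear_combination eF0 + eF0'
    | .edge true .free 0 =>
      simp only [c, State.next, topNext, State.dist, Option.elim_some, Option.elim_none, stepWeight,
        pow_zero, zero_add, pow_one, one_mul, inv_mul_cancel_left₀ hb, hF0']
      linear_combination eF0
    | .edge true .free (d + 1) =>
      simp only [c, State.next, topNext, State.dist, Option.elim_some, Option.elim_none, stepWeight]
      rw [pb]
      linear_combination b ^ (d + 1) * eF d - t * W (d + 1 + 1) * ib (d + 1)
    | .edge true .away d =>
      simp only [c, State.next, topNext, State.dist, Option.elim_some, Option.elim_none, stepWeight]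
      rw [pb]
      linear_combination b ^ d * eW d - t * W (d + 1) * ib d
    | .edge true .toward 0 =>
      simp only [c, State.next, topNext, State.dist, Option.elim_some, Option.elim_none, stepWeight,
        pow_zero, one_mul, hF0']
      linear_combination eE0
    | .edge true .toward (d + 1) =>
      simp only [c, State.next, topNext, State.dist, Option.elim_some, Option.elim_none, stepWeight]
      rw [pb]
      linear_combination b ^ (d + 1) * eE d
    | .edge false .free 0 =>
      simp only [c, State.next, topNext, State.dist, Option.elim_some, Option.elim_none, stepWeight,
        Step.swap, Option.map_some, Option.map_none, State.swap, Bool.not_true, Bool.not_false,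
        pow_zero, zero_add, pow_one, one_mul, inv_mul_cancel_left₀ ha, hF0]
      linear_combination eF0'
    | .edge false .free (d + 1) =>
      simp only [c, State.next, topNext, State.dist, Option.elim_some, Option.elim_none, stepWeight,
        Step.swap, Option.map_some, Option.map_none, State.swap, Bool.not_true]
      rw [pa]
      linear_combination a ^ (d + 1) * eF' d - t * W' (d + 1 + 1) * ia (d + 1)
    | .edge false .away d =>
      simp only [c, State.next, topNext, State.dist, Option.elim_some, Option.elim_none, stepWeight,
        Step.swap, Option.map_some, Option.map_none, State.swap, Bool.not_true]
      rw [pa]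
      linear_combination a ^ d * eW' d - t * W' (d + 1) * ia d
    | .edge false .toward 0 =>
      simp only [c, State.next, topNext, State.dist, Option.elim_some, Option.elim_none, stepWeight,
        Step.swap, Option.map_some, Option.map_none, State.swap, Bool.not_true, Bool.not_false,
        pow_zero, one_mul, hF0]
      linear_combination eE0'
    | .edge false .toward (d + 1) =>
      simp only [c, State.next, topNext, State.dist, Option.elim_some, Option.elim_none, stepWeight,
        Step.swap, Option.map_some, Option.map_none, State.swap, Bool.not_true]
      rw [pa]
      linear_combination a ^ (d + 1) * eE' d

end SquareWalk

/-! ### Coefficient asymptotics at a simple pole, uniformly in a parameter -/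

section PowerSeriesCoefficients

open Metric Function

/-- The coefficients of a power series are the Taylor coefficients of its sum. -/
theorem AnalyticAt.coeff_eq_iteratedDeriv {f : ℂ → ℂ} {a : ℕ → ℂ} (hf : AnalyticAt ℂ f 0)
    (h : ∀ᶠ z in 𝓝 0, HasSum (fun n => a n * z ^ n) (f z)) (n : ℕ) :
    a n = iteratedDeriv n f 0 / n.factorial := by
  have h1 : HasFPowerSeriesAt f (FormalMultilinearSeries.ofScalars ℂ a) 0 := by
    rw [hasFPowerSeriesAt_iff]
    filter_upwards [h] with z hz
    simpa [mul_comm] using hz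
  have h2 := h1.eq_formalMultilinearSeries hf.hasFPowerSeriesAt
  simpa using congrArg (fun p => FormalMultilinearSeries.coeff p n) h2

/-- Cauchy's estimate for the coefficients of a power series. -/
theorem AnalyticOnNhd.norm_coeff_le {f : ℂ → ℂ} {a : ℕ → ℂ} {R C : ℝ} (hR : 0 < R)
    (hf : AnalyticOnNhd ℂ f (closedBall 0 R)) (hC : ∀ z ∈ sphere (0 : ℂ) R, ‖f z‖ ≤ C)
    (h : ∀ᶠ z in 𝓝 0, HasSum (fun n => a n * z ^ n) (f z)) (n : ℕ) :
    ‖a n‖ ≤ C / R ^ n := by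
  rw [(hf 0 (mem_closedBall_self hR.le)).coeff_eq_iteratedDeriv h n, norm_div,
    Complex.norm_natCast]
  have hd : DiffContOnCl ℂ f (ball 0 R) := by
    refine DifferentiableOn.diffContOnCl ?_
    rw [closure_ball _ hR.ne']
    exact hf.differentiableOn
  have := Complex.norm_iteratedDeriv_le_of_forall_mem_sphere_norm_le n hR hd hC
  have hn : (0 : ℝ) < n.factorial := by positivity
  rw [div_le_iff₀ hn]
  calc _ ≤ _ := this
    _ = _ := by ring

/-- The function `dslope D ρ` is analytic where `D` is. -/
theorem AnalyticOnNhd.dslope_closedBall {D : ℂ → ℂ} {R : ℝ} {ρ : ℂ} (hρ : ρ ∈ ball (0 : ℂ) R)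
    (hD : AnalyticOnNhd ℂ D (closedBall 0 R)) :
    AnalyticOnNhd ℂ (dslope D ρ) (closedBall 0 R) := by
  have ho : IsOpen {z | AnalyticAt ℂ D z} := isOpen_analyticAt ℂ D
  have hd : DifferentiableOn ℂ D {z | AnalyticAt ℂ D z} := fun z hz =>
    hz.differentiableAt.differentiableWithinAt
  have := (Complex.differentiableOn_dslope (ho.mem_nhds (hD ρ (ball_subset_closedBall hρ)))).2 hd
  exact fun z hz => this.analyticAt (ho.mem_nhds (hD z hz))

/-- If the denominator of a meromorphic function has a unique zero in a closed disc and this zero is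
simple, then the coefficients of the function are given by the pole, up to an explicit error. -/
theorem norm_coeff_sub_le {N D : ℂ → ℂ} {R C : ℝ} {ρ : ℂ} {a : ℕ → ℂ}
    (hN : AnalyticOnNhd ℂ N (closedBall 0 R)) (hD : AnalyticOnNhd ℂ D (closedBall 0 R))
    (hρ : ρ ∈ ball (0 : ℂ) R) (hρ0 : ρ ≠ 0) (hzero : D ρ = 0) (hsimple : deriv D ρ ≠ 0)
    (huniq : ∀ t ∈ closedBall (0 : ℂ) R, D t = 0 → t = ρ)
    (ha : ∀ᶠ t in 𝓝 0, HasSum (fun n => a n * t ^ n) (N t / D t))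
    (hC : ∀ t ∈ sphere (0 : ℂ) R,
      ‖N t / D t - -N ρ / (ρ * deriv D ρ) / (1 - t / ρ)‖ ≤ C) (n : ℕ) :
    ‖a n - -N ρ / (ρ * deriv D ρ) * (ρ⁻¹) ^ n‖ ≤ C / R ^ n := by
  have hR : 0 < R := (norm_nonneg _).trans_lt (mem_ball_zero_iff.1 hρ)
  -- Write D = (t - ρ) D₁ with D₁ zero-free. The divided difference at ρ of N / D₁ is N / D minus
  -- its polar part, hence analytic on the whole disc, and Cauchy's estimate bounds its
  -- coefficients.
  have hD1 := hD.dslope_closedBall hρ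
  have hD1ne : ∀ t ∈ closedBall (0 : ℂ) R, dslope D ρ t ≠ 0 := by
    intro t ht
    by_cases h : t = ρ
    · rwa [h, dslope_same]
    · rw [dslope_of_ne _ h, slope_def_field, hzero, sub_zero]
      exact div_ne_zero (fun h0 => h (huniq t ht h0)) (sub_ne_zero.2 h)
  have hG : AnalyticOnNhd ℂ (fun t => N t / dslope D ρ t) (closedBall 0 R) :=
    fun t ht => (hN t ht).div (hD1 t ht) (hD1ne t ht)
  have hH := hG.dslope_closedBall hρ
  have key : ∀ t ≠ ρ, dslope (fun t => N t / dslope D ρ t) ρ t =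
      N t / D t - -N ρ / (ρ * deriv D ρ) / (1 - t / ρ) := by
    intro t ht
    have h1 : t - ρ ≠ 0 := sub_ne_zero.2 ht
    have h2 : ρ - t ≠ 0 := sub_ne_zero.2 ht.symm
    rw [dslope_of_ne _ ht, slope_def_field, dslope_same, dslope_of_ne _ ht, slope_def_field, hzero,
      sub_zero, sub_div]
    congr 1
    · rw [div_div_eq_mul_div, div_div, mul_div_mul_right _ _ h1]
    · have h3 : 1 - t / ρ = (ρ - t) / ρ := by field_simp
      rw [h3, div_div, div_div, div_eq_div_iff (mul_ne_zero hsimple h1)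
        (mul_ne_zero (mul_ne_zero hρ0 hsimple) (div_ne_zero h2 hρ0))]
      field_simp
      ring
  refine hH.norm_coeff_le (a := fun n => a n - -N ρ / (ρ * deriv D ρ) * (ρ⁻¹) ^ n) hR
    (fun t ht => ?_) ?_ n
  · rw [key t fun h => ?_]
    · exact hC t ht
    · rw [h, mem_sphere_zero_iff_norm] at ht
      exact (mem_ball_zero_iff.1 hρ).ne ht
  · have small : ∀ᶠ t : ℂ in 𝓝 0, ‖t‖ < ‖ρ‖ := by
      have : ball (0 : ℂ) ‖ρ‖ ∈ 𝓝 0 := ball_mem_nhds _ (norm_pos_iff.2 hρ0)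
      filter_upwards [this] with t ht using mem_ball_zero_iff.1 ht
    filter_upwards [ha, small] with t ht hlt
    rw [key t fun h => hlt.ne (by rw [h])]
    have hg : ‖t / ρ‖ < 1 := by rwa [norm_div, div_lt_one (norm_pos_iff.2 hρ0)]
    have := ht.sub ((hasSum_geometric_of_norm_lt_one hg).mul_left (-N ρ / (ρ * deriv D ρ)))
    rw [← div_eq_mul_inv] at this
    refine this.congr_fun ?_
    intro n
    rw [div_pow, inv_pow]
    ring

/-- A tube argument; it makes the constant in Cauchy's estimate independent of the parameter. -/
theorem IsCompact.exists_eventually_norm_le {X Y : Type*} [TopologicalSpace X] [TopologicalSpace Y]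
    {K : Set Y} (hK : IsCompact K) {Φ : X → Y → ℂ} {x₀ : X}
    (h : ∀ y ∈ K, ContinuousAt (uncurry Φ) (x₀, y)) :
    ∃ C : ℝ, ∀ᶠ x in 𝓝 x₀, ∀ y ∈ K, ‖Φ x y‖ ≤ C := by
  have hc : ContinuousOn (Φ x₀) K := fun y hy =>
    ((h y hy).comp (f := fun y => (x₀, y)) (by fun_prop)).continuousWithinAt
  obtain ⟨C, hC⟩ := hK.exists_bound_of_continuousOn hc
  refine ⟨C + 1, hK.eventually_forall_of_forall_eventually (P := fun x y => ‖Φ x y‖ ≤ C + 1)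
    fun y hy => ?_⟩
  have h1 : ‖uncurry Φ (x₀, y)‖ < C + 1 := (hC y hy).trans_lt (lt_add_one C)
  filter_upwards [(h y hy).norm.eventually (gt_mem_nhds h1)] with z hz using hz.le

/-- Uniform asymptotics of the coefficients of a family of meromorphic functions `N x / D x`, when
for `x = x₀` the denominator has a unique zero in a closed disc and this zero is simple. -/
theorem exists_tendstoUniformlyOn_coeff {N D : ℂ → ℂ → ℂ} {x₀ ρ₀ : ℂ} {R : ℝ} (hρ₀ : ρ₀ ≠ 0)
    (hρR : ρ₀ ∈ ball (0 : ℂ) R) (hN : ∀ t ∈ closedBall (0 : ℂ) R, AnalyticAt ℂ (uncurry N) (x₀, t))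
    (hD : ∀ t ∈ closedBall (0 : ℂ) R, AnalyticAt ℂ (uncurry D) (x₀, t))
    (hzero : ∀ t ∈ closedBall (0 : ℂ) R, D x₀ t = 0 ↔ t = ρ₀) (hsimple : deriv (D x₀) ρ₀ ≠ 0)
    {a : ℕ → ℂ → ℂ}
    (ha : ∀ᶠ x in 𝓝 x₀, ∀ᶠ t in 𝓝 0, HasSum (fun n => a n x * t ^ n) (N x t / D x t)) :
    ∃ ρ : ℂ → ℂ, AnalyticAt ℂ ρ x₀ ∧ ρ x₀ = ρ₀ ∧
      (∀ᶠ x in 𝓝 x₀, ρ x ∈ ball (0 : ℂ) R ∧ D x (ρ x) = 0) ∧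
      ∃ U ∈ 𝓝 x₀, TendstoUniformlyOn (fun n x => a n x * ρ x ^ n)
        (fun x => -N x (ρ x) / (ρ x * deriv (D x) (ρ x))) atTop U := by
  have hρR' : ρ₀ ∈ closedBall (0 : ℂ) R := ball_subset_closedBall hρR
  have hcomp : IsCompact (closedBall (0 : ℂ) R) := isCompact_closedBall _ _
  -- analyticity persists for nearby parameters
  have evan : ∀ {F : ℂ → ℂ → ℂ}, (∀ t ∈ closedBall (0 : ℂ) R, AnalyticAt ℂ (uncurry F) (x₀, t)) →
      ∀ᶠ x in 𝓝 x₀, ∀ t ∈ closedBall (0 : ℂ) R, AnalyticAt ℂ (uncurry F) (x, t) := fun hF =>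
    hcomp.eventually_forall_of_forall_eventually fun t ht => (hF t ht).eventually_analyticAt
  have slice : ∀ {F : ℂ → ℂ → ℂ} {x t : ℂ}, AnalyticAt ℂ (uncurry F) (x, t) →
      AnalyticAt ℂ (F x) t := fun {F x t} h =>
    h.comp (g := uncurry F) (f := fun t => (x, t)) (analyticAt_const.prod analyticAt_id)
  have derivEq : ∀ {x t : ℂ}, AnalyticAt ℂ (uncurry D) (x, t) →
      deriv (D x) t = fderiv ℂ (uncurry D) (x, t) (0, 1) := by
    intro x t h
    have h1 : HasDerivAt (fun t : ℂ => (x, t)) ((0 : ℂ), (1 : ℂ)) t :=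
      (hasDerivAt_const t x).prodMk (hasDerivAt_id t)
    exact (h.differentiableAt.hasFDerivAt.comp_hasDerivAt t h1).deriv
  -- the implicit function
  have cd : ContDiffAt ℂ ⊤ (uncurry D) (x₀, ρ₀) := (hD ρ₀ hρR').contDiffAt
  have hne : (⊤ : WithTop ℕ∞) ≠ 0 := by simp
  have inv : (fderiv ℂ (uncurry D) (x₀, ρ₀) ∘L .inr ℂ ℂ ℂ).IsInvertible := by
    rw [derivEq (hD ρ₀ hρR')] at hsimple
    refine ⟨ContinuousLinearEquiv.unitsEquivAut ℂ (Units.mk0 _ hsimple), ?_⟩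
    ext
    simp
  set ρ := cd.implicitFunction hne inv with hρdef
  have hρan : AnalyticAt ℂ ρ x₀ := (cd.contDiffAt_implicitFunction hne inv).analyticAt
  have hρx : ρ x₀ = ρ₀ := cd.implicitFunction_apply_self hne inv
  have hD0 : uncurry D (x₀, ρ₀) = 0 := (hzero ρ₀ hρR').2 rfl
  have hρroot : ∀ᶠ x in 𝓝 x₀, D x (ρ x) = 0 := by
    filter_upwards [cd.eventually_apply_implicitFunction hne inv] with x hx
    rwa [hD0] at hx
  -- Near (x₀, ρ₀) the implicit function theorem gives uniqueness of the zero; near the other points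
  -- of the compact disc D stays nonzero.
  have huniq : ∀ᶠ x in 𝓝 x₀, ∀ t ∈ closedBall (0 : ℂ) R, D x t = 0 → t = ρ x := by
    refine hcomp.eventually_forall_of_forall_eventually fun t ht => ?_
    by_cases h : t = ρ₀
    · rw [h]
      filter_upwards [cd.eventually_apply_eq_iff_implicitFunction hne inv] with v hv h0
      rw [hD0] at hv
      exact (hv.1 h0).symm
    · have h0 : uncurry D (x₀, t) ≠ 0 := fun h0 => h ((hzero t ht).1 h0)
      filter_upwards [(hD t ht).continuousAt.eventually_ne h0] with v hv h1
      exact absurd h1 hv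
  -- With |ρ(x)| < r < R, the error term multiplied by ρ(x)^n is at most C (r/R)^n.
  obtain ⟨r, hr1, hr2⟩ := exists_between (mem_ball_zero_iff.1 hρR)
  have hr0 : 0 < r := (norm_nonneg _).trans_lt hr1
  have hR0 : 0 < R := hr0.trans hr2
  have hρr : ∀ᶠ x in 𝓝 x₀, ‖ρ x‖ < r :=
    hρan.continuousAt.norm.eventually (gt_mem_nhds (by simpa only [hρx] using hr1))
  have hρ0 : ∀ᶠ x in 𝓝 x₀, ρ x ≠ 0 := hρan.continuousAt.eventually_ne (by rwa [hρx])
  -- the residue depends continuously on the parameter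
  set c : ℂ → ℂ := fun x =>
    -uncurry N (x, ρ x) / (ρ x * fderiv ℂ (uncurry D) (x, ρ x) (0, 1)) with hc
  have pair : ContinuousAt (fun x => (x, ρ x)) x₀ := continuousAt_id.prodMk hρan.continuousAt
  have hcc : ContinuousAt c x₀ := by
    have h1 : ContinuousAt (fun x => uncurry N (x, ρ x)) x₀ :=
      ContinuousAt.comp (g := uncurry N) (by rw [hρx]; exact (hN ρ₀ hρR').continuousAt) pair
    have h2 : ContinuousAt (fun x => fderiv ℂ (uncurry D) (x, ρ x)) x₀ :=
      ContinuousAt.comp (g := fderiv ℂ (uncurry D))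
        (by rw [hρx]; exact (hD ρ₀ hρR').fderiv.continuousAt) pair
    refine h1.neg.div (hρan.continuousAt.mul (h2.clm_apply continuousAt_const)) ?_
    rw [hρx, ← derivEq (hD ρ₀ hρR')]
    exact mul_ne_zero hρ₀ hsimple
  have hnear : ∀ᶠ x in 𝓝 x₀, c x = -N x (ρ x) / (ρ x * deriv (D x) (ρ x)) := by
    filter_upwards [evan hD, hρr] with x hx hlt
    rw [derivEq (hx _ (mem_closedBall_zero_iff.2 (hlt.trans hr2).le))]
    rfl
  obtain ⟨C, hC⟩ := (isCompact_sphere (0 : ℂ) R).exists_eventually_norm_le (x₀ := x₀)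
    (Φ := fun x t => N x t / D x t - c x / (1 - t / ρ x)) (by
      intro t ht
      have ht' : t ∈ closedBall (0 : ℂ) R := sphere_subset_closedBall ht
      have htρ : t ≠ ρ₀ := by
        rintro rfl
        exact (mem_ball_zero_iff.1 hρR).ne (mem_sphere_zero_iff_norm.1 ht)
      refine ((hN t ht').continuousAt.div (hD t ht').continuousAt
        fun h0 => htρ ((hzero t ht').1 h0)).sub ?_
      have fst : ContinuousAt (Prod.fst : ℂ × ℂ → ℂ) (x₀, t) := continuousAt_fst
      refine (ContinuousAt.comp (g := c) hcc fst).div (continuousAt_const.sub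
        (continuousAt_snd.div (ContinuousAt.comp (g := ρ) hρan.continuousAt fst) ?_)) ?_
      · simpa [hρx] using hρ₀
      · simp only [hρx]
        rw [sub_ne_zero, ne_comm, Ne, div_eq_one_iff_eq hρ₀]
        exact htρ)
  have hderiv : ∀ᶠ x in 𝓝 x₀, deriv (D x) (ρ x) ≠ 0 := by
    have h2 : ContinuousAt (fun x => fderiv ℂ (uncurry D) (x, ρ x) (0, 1)) x₀ :=
      (ContinuousAt.comp (g := fderiv ℂ (uncurry D))
        (by rw [hρx]; exact (hD ρ₀ hρR').fderiv.continuousAt) pair).clm_apply continuousAt_const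
    have h3 : fderiv ℂ (uncurry D) (x₀, ρ x₀) (0, 1) ≠ 0 := by
      rwa [hρx, ← derivEq (hD ρ₀ hρR')]
    filter_upwards [h2.eventually_ne h3, evan hD, hρr] with x hx hx' hlt
    rwa [derivEq (hx' _ (mem_closedBall_zero_iff.2 (hlt.trans hr2).le))]
  obtain ⟨U, hU, hall⟩ := ((evan hN).and ((evan hD).and (huniq.and (hρroot.and
    (hρr.and (hρ0.and (hC.and (hnear.and (ha.and hderiv))))))))).exists_mem
  refine ⟨ρ, hρan, hρx, ?_, U, hU, ?_⟩
  · filter_upwards [hρr, hρroot] with x h1 h2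
    exact ⟨mem_ball_zero_iff.2 (h1.trans hr2), h2⟩
  · have geo : Tendsto (fun n : ℕ => C * (r / R) ^ n) atTop (𝓝 0) := by
      have := tendsto_pow_atTop_nhds_zero_of_lt_one (div_nonneg hr0.le hR0.le)
        ((div_lt_one hR0).2 hr2)
      simpa using this.const_mul C
    rw [Metric.tendstoUniformlyOn_iff]
    intro ε hε
    filter_upwards [geo.eventually (gt_mem_nhds hε)] with n hn x hx
    obtain ⟨h1, h2, h3, h4, h5, h6, h7, h8, h9, h10⟩ := hall x hx
    have hmem : ρ x ∈ ball (0 : ℂ) R := mem_ball_zero_iff.2 (h5.trans hr2)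
    have := norm_coeff_sub_le (fun t ht => slice (h1 t ht)) (fun t ht => slice (h2 t ht)) hmem h6
      h4 h10 h3 h9 (by simpa only [h8] using h7) n
    rw [dist_comm, dist_eq_norm]
    refine lt_of_le_of_lt ?_ hn
    have e : a n x * ρ x ^ n - -N x (ρ x) / (ρ x * deriv (D x) (ρ x)) =
        (a n x - -N x (ρ x) / (ρ x * deriv (D x) (ρ x)) * (ρ x)⁻¹ ^ n) * ρ x ^ n := by
      rw [sub_mul, mul_assoc _ ((ρ x)⁻¹ ^ n), ← mul_pow, inv_mul_cancel₀ h6, one_pow, mul_one]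
    have hC0 : 0 ≤ C / R ^ n := (norm_nonneg _).trans this
    rw [e, norm_mul, norm_pow, div_pow, mul_div_assoc', mul_div_right_comm]
    exact mul_le_mul this (pow_le_pow_left₀ (norm_nonneg _) h5.le n) (by positivity) hC0

end PowerSeriesCoefficients

/-! ### The algebraic function `growth` and the closed form of the generating function -/

namespace SquareWalk

open Metric

/-- The linear coefficient of the quadratic equation of `growth`. -/
noncomputable def linCoeff (u t : ℂ) : ℂ := 1 + t ^ 2 - u * t * (1 - t ^ 2)

/-- A square root of the discriminant of the quadratic equation of `growth`. -/
noncomputable def discrRoot (u t : ℂ) : ℂ :=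
  (1 - t ^ 2) ^ ((2 : ℂ)⁻¹) * (1 - t - u * t - u * t ^ 2) ^ ((2 : ℂ)⁻¹) *
    (1 + t - u * t + u * t ^ 2) ^ ((2 : ℂ)⁻¹)

/-- The power series `V` with `V = 1 + O(t)` and `(1 - t² V) (V - 1) = u t V (1 - t²)`. The
generating function of the walks that stay on one edge of the box and end at distance `d` from the
corner is proportional to `(t V) ^ d`. -/
noncomputable def growth (u t : ℂ) : ℂ := 2 / (linCoeff u t + discrRoot u t)

/-- The discriminant is (L - 2t)(L + 2t) with L = `linCoeff u t`, and 1 - t and 1 + t split off from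
these factors. Taking principal roots factor by factor keeps the product analytic wherever each
factor avoids the cut. -/
theorem discrRoot_sq (u t : ℂ) : discrRoot u t ^ 2 = linCoeff u t ^ 2 - 4 * t ^ 2 := by
  have h : ∀ z : ℂ, (z ^ ((2 : ℂ)⁻¹)) ^ 2 = z := fun z => by
    simp
  rw [discrRoot, mul_pow, mul_pow, h, h, h, linCoeff]
  ring

/-- The product with its conjugate is 4t², so a zero forces t = 0, where the sum is 2. Hence the
rationalised form of `growth` has no spurious singularity at t = 0. -/
theorem linCoeff_add_discrRoot_ne_zero (u t : ℂ) : linCoeff u t + discrRoot u t ≠ 0 := by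
  intro h
  have h1 : (linCoeff u t + discrRoot u t) * (linCoeff u t - discrRoot u t) = 4 * t ^ 2 := by
    linear_combination -discrRoot_sq u t
  rw [h, zero_mul] at h1
  have ht : t = 0 := by simpa using h1.symm
  norm_num [ht, linCoeff, discrRoot] at h

theorem growth_ne_zero (u t : ℂ) : growth u t ≠ 0 :=
  div_ne_zero two_ne_zero (linCoeff_add_discrRoot_ne_zero u t)

theorem growth_quadratic (u t : ℂ) :
    t ^ 2 * growth u t ^ 2 - linCoeff u t * growth u t + 1 = 0 := by
  have h := linCoeff_add_discrRoot_ne_zero u t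
  rw [growth]
  field_simp
  linear_combination discrRoot_sq u t

theorem growth_kernel (u t : ℂ) :
    (1 - t ^ 2 * growth u t) * (growth u t - 1) = u * t * growth u t * (1 - t ^ 2) := by
  have := growth_quadratic u t
  rw [linCoeff] at this
  linear_combination -this

@[simp] theorem growth_zero (u : ℂ) : growth u 0 = 1 := by
  norm_num [growth, linCoeff, discrRoot]

/-- A zero makes the right side of the kernel equation vanish, which forces t = 0, and there the
expression is 1. -/
theorem one_sub_sq_mul_growth_ne_zero {u t : ℂ} (hu : u ≠ 0) (ht : t ^ 2 ≠ 1) :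
    1 - t ^ 2 * growth u t ≠ 0 := by
  intro h
  have h1 := growth_kernel u t
  rw [h, zero_mul, eq_comm] at h1
  have ht0 : t = 0 := by
    simpa [hu, growth_ne_zero, sub_eq_zero, ht.symm] using h1
  simp [ht0] at h

theorem analyticAt_growth {E : Type*} [NormedAddCommGroup E] [NormedSpace ℂ E] {f g : E → ℂ} {x : E}
    (hf : AnalyticAt ℂ f x) (hg : AnalyticAt ℂ g x) (h1 : 1 - g x ^ 2 ∈ Complex.slitPlane)
    (h2 : 1 - g x - f x * g x - f x * g x ^ 2 ∈ Complex.slitPlane)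
    (h3 : 1 + g x - f x * g x + f x * g x ^ 2 ∈ Complex.slitPlane) :
    AnalyticAt ℂ (fun y => growth (f y) (g y)) x := by
  unfold growth
  refine analyticAt_const.div ?_ (linCoeff_add_discrRoot_ne_zero _ _)
  unfold linCoeff discrRoot
  refine AnalyticAt.add (by fun_prop) (AnalyticAt.mul (AnalyticAt.mul ?_ ?_) ?_)
  · exact AnalyticAt.cpow (by fun_prop) analyticAt_const h1
  · exact AnalyticAt.cpow (by fun_prop) analyticAt_const h2
  · exact AnalyticAt.cpow (by fun_prop) analyticAt_const h3

theorem analyticAt_growth_zero (u : ℂ) : AnalyticAt ℂ (growth u) 0 :=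
  analyticAt_growth (f := fun _ => u) (g := fun t => t) analyticAt_const analyticAt_id
    (by simp) (by simp) (by simp)

theorem one_sub_mem_slitPlane {z : ℂ} (hz : ‖z‖ < 1) : 1 - z ∈ Complex.slitPlane := by
  left
  have := (Complex.re_le_norm z).trans_lt hz
  simp
  linarith

/-- The conditions for the analyticity of `growth` hold near `u = 1` in a disc. -/
theorem analyticAt_growth_one {E : Type*} [NormedAddCommGroup E] [NormedSpace ℂ E] {f g : E → ℂ}
    {x : E} (hf : AnalyticAt ℂ f x) (hg : AnalyticAt ℂ g x) (hfx : f x = 1)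
    (hgx : g x ∈ closedBall (0 : ℂ) (81 / 200)) :
    AnalyticAt ℂ (fun y => growth (f y) (g y)) x := by
  -- The radius lies between ρ and √2 - 1, the zero of 1 - 2t - t² and nearest branch point for u =
  -- 1. Accordingly 2 · 0.405 + 0.405² < 1.
  have h : ‖g x‖ ≤ 81 / 200 := mem_closedBall_zero_iff.1 hgx
  have hsq : ‖g x ^ 2‖ ≤ 81 / 200 * (81 / 200) := by
    rw [norm_pow, sq]
    gcongr
  refine analyticAt_growth hf hg (one_sub_mem_slitPlane (by linarith)) ?_ ?_
  · rw [hfx, show 1 - g x - 1 * g x - 1 * g x ^ 2 = 1 - (g x + g x + g x ^ 2) by ring]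
    refine one_sub_mem_slitPlane ?_
    have h1 := norm_add_le (g x + g x) (g x ^ 2)
    have h2 := norm_add_le (g x) (g x)
    linarith
  · rw [hfx, show 1 + g x - 1 * g x + 1 * g x ^ 2 = 1 - -(g x ^ 2) by ring]
    refine one_sub_mem_slitPlane ?_
    rw [norm_neg]
    linarith

theorem sq_ne_one_of_mem_closedBall {t : ℂ} (ht : t ∈ closedBall (0 : ℂ) (81 / 200)) :
    t ^ 2 ≠ 1 := by
  intro h
  have h1 : ‖t‖ ≤ 81 / 200 := mem_closedBall_zero_iff.1 ht
  have h2 : ‖t‖ ^ 2 = 1 := by rw [← norm_pow, h, norm_one]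
  nlinarith [norm_nonneg t]

/-- `t * growth 1 t` has modulus different from one. -/
theorem one_sub_mul_growth_ne_zero {P t : ℂ} (hP : ‖P‖ = 1)
    (ht : t ∈ closedBall (0 : ℂ) (81 / 200)) : 1 - P * t * growth 1 t ≠ 0 := by
  intro h
  have ht' : ‖t‖ ≤ 81 / 200 := mem_closedBall_zero_iff.1 ht
  have hV := growth_quadratic 1 t
  have ht0 : t ≠ 0 := by
    rintro rfl
    simp at h
  -- If tV = 1/P then P satisfies the kernel equation too, by its symmetry under inversion. Since
  -- |P| = 1, dividing by (P - t)(1 - Pt) would give 1 ≤ (0.405 + 0.405²) / 0.595, which is false.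
  have key : (P - t) * (1 - P * t) = t * (P - t) + t * t * (1 - P * t) := by
    have h1 : P * t * growth 1 t = 1 := by linear_combination -h
    have h2 : t * ((P - t) * (1 - P * t)) = t * (t * (P - t) + t * t * (1 - P * t)) := by
      rw [linCoeff] at hV
      linear_combination -(P * t) ^ 2 * hV +
        (t ^ 2 * (P * t * growth 1 t + 1) - (1 + t ^ 2 - 1 * t * (1 - t ^ 2)) * (P * t)) * h1
    exact mul_left_cancel₀ ht0 h2
  have h1 : 1 - 81 / 200 ≤ ‖P - t‖ := by
    have := norm_sub_norm_le P t
    linarith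
  have h2 : 1 - 81 / 200 ≤ ‖1 - P * t‖ := by
    have := norm_sub_norm_le 1 (P * t)
    rw [norm_mul, hP, norm_one, one_mul] at this
    linarith
  have h3 : ‖P - t‖ * ‖1 - P * t‖ ≤ ‖t‖ * ‖P - t‖ + ‖t‖ * ‖t‖ * ‖1 - P * t‖ := by
    rw [← norm_mul, ← norm_mul, ← norm_mul, ← norm_mul, key]
    exact norm_add_le _ _
  have h4 : ‖t‖ * ‖P - t‖ ≤ 81 / 200 * ‖P - t‖ := by gcongr
  have h5 : ‖t‖ * ‖t‖ * ‖1 - P * t‖ ≤ 81 / 200 * (81 / 200) * ‖1 - P * t‖ := by gcongr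
  nlinarith

/-- The generating function of the walks that stay on one edge of the box. -/
noncomputable def edgeGF (u P t : ℂ) : ℂ :=
  growth u t * (1 - t ^ 2) / ((1 - t ^ 2 * growth u t) * (1 - P * t * growth u t))

/-- The denominator of the generating function of 2-sided walks. -/
noncomputable def walkDen (a b t : ℂ) : ℂ := 1 - (growth a t - 1) * (growth b t - 1)

/-- The numerator of the generating function of 2-sided walks. -/
noncomputable def walkNum (a b q t : ℂ) : ℂ :=
  -walkDen a b t +
    (1 - a * t) * (edgeGF a (q / b) t + b / a * (growth a t - 1) * edgeGF b (q / a) t) +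
    (1 - b * t) * (edgeGF b (q / a) t + a / b * (growth b t - 1) * edgeGF a (q / b) t)

/-- The generating function of 2-sided walks, where `a`, `b`, `q` are the weights of the ordinate
and the abscissa of the endpoint and of the distance to the north-east corner. -/
theorem eventually_hasSum_weightSum {a b q : ℂ} (ha : a ≠ 0) (hb : b ≠ 0) (hq : q ≠ 0) :
    ∀ᶠ t in 𝓝 0, HasSum (fun n => weightSum (stepWeight a b) (fun σ => q ^ σ.dist) n * t ^ n)
      (walkNum a b q t / walkDen a b t) := by
  have cV : ∀ u, ContinuousAt (growth u) 0 := fun u => (analyticAt_growth_zero u).continuousAt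
  have ev : ∀ {g : ℂ → ℂ} (c : ℂ), ContinuousAt g 0 → g 0 ≠ c → ∀ᶠ t in 𝓝 0, g t ≠ c :=
    fun c hg h => hg.eventually_ne h
  have cid : ContinuousAt (fun t : ℂ => t) 0 := continuousAt_id
  have ct : ∀ u, ContinuousAt (fun t => t * growth u t) 0 := fun u => cid.mul (cV u)
  have cond : ∀ (u P : ℂ), P ≠ 0 → ∀ᶠ t in 𝓝 0, P - t ≠ 0 ∧ 1 - t * P ≠ 0 ∧
      P - t * growth u t ≠ 0 ∧ 1 - t ^ 2 * growth u t ≠ 0 ∧ 1 - P * t * growth u t ≠ 0 := by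
    intro u P hP
    have c1 : ContinuousAt (fun t : ℂ => P - t) 0 := by fun_prop
    have c2 : ContinuousAt (fun t : ℂ => 1 - t * P) 0 := by fun_prop
    have c3 : ContinuousAt (fun t => P - t * growth u t) 0 := continuousAt_const.sub (ct u)
    have c4 : ContinuousAt (fun t => 1 - t ^ 2 * growth u t) 0 :=
      continuousAt_const.sub ((cid.pow 2).mul (cV u))
    have c5 : ContinuousAt (fun t => 1 - P * t * growth u t) 0 :=
      continuousAt_const.sub ((continuousAt_const.mul cid).mul (cV u))
    filter_upwards [ev 0 c1 (by simpa), ev 0 c2 (by simp), ev 0 c3 (by simpa), ev 0 c4 (by simp),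
      ev 0 c5 (by simp)] with t h1 h2 h3 h4 h5 using ⟨h1, h2, h3, h4, h5⟩
  have csq : ∀ᶠ t : ℂ in 𝓝 0, t ^ 2 ≠ 1 := ev 1 (cid.pow 2) (by simp)
  have cden : ∀ᶠ t in 𝓝 0, walkDen a b t ≠ 0 := by
    refine ev 0 (continuousAt_const.sub (((cV a).sub continuousAt_const).mul
      ((cV b).sub continuousAt_const))) ?_
    simp [walkDen]
  have small : ∀ u, ∀ᶠ t in 𝓝 0, ‖t * growth u t‖ < 1 := fun u =>
    (ct u).norm.eventually (gt_mem_nhds (by simp))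
  set B : ℝ := ‖a‖ + ‖a⁻¹‖ + ‖b‖ + ‖b⁻¹‖ + 1 with hB
  set Q : ℝ := ‖q / a‖ + ‖q / b‖ + 1 with hQ
  have smallt : ∀ᶠ t : ℂ in 𝓝 0, 4 * B * (B * Q) * ‖t‖ < 1 := by
    refine (continuousAt_const.mul cid.norm).eventually (gt_mem_nhds ?_)
    simp
  have na := norm_nonneg a
  have na' := norm_nonneg a⁻¹
  have nb := norm_nonneg b
  have nb' := norm_nonneg b⁻¹
  have nqa := norm_nonneg (q / a)
  have nqb := norm_nonneg (q / b)
  filter_upwards [cond a (q / b) (div_ne_zero hq hb), cond b (q / a) (div_ne_zero hq ha), csq, cden,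
    small a, small b, smallt] with t ⟨h1, h2, h3, h4, h5⟩ ⟨h1', h2', h3', h4', h5'⟩ hsq hden hs hs' hst
  -- The edge solution divides by t, so the constant term is checked separately.
  by_cases ht : t = 0
  · subst ht
    have : walkNum a b q 0 / walkDen a b 0 = weightSum (stepWeight a b) (fun σ => q ^ σ.dist) 0 := by
      simp [walkNum, walkDen, edgeGF, weightSum_zero, State.dist]
    rw [this]
    convert hasSum_single (f := fun n => weightSum (stepWeight a b) (fun σ => q ^ σ.dist) n * 0 ^ n) 0
      ?_ using 1
    · simp
    · intro n hn
      simp [hn]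
  -- Cramer's rule for the two equations that link the values at the corner.
  set f := (edgeGF a (q / b) t + b / a * (growth a t - 1) * edgeGF b (q / a) t) / walkDen a b t
    with hf
  set r := (edgeGF b (q / a) t + a / b * (growth b t - 1) * edgeGF a (q / b) t) / walkDen a b t
    with hr
  have main := hasSum_weightSum_stepWeight (q := q) (f := f) (r := r) (B := B) (Q := Q) ht ha hb hsq
    (growth_ne_zero a t) (growth_ne_zero b t) (growth_kernel a t) (growth_kernel b t)
    (sub_ne_zero.1 h1) (sub_ne_zero.1 h1') h2 h2' (sub_ne_zero.1 h3) (sub_ne_zero.1 h3') h4 h4' h5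
    h5' ?_ ?_ ?_ (by linarith) (by linarith) (by linarith) (by linarith) ?_ hst
  · convert main using 1
    rw [hf, hr, walkNum]
    field_simp
  · change f = edgeGF a (q / b) t + _
    rw [hf, hr, div_eq_iff hden]
    generalize edgeGF a (q / b) t = x
    generalize edgeGF b (q / a) t = y
    have e : ∀ z : ℂ, z / walkDen a b t * walkDen a b t = z := fun z => div_mul_cancel₀ _ hden
    have hab : a / b * b / a = 1 := by field_simp
    rw [add_mul, show ∀ z, (growth a t - 1) / a * (b * (z / walkDen a b t)) * walkDen a b t =
      (growth a t - 1) / a * b * (z / walkDen a b t * walkDen a b t) from fun z => by ring, e,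
      walkDen]
    linear_combination -(growth a t - 1) * (growth b t - 1) * x * hab
  · change r = edgeGF b (q / a) t + _
    rw [hf, hr, div_eq_iff hden]
    generalize edgeGF a (q / b) t = x
    generalize edgeGF b (q / a) t = y
    have e : ∀ z : ℂ, z / walkDen a b t * walkDen a b t = z := fun z => div_mul_cancel₀ _ hden
    have hab : b / a * a / b = 1 := by field_simp
    rw [add_mul, show ∀ z, (growth b t - 1) / b * (a * (z / walkDen a b t)) * walkDen a b t =
      (growth b t - 1) / b * a * (z / walkDen a b t * walkDen a b t) from fun z => by ring, e,
      walkDen]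
    linear_combination -(growth a t - 1) * (growth b t - 1) * y * hab
  · intro s
    cases s <;> simp only [stepWeight] <;> linarith
  · nlinarith

section Analyticity

variable {E : Type*} [NormedAddCommGroup E] [NormedSpace ℂ E] {α β κ τ : E → ℂ} {x : E}

theorem analyticAt_walkDen (hα : AnalyticAt ℂ α x) (hβ : AnalyticAt ℂ β x) (hτ : AnalyticAt ℂ τ x)
    (hα1 : α x = 1) (hβ1 : β x = 1) (hτx : τ x ∈ closedBall (0 : ℂ) (81 / 200)) :
    AnalyticAt ℂ (fun y => walkDen (α y) (β y) (τ y)) x :=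
  analyticAt_const.sub (((analyticAt_growth_one hα hτ hα1 hτx).sub analyticAt_const).mul
    ((analyticAt_growth_one hβ hτ hβ1 hτx).sub analyticAt_const))

theorem analyticAt_edgeGF (hα : AnalyticAt ℂ α x) (hκ : AnalyticAt ℂ κ x) (hτ : AnalyticAt ℂ τ x)
    (hα1 : α x = 1) (hκ1 : ‖κ x‖ = 1) (hτx : τ x ∈ closedBall (0 : ℂ) (81 / 200)) :
    AnalyticAt ℂ (fun y => edgeGF (α y) (κ y) (τ y)) x := by
  have hV := analyticAt_growth_one hα hτ hα1 hτx
  refine (hV.mul (analyticAt_const.sub (hτ.pow 2))).div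
    ((analyticAt_const.sub ((hτ.pow 2).mul hV)).mul (analyticAt_const.sub ((hκ.mul hτ).mul hV))) ?_
  rw [hα1]
  exact mul_ne_zero
    (one_sub_sq_mul_growth_ne_zero one_ne_zero (sq_ne_one_of_mem_closedBall hτx))
    (one_sub_mul_growth_ne_zero hκ1 hτx)

theorem analyticAt_walkNum (hα : AnalyticAt ℂ α x) (hβ : AnalyticAt ℂ β x) (hκ : AnalyticAt ℂ κ x)
    (hτ : AnalyticAt ℂ τ x) (hα1 : α x = 1) (hβ1 : β x = 1) (hκ1 : ‖κ x‖ = 1)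
    (hτx : τ x ∈ closedBall (0 : ℂ) (81 / 200)) :
    AnalyticAt ℂ (fun y => walkNum (α y) (β y) (κ y) (τ y)) x := by
  have hα0 : α x ≠ 0 := by simp [hα1]
  have hβ0 : β x ≠ 0 := by simp [hβ1]
  have hV := analyticAt_growth_one hα hτ hα1 hτx
  have hV' := analyticAt_growth_one hβ hτ hβ1 hτx
  have hE := analyticAt_edgeGF hα (hκ.div hβ hβ0) hτ hα1 (by simp [hκ1, hβ1]) hτx
  have hE' := analyticAt_edgeGF hβ (hκ.div hα hα0) hτ hβ1 (by simp [hκ1, hα1]) hτx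
  refine ((analyticAt_walkDen hα hβ hτ hα1 hβ1 hτx).neg.add ?_).add ?_
  · exact (analyticAt_const.sub (hα.mul hτ)).mul
      (hE.add (((hβ.div hα hα0).mul (hV.sub analyticAt_const)).mul hE'))
  · exact (analyticAt_const.sub (hβ.mul hτ)).mul
      (hE'.add (((hα.div hβ hβ0).mul (hV'.sub analyticAt_const)).mul hE))

end Analyticity

end SquareWalk

/-! ### Quasi-powers: moments and Gaussian limit -/

namespace SquareWalk

open Complex (exp)

theorem numTwoSided_eq (n : ℕ) : numTwoSided n = Fintype.card (TwoSidedWalk n) :=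
  Nat.card_eq_fintype_card

theorem numTwoSided_pos (n : ℕ) : 0 < numTwoSided n := Nat.card_pos

theorem unif_real_singleton {n : ℕ} (w : TwoSidedWalk n) :
    (unif n).real {w} = (numTwoSided n : ℝ)⁻¹ := by
  rw [measureReal_def, unif, uniformOn_univ, Measure.count_singleton, numTwoSided_eq]
  simp

theorem integral_unif {𝕜 : Type*} [RCLike 𝕜] {n : ℕ} (f : TwoSidedWalk n → 𝕜) :
    ∫ w, f w ∂(unif n) = (∑ w, f w) / numTwoSided n := by
  rw [integral_fintype .of_finite, Finset.sum_div]
  refine Finset.sum_congr rfl fun w _ => ?_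
  rw [unif_real_singleton, RCLike.real_smul_eq_coe_mul]
  push_cast
  ring

/-- The moment generating function of `S`, multiplied by the number of walks. -/
noncomputable def mgfSum {n : ℕ} (S : TwoSidedWalk n → ℝ) (s : ℂ) : ℂ := ∑ w, exp (s * S w)

theorem mgfSum_zero {n : ℕ} (S : TwoSidedWalk n → ℝ) : mgfSum S 0 = numTwoSided n := by
  simp [mgfSum, numTwoSided_eq]

theorem hasDerivAt_sum_mul_exp {n : ℕ} (S : TwoSidedWalk n → ℝ) (f : TwoSidedWalk n → ℂ) (s : ℂ) :
    HasDerivAt (fun s => ∑ w, f w * exp (s * S w)) (∑ w, f w * S w * exp (s * S w)) s := by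
  refine HasDerivAt.fun_sum fun w _ => ?_
  have := ((hasDerivAt_id s).mul_const (S w : ℂ)).cexp.const_mul (f w)
  simp only [id, one_mul] at this
  exact this.congr_deriv (by ring)

theorem hasDerivAt_mgfSum {n : ℕ} (S : TwoSidedWalk n → ℝ) (s : ℂ) :
    HasDerivAt (mgfSum S) (∑ w, S w * exp (s * S w)) s := by
  have := hasDerivAt_sum_mul_exp S (fun _ => 1) s
  simp only [one_mul] at this
  exact this

section QuasiPowers

variable {S : ∀ n, TwoSidedWalk n → ℝ} {ℓ c : ℂ → ℂ} {m v : ℝ} {A : ℕ → ℂ} {U : Set ℂ}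

/-- If the moment generating functions are uniformly asymptotic to quasi-powers, then the first two
moments grow linearly. -/
theorem exists_moment_expansion (hℓ : AnalyticAt ℂ ℓ 0) (hℓ0 : ℓ 0 = 0) (hm : deriv ℓ 0 = m)
    (hv : deriv (deriv ℓ) 0 = v) (hA : ∀ n, A n ≠ 0) (hU : U ∈ 𝓝 0)
    (hg : TendstoUniformlyOn (fun n s => mgfSum (S n) s * A n * exp (-(n * ℓ s))) c atTop U)
    (hc : c 0 ≠ 0) :
    ∃ (x y : ℕ → ℂ) (x' y' : ℂ), Tendsto x atTop (𝓝 x') ∧ Tendsto y atTop (𝓝 y') ∧ ∀ n,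
      (∑ w, (S n w : ℂ)) / numTwoSided n = n * m + x n ∧
      (∑ w, (S n w : ℂ) ^ 2) / numTwoSided n = (n * m + x n) ^ 2 + n * v + y n := by
  obtain ⟨W, hWU, hWo, hW0⟩ := mem_nhds_iff.1
    (inter_mem hU ((isOpen_analyticAt ℂ ℓ).mem_nhds hℓ))
  set g : ℕ → ℂ → ℂ := fun n s => mgfSum (S n) s * A n * exp (-(n * ℓ s)) with hgdef
  -- the first derivative
  set g' : ℕ → ℂ → ℂ := fun n s =>
    ((∑ w, S n w * exp (s * S n w)) - n * deriv ℓ s * mgfSum (S n) s) * A n * exp (-(n * ℓ s))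
    with hg'def
  have hdℓ : ∀ s ∈ W, HasDerivAt ℓ (deriv ℓ s) s := fun s hs =>
    (hWU hs).2.differentiableAt.hasDerivAt
  have hexp : ∀ n : ℕ, ∀ s ∈ W, HasDerivAt (fun s => exp (-(n * ℓ s)))
      (exp (-(n * ℓ s)) * -(n * deriv ℓ s)) s := fun n s hs =>
    ((hdℓ s hs).const_mul (n : ℂ)).neg.cexp
  have h1 : ∀ n, ∀ s ∈ W, HasDerivAt (g n) (g' n s) s := fun n s hs => by
    have := ((hasDerivAt_mgfSum (S n) s).mul_const (A n)).mul (hexp n s hs)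
    exact this.congr_deriv (by simp only [hg'def]; ring)
  have h2 : ∀ n, HasDerivAt (g' n) (((∑ w, S n w * S n w * exp (0 * S n w)) -
      (n * deriv (deriv ℓ) 0 * mgfSum (S n) 0 + n * deriv ℓ 0 * ∑ w, S n w * exp (0 * S n w))) *
      A n * exp (-(n * ℓ 0)) + ((∑ w, S n w * exp (0 * S n w)) - n * deriv ℓ 0 * mgfSum (S n) 0) *
      A n * (exp (-(n * ℓ 0)) * -(n * deriv ℓ 0))) 0 := fun n => by
    have hd2 : HasDerivAt (deriv ℓ) (deriv (deriv ℓ) 0) 0 :=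
      hℓ.deriv.differentiableAt.hasDerivAt
    exact (((hasDerivAt_sum_mul_exp (S n) (fun w => S n w) 0).sub
      ((hd2.const_mul (n : ℂ)).mul (hasDerivAt_mgfSum (S n) 0))).mul_const (A n)).mul
      (hexp n 0 hW0)
  have lim0 : TendstoLocallyUniformlyOn g c atTop W :=
    (hg.mono fun s hs => (hWU hs).1).tendstoLocallyUniformlyOn
  have diff0 : ∀ᶠ n in atTop, DifferentiableOn ℂ (g n) W := Eventually.of_forall fun n s hs =>
    (h1 n s hs).differentiableAt.differentiableWithinAt
  -- Locally uniform limits of holomorphic functions may be differentiated, so no separate control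
  -- of the derivatives is needed.
  have lim1 := lim0.deriv diff0 hWo
  have lim2 := lim1.deriv (Eventually.of_forall fun n =>
    ((diff0.exists.elim fun _ _ => (show DifferentiableOn ℂ (g n) W from fun s hs =>
      (h1 n s hs).differentiableAt.differentiableWithinAt)).deriv hWo)) hWo
  have t0 : Tendsto (fun n => g n 0) atTop (𝓝 (c 0)) := lim0.tendsto_at hW0
  have t1 : Tendsto (fun n => deriv (g n) 0) atTop (𝓝 (deriv c 0)) := lim1.tendsto_at hW0
  have t2 : Tendsto (fun n => deriv (deriv (g n)) 0) atTop (𝓝 (deriv (deriv c) 0)) :=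
    lim2.tendsto_at hW0
  -- These are the first two derivatives of log g_n at 0, namely the mean minus n m and the variance
  -- minus n v; the factor `A n` cancels.
  refine ⟨fun n => deriv (g n) 0 / g n 0,
    fun n => deriv (deriv (g n)) 0 / g n 0 - (deriv (g n) 0 / g n 0) ^ 2, _, _, t1.div t0 hc,
    (t2.div t0 hc).sub ((t1.div t0 hc).pow 2), fun n => ?_⟩
  have e0 : g n 0 = numTwoSided n * A n := by simp [hgdef, mgfSum_zero, hℓ0]
  have e1 : deriv (g n) 0 = ((∑ w, (S n w : ℂ)) - n * m * numTwoSided n) * A n := by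
    rw [(h1 n 0 hW0).deriv]
    simp [hg'def, mgfSum_zero, hℓ0, hm]
  have e2 : deriv (deriv (g n)) 0 = ((∑ w, (S n w : ℂ) ^ 2) - n * v * numTwoSided n -
      2 * n * m * (∑ w, (S n w : ℂ)) + n ^ 2 * m ^ 2 * numTwoSided n) * A n := by
    have : deriv (g n) =ᶠ[𝓝 0] g' n := by
      filter_upwards [hWo.mem_nhds hW0] with s hs using (h1 n s hs).deriv
    rw [this.deriv_eq, (h2 n).deriv, hm, hv]
    simp only [zero_mul, Complex.exp_zero, mul_one, mgfSum_zero, hℓ0, mul_zero, neg_zero, one_mul,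
      sq]
    ring
  have hp : (numTwoSided n : ℂ) ≠ 0 := by exact_mod_cast (numTwoSided_pos n).ne'
  have hAn := hA n
  simp only [e0, e1, e2]
  constructor
  · field_simp
    ring
  · field_simp
    ring

theorem tendsto_sub_of_ofReal {u : ℕ → ℝ} {k : ℝ} {x : ℕ → ℂ} {x' : ℂ} (hx : Tendsto x atTop (𝓝 x'))
    (h : ∀ n, (u n : ℂ) = n * k + x n) : Tendsto (fun n => u n - k * n) atTop (𝓝 x'.re) := by
  refine ((Complex.continuous_re.tendsto _).comp hx).congr fun n => ?_
  have : x n = ((u n - k * n : ℝ) : ℂ) := by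
    push_cast
    rw [h]
    ring
  simp [this]

theorem isEquivalent_of_tendsto_sub {u : ℕ → ℝ} {k x : ℝ} (hk : k ≠ 0)
    (h : Tendsto (fun n => u n - k * n) atTop (𝓝 x)) : u ~[atTop] fun n : ℕ => k * n := by
  have h1 : (fun n => u n - k * n) =O[atTop] fun _ => (1 : ℝ) := h.isBigO_one ℝ
  have h2 : (fun _ : ℕ => (1 : ℝ)) =o[atTop] fun n : ℕ => k * (n : ℝ) :=
    (isLittleO_const_left.2 (Or.inr (by
      simpa [Function.comp_def] using tendsto_natCast_atTop_atTop (R := ℝ)))).const_mul_right hk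
  exact h1.trans_isLittleO h2

theorem tendsto_integral_sub (hℓ : AnalyticAt ℂ ℓ 0) (hℓ0 : ℓ 0 = 0) (hm : deriv ℓ 0 = m)
    (hv : deriv (deriv ℓ) 0 = v) (hA : ∀ n, A n ≠ 0) (hU : U ∈ 𝓝 0)
    (hg : TendstoUniformlyOn (fun n s => mgfSum (S n) s * A n * exp (-(n * ℓ s))) c atTop U)
    (hc : c 0 ≠ 0) :
    (∃ x, Tendsto (fun n : ℕ => (∫ w, S n w ∂(unif n)) - m * n) atTop (𝓝 x)) ∧
    ∃ y, Tendsto (fun n : ℕ => Var[S n; unif n] - v * n) atTop (𝓝 y) := by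
  obtain ⟨x, y, x', y', hx, hy, h⟩ := exists_moment_expansion hℓ hℓ0 hm hv hA hU hg hc
  have e1 : ∀ n, ((∫ w, S n w ∂(unif n) : ℝ) : ℂ) = n * m + x n := fun n => by
    rw [integral_unif, ← (h n).1]
    push_cast
    rfl
  refine ⟨⟨_, tendsto_sub_of_ofReal hx e1⟩, ⟨_, tendsto_sub_of_ofReal hy fun n => ?_⟩⟩
  rw [variance_eq_sub .of_discrete]
  push_cast
  rw [e1, integral_unif]
  have := (h n).2
  push_cast [Pi.pow_apply]
  rw [this]
  ring

/-- If the moment generating functions are uniformly asymptotic to quasi-powers, then the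
fluctuations are asymptotically normal. -/
theorem tendstoInDistribution_of_quasiPowers (hℓ : AnalyticAt ℂ ℓ 0) (hℓ0 : ℓ 0 = 0)
    (hm : deriv ℓ 0 = m) (hv : deriv (deriv ℓ) 0 = v) (hv0 : 0 < v) (hA : ∀ n, A n ≠ 0)
    (hU : U ∈ 𝓝 0)
    (hg : TendstoUniformlyOn (fun n s => mgfSum (S n) s * A n * exp (-(n * ℓ s))) c atTop U)
    (hcc : ContinuousAt c 0) (hc : c 0 ≠ 0) :
    TendstoInDistribution (fun (n : ℕ) (w : TwoSidedWalk n) => (S n w - m * n) / (√v * √n))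
      atTop (id : ℝ → ℝ) unif (gaussianReal 0 1) where
  forall_aemeasurable n := Measurable.aemeasurable .of_discrete
  aemeasurable_limit := aemeasurable_id
  tendsto := by
    refine ProbabilityMeasure.tendsto_iff_tendsto_charFun.2 fun θ => ?_
    simp only [ProbabilityMeasure.coe_mk, Measure.map_id]
    rw [charFun_gaussianReal]
    -- the points at which the moment generating functions are evaluated
    set s : ℕ → ℂ := fun n => θ * Complex.I / (√v * √n) with hs
    have hs0 : Tendsto s atTop (𝓝 0) := by
      have h1 : Tendsto (fun n : ℕ => √v * √(n : ℝ)) atTop atTop :=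
        (Real.tendsto_sqrt_atTop.comp tendsto_natCast_atTop_atTop).const_mul_atTop
          (Real.sqrt_pos.2 hv0)
      have h2 := (Complex.continuous_ofReal.tendsto 0).comp h1.inv_tendsto_atTop
      have h3 := h2.const_mul (θ * Complex.I)
      rw [Complex.ofReal_zero, mul_zero] at h3
      refine h3.congr fun n => ?_
      simp [hs, div_eq_mul_inv]
    have hns : ∀ᶠ n : ℕ in atTop, (n : ℂ) * s n ^ 2 = -(θ ^ 2 / v) := by
      filter_upwards [eventually_gt_atTop 0] with n hn
      have hn' : (n : ℂ) ≠ 0 := by exact_mod_cast hn.ne'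
      have hv' : (v : ℂ) ≠ 0 := by exact_mod_cast hv0.ne'
      have e1 : ((√v : ℝ) : ℂ) ^ 2 = v := by exact_mod_cast Real.sq_sqrt hv0.le
      have e2 : ((√(n : ℝ) : ℝ) : ℂ) ^ 2 = n := by
        exact_mod_cast Real.sq_sqrt (Nat.cast_nonneg n)
      rw [hs, div_pow, mul_pow, mul_pow, e1, e2, Complex.I_sq]
      field_simp
    have taylor : Tendsto (fun n : ℕ => n * (ℓ (s n) - m * s n)) atTop (𝓝 (-(θ ^ 2 / 2))) := by
      have hO := (hℓ.hasFPowerSeriesAt.isBigO_sub_partialSum_pow 3).comp_tendsto hs0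
      have hO2 : (fun n : ℕ => (n : ℂ) * (ℓ (s n) - m * s n - v / 2 * s n ^ 2)) =O[atTop]
          fun n : ℕ => (n : ℂ) * s n ^ 2 * s n := by
        have hle : ((fun y : ℂ => ‖y‖ ^ 3) ∘ s) =O[atTop] fun n => s n ^ 3 :=
          isBigO_of_le _ fun n => by simp
        have := (isBigO_refl (fun n : ℕ => (n : ℂ)) atTop).mul (hO.trans hle)
        refine (this.congr_left fun n => ?_).congr_right fun n => by ring
        simp only [Function.comp, zero_add, FormalMultilinearSeries.partialSum,
          Finset.sum_range_succ, Finset.sum_range_zero, FormalMultilinearSeries.ofScalars_apply_eq,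
          iteratedDeriv_succ, iteratedDeriv_zero, hℓ0, hm, hv]
        simp only [Nat.factorial, Nat.cast_one, pow_zero, pow_one, smul_eq_mul, div_one, zero_mul,
          zero_add]
        ring
      have hz : Tendsto (fun n : ℕ => (n : ℂ) * s n ^ 2 * s n) atTop (𝓝 0) := by
        have : Tendsto (fun n : ℕ => -((θ : ℂ) ^ 2 / v) * s n) atTop (𝓝 0) := by
          simpa using hs0.const_mul (-((θ : ℂ) ^ 2 / v))
        refine this.congr' ?_
        filter_upwards [hns] with n hn
        rw [hn]
      have hv' : (v : ℂ) ≠ 0 := by exact_mod_cast hv0.ne'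
      have := (hO2.trans_tendsto hz).add_const (-((θ : ℂ) ^ 2 / 2))
      rw [zero_add] at this
      refine this.congr' ?_
      filter_upwards [hns] with n hn
      have : (v : ℂ) / 2 * (n * s n ^ 2) = -(θ ^ 2 / 2) := by
        rw [hn]
        field_simp
      linear_combination -this
    set g : ℕ → ℂ → ℂ := fun n s => mgfSum (S n) s * A n * exp (-(n * ℓ s)) with hgdef
    have hU0 : (0 : ℂ) ∈ U := mem_of_mem_nhds hU
    have t0 : Tendsto (fun n => g n 0) atTop (𝓝 (c 0)) := hg.tendsto_at hU0
    have t1 : Tendsto (fun n => g n (s n)) atTop (𝓝 (c 0)) :=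
      hg.tendsto_comp hcc.continuousWithinAt
        (tendsto_nhdsWithin_iff.2 ⟨hs0, hs0.eventually hU⟩)
    -- The quotient g_n(s_n) / g_n(0) tends to 1, so only the factor exp(n (ℓ(s_n) - m s_n))
    -- survives, and its exponent tends to -θ²/2.
    have lim := (t1.div t0 hc).mul ((Complex.continuous_exp.tendsto _).comp taylor)
    rw [div_self hc, one_mul] at lim
    convert lim using 1
    · ext n
      have hp : (numTwoSided n : ℂ) ≠ 0 := by exact_mod_cast (numTwoSided_pos n).ne'
      have e0 : g n 0 = numTwoSided n * A n := by simp [hgdef, mgfSum_zero, hℓ0]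
      rw [charFun_apply_real, integral_map (Measurable.aemeasurable .of_discrete)
        (by fun_prop), integral_unif]
      simp only [Function.comp, Pi.div_apply]
      rw [e0]
      simp only [hgdef]
      rw [mul_right_comm, mul_div_mul_right _ _ (hA n), div_mul_eq_mul_div, mul_assoc,
        ← Complex.exp_add]
      congr 1
      rw [mgfSum, Finset.sum_mul]
      refine Finset.sum_congr rfl fun w _ => ?_
      rw [← Complex.exp_add]
      congr 1
      simp only [hs]
      push_cast
      ring
    · congr 2
      simp

end QuasiPowers

end SquareWalk

/-! ### The dominant singularity and its residue -/

namespace SquareWalk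

open Metric

/-- The interval is much narrower than three digits because 5ρ - 2 ≈ 0.015 occurs in the denominator
of κ. -/
theorem exists_singularity : ∃ ρ ∈ Set.Ioo (0.4030317 : ℝ) 0.4030318,
    1 - 2 * ρ - 2 * ρ ^ 2 + 2 * ρ ^ 3 = 0 := by
  have hc : ContinuousOn (fun x : ℝ => 1 - 2 * x - 2 * x ^ 2 + 2 * x ^ 3)
      (Set.Icc 0.4030317 0.4030318) := by fun_prop
  obtain ⟨ρ, h1, h2⟩ := intermediate_value_Ioo' (by norm_num) hc
    (show (0 : ℝ) ∈ Set.Ioo _ _ by constructor <;> norm_num)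
  exact ⟨ρ, h1, h2⟩

section Singularity

variable {ρ : ℝ}

theorem singularity_mem_ball (hρ : ρ ∈ Set.Ioo (0.4030317 : ℝ) 0.4030318) : (ρ : ℂ) ∈ ball (0 : ℂ) (81 / 200) := by
  obtain ⟨h1, h2⟩ := hρ
  rw [mem_ball_zero_iff, Complex.norm_real, Real.norm_eq_abs, abs_lt]
  constructor <;> linarith

theorem singularity_ne_zero (hρ : ρ ∈ Set.Ioo (0.4030317 : ℝ) 0.4030318) : (ρ : ℂ) ≠ 0 := by
  have : ρ ≠ 0 := by
    have := hρ.1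
    rintro rfl
    norm_num at this
  exact_mod_cast this

/-- The cubic makes 2 a root of the quadratic, but the branch has to be identified: the other root
is 1/(2ρ²). The discriminant is (1/2 - 2ρ²)², the principal roots are nonnegative reals and ρ < 1/2,
so `discrRoot` is 1/2 - 2ρ² and the denominator of `growth` is 1. -/
theorem growth_one_singularity (hρ : ρ ∈ Set.Ioo (0.4030317 : ℝ) 0.4030318)
    (hcubic : 1 - 2 * ρ - 2 * ρ ^ 2 + 2 * ρ ^ 3 = 0) : growth 1 ρ = 2 := by
  obtain ⟨h1, h2⟩ := hρ
  have sqrtReal : ∀ x : ℝ, 0 ≤ x → ∃ y : ℝ, 0 ≤ y ∧ (x : ℂ) ^ ((2 : ℂ)⁻¹) = y := fun x hx =>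
    ⟨x ^ ((2 : ℝ)⁻¹), by positivity, by rw [Complex.ofReal_cpow hx]; norm_num⟩
  obtain ⟨y1, hy1, e1⟩ := sqrtReal (1 - ρ ^ 2) (by nlinarith)
  obtain ⟨y2, hy2, e2⟩ := sqrtReal (1 - ρ - 1 * ρ - 1 * ρ ^ 2) (by nlinarith)
  obtain ⟨y3, hy3, e3⟩ := sqrtReal (1 + ρ - 1 * ρ + 1 * ρ ^ 2) (by nlinarith)
  push_cast at e1 e2 e3
  have hroot : discrRoot 1 ρ = ((y1 * y2 * y3 : ℝ) : ℂ) := by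
    rw [discrRoot, e1, e2, e3]
    push_cast
    rfl
  have hlin : linCoeff 1 ρ = ((1 / 2 + 2 * ρ ^ 2 : ℝ) : ℂ) := by
    have : 1 / 2 + 2 * ρ ^ 2 = 1 + ρ ^ 2 - 1 * ρ * (1 - ρ ^ 2) := by linarith
    rw [this, linCoeff]
    push_cast
    ring
  have hsq := discrRoot_sq 1 ρ
  rw [hroot, hlin] at hsq
  have hsq' : (y1 * y2 * y3) ^ 2 = (1 / 2 + 2 * ρ ^ 2) ^ 2 - 4 * ρ ^ 2 := by exact_mod_cast hsq
  have hy : y1 * y2 * y3 = 1 / 2 - 2 * ρ ^ 2 := by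
    have h3 : 0 ≤ 1 / 2 - 2 * ρ ^ 2 := by nlinarith
    refine (sq_eq_sq₀ (by positivity) h3).1 ?_
    rw [hsq']
    ring
  rw [growth, hroot, hlin, hy]
  push_cast
  ring

/-- The determinant is V(2 - V) and V never vanishes. Putting V = 2 in the quadratic gives the
cubic; after division by t - ρ, the constant term of the quotient outweighs its other terms
throughout the disc. -/
theorem walkDen_one_eq_zero_iff (hρ : ρ ∈ Set.Ioo (0.4030317 : ℝ) 0.4030318)
    (hcubic : 1 - 2 * ρ - 2 * ρ ^ 2 + 2 * ρ ^ 3 = 0) {t : ℂ} (ht : t ∈ closedBall (0 : ℂ) (81 / 200)) :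
    walkDen 1 1 t = 0 ↔ t = ρ := by
  constructor
  · intro h
    have hV : growth 1 t = 2 := by
      have h1 : growth 1 t * (growth 1 t - 2) = 0 := by
        rw [walkDen] at h
        linear_combination -h
      rcases mul_eq_zero.1 h1 with h2 | h2
      · exact absurd h2 (growth_ne_zero 1 t)
      · linear_combination h2
    have hq := growth_quadratic 1 t
    rw [hV, linCoeff] at hq
    have hc : 1 - 2 * (ρ : ℂ) - 2 * ρ ^ 2 + 2 * ρ ^ 3 = 0 := by exact_mod_cast hcubic
    have hfac : (t - ρ) * (2 * t ^ 2 + (2 * ρ - 2) * t + (2 * ρ ^ 2 - 2 * ρ - 2)) = 0 := by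
      linear_combination -hq - hc
    rcases mul_eq_zero.1 hfac with h1 | h1
    · exact sub_eq_zero.1 h1
    · exfalso
      obtain ⟨hρ1, hρ2⟩ := hρ
      have ht' : ‖t‖ ≤ 81 / 200 := mem_closedBall_zero_iff.1 ht
      have e : ((2 + 2 * ρ - 2 * ρ ^ 2 : ℝ) : ℂ) = 2 * t ^ 2 + ((2 * ρ - 2 : ℝ) : ℂ) * t := by
        push_cast
        linear_combination -h1
      have h2 : ‖((2 + 2 * ρ - 2 * ρ ^ 2 : ℝ) : ℂ)‖ ≤ 2 * ‖t‖ ^ 2 + (2 - 2 * ρ) * ‖t‖ := by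
        rw [e]
        refine (norm_add_le _ _).trans ?_
        rw [norm_mul, norm_mul, norm_pow, Complex.norm_real, Real.norm_eq_abs,
          abs_of_nonpos (by linarith)]
        simp
      rw [Complex.norm_real, Real.norm_eq_abs, abs_of_nonneg (by nlinarith)] at h2
      nlinarith [norm_nonneg t]
  · rintro rfl
    rw [walkDen, growth_one_singularity hρ hcubic]
    ring

theorem analyticAt_growth_one_slice {t : ℂ} (ht : t ∈ closedBall (0 : ℂ) (81 / 200)) :
    AnalyticAt ℂ (growth 1) t :=
  analyticAt_growth_one (f := fun _ => 1) (g := fun t => t) analyticAt_const analyticAt_id rfl ht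

/-- Implicit differentiation of the quadratic, whose derivative in V at V = 2 is 2ρ² - 1/2 ≠ 0. -/
theorem deriv_growth_one_singularity (hρ : ρ ∈ Set.Ioo (0.4030317 : ℝ) 0.4030318)
    (hcubic : 1 - 2 * ρ - 2 * ρ ^ 2 + 2 * ρ ^ 3 = 0) :
    deriv (growth 1) ρ = ((4 * ρ + 2 - 6 * ρ ^ 2) / (1 / 2 - 2 * ρ ^ 2) : ℝ) := by
  have hmem := ball_subset_closedBall (singularity_mem_ball hρ)
  have hV := (analyticAt_growth_one_slice hmem).differentiableAt.hasDerivAt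
  have hid := hasDerivAt_id' (ρ : ℂ)
  have h1 := (((hid.pow 2).mul (hV.pow 2)).sub (((((hid.pow 2).const_add 1).sub
    (hid.mul ((hid.pow 2).const_sub 1)))).mul hV)).add_const 1
  have h0 : (fun t => t ^ 2 * growth 1 t ^ 2 - (1 + t ^ 2 - t * (1 - t ^ 2)) * growth 1 t + 1) =
      fun _ => 0 := by
    funext t
    have := growth_quadratic 1 t
    rw [linCoeff, one_mul] at this
    exact this
  have h2 := h1.unique (by
    have := hasDerivAt_const (ρ : ℂ) (0 : ℂ)
    rw [← h0] at this
    exact this)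
  have hc : 1 - 2 * (ρ : ℂ) - 2 * ρ ^ 2 + 2 * ρ ^ 3 = 0 := by exact_mod_cast hcubic
  have hne : (1 / 2 - 2 * ρ ^ 2 : ℝ) ≠ 0 := by
    have := hρ.1
    have := hρ.2
    nlinarith
  have hne' := Complex.ofReal_ne_zero.2 hne
  push_cast at hne'
  push_cast
  rw [eq_div_iff hne']
  norm_num [growth_one_singularity hρ hcubic] at h2
  linear_combination -h2 - (deriv (growth 1) ρ / 2) * hc

theorem deriv_walkDen_one_singularity (hρ : ρ ∈ Set.Ioo (0.4030317 : ℝ) 0.4030318)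
    (hcubic : 1 - 2 * ρ - 2 * ρ ^ 2 + 2 * ρ ^ 3 = 0) :
    deriv (walkDen 1 1) ρ = -2 * ((4 * ρ + 2 - 6 * ρ ^ 2) / (1 / 2 - 2 * ρ ^ 2) : ℝ) := by
  have hmem := ball_subset_closedBall (singularity_mem_ball hρ)
  have hV := (analyticAt_growth_one_slice hmem).differentiableAt.hasDerivAt
  have h1 : HasDerivAt (walkDen 1 1) _ (ρ : ℂ) :=
    ((hV.sub_const 1).mul (hV.sub_const 1)).const_sub 1
  rw [h1.deriv, growth_one_singularity hρ hcubic, deriv_growth_one_singularity hρ hcubic]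
  ring

theorem deriv_walkDen_one_ne_zero (hρ : ρ ∈ Set.Ioo (0.4030317 : ℝ) 0.4030318)
    (hcubic : 1 - 2 * ρ - 2 * ρ ^ 2 + 2 * ρ ^ 3 = 0) : deriv (walkDen 1 1) ρ ≠ 0 := by
  obtain ⟨h1, h2⟩ := hρ
  rw [deriv_walkDen_one_singularity ⟨h1, h2⟩ hcubic]
  have h3 : 4 * ρ + 2 - 6 * ρ ^ 2 ≠ 0 := by nlinarith
  have h4 : 1 / 2 - 2 * ρ ^ 2 ≠ 0 := by nlinarith
  refine mul_ne_zero (by norm_num) ?_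
  exact_mod_cast div_ne_zero h3 h4

/-- The residue of the generating function, as a function of the weight of the distance to the
corner. -/
theorem residue_eq (hρ : ρ ∈ Set.Ioo (0.4030317 : ℝ) 0.4030318)
    (hcubic : 1 - 2 * ρ - 2 * ρ ^ 2 + 2 * ρ ^ 3 = 0) (q : ℂ) :
    -walkNum 1 1 q ρ / (ρ * deriv (walkDen 1 1) ρ) =
      ((ρ * (3 * ρ - 1) / ((3 * ρ + 1) * (5 * ρ - 2)) * (1 - 2 * ρ) : ℝ) : ℂ) /
        (1 - 2 * ρ * q) := by
  have hmem := ball_subset_closedBall (singularity_mem_ball hρ)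
  have hρ0 := singularity_ne_zero hρ
  -- Since `growth` equals 2 at ρ, the weight q survives only in the factor 1 - 2ρq.
  rw [deriv_walkDen_one_singularity hρ hcubic, walkNum,
    (walkDen_one_eq_zero_iff hρ hcubic hmem).2 rfl, edgeGF, growth_one_singularity hρ hcubic]
  have key : 4 * (1 - ρ) * (2 * (1 - ρ ^ 2) / (1 - ρ ^ 2 * 2)) /
      (2 * ρ * ((4 * ρ + 2 - 6 * ρ ^ 2) / (1 / 2 - 2 * ρ ^ 2))) =
      ρ * (3 * ρ - 1) / ((3 * ρ + 1) * (5 * ρ - 2)) * (1 - 2 * ρ) := by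
    obtain ⟨h1, h2⟩ := hρ
    have n0 : ρ ≠ 0 := by nlinarith
    have n1 : 1 - ρ ≠ 0 := by nlinarith
    have n2 : 1 + ρ ≠ 0 := by nlinarith
    have n3 : 3 * ρ + 1 ≠ 0 := by nlinarith
    have n4 : 5 * ρ - 2 ≠ 0 := by nlinarith
    have n5 : 1 - 2 * ρ ≠ 0 := by nlinarith
    have n6 : 1 + 2 * ρ ≠ 0 := by nlinarith
    -- By the cubic, 1 - 2ρ² = 2ρ(1 - ρ²), which cancels against the numerator.
    rw [show 1 - ρ ^ 2 * 2 = 2 * ρ * ((1 - ρ) * (1 + ρ)) by linear_combination hcubic,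
      show 4 * ρ + 2 - 6 * ρ ^ 2 = 2 * (1 - ρ) * (3 * ρ + 1) by ring,
      show 1 / 2 - 2 * ρ ^ 2 = (1 - 2 * ρ) * (1 + 2 * ρ) / 2 by ring,
      show 1 - ρ ^ 2 = (1 - ρ) * (1 + ρ) by ring]
    have e1 : 4 * (1 - ρ) * (2 * ((1 - ρ) * (1 + ρ)) / (2 * ρ * ((1 - ρ) * (1 + ρ)))) /
        (2 * ρ * (2 * (1 - ρ) * (3 * ρ + 1) / ((1 - 2 * ρ) * (1 + 2 * ρ) / 2))) =
        (1 - 2 * ρ) * (1 + 2 * ρ) / (2 * ρ ^ 2 * (3 * ρ + 1)) := by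
      field_simp
      ring
    rw [e1, div_mul_eq_mul_div, div_eq_div_iff (by positivity) (mul_ne_zero n3 n4)]
    linear_combination (-(1 - 2 * ρ) * (3 * ρ + 1) * (3 * ρ + 2)) * hcubic
  rw [← key, show 1 - q / 1 * (ρ : ℂ) * 2 = 1 - 2 * ρ * q by ring]
  push_cast
  generalize (4 * (ρ : ℂ) + 2 - 6 * ρ ^ 2) / (1 / 2 - 2 * ρ ^ 2) = x
  generalize (1 - (ρ : ℂ) ^ 2 * 2) = y
  generalize (1 - 2 * (ρ : ℂ) * q) = z
  ring

end Singularity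

theorem prod_stepWeight {n : ℕ} (w : Fin n → Step) (x y : ℂ) :
    ∏ j, stepWeight (Complex.exp y) (Complex.exp x) (w j) =
      Complex.exp (x * (vertex w n).1 + y * (vertex w n).2) := by
  have hv : vertex w n = ∑ j, (w j).vec := by simp [vertex]
  rw [hv, Prod.fst_sum, Prod.snd_sum]
  push_cast
  rw [Finset.mul_sum, Finset.mul_sum, ← Finset.sum_add_distrib, Complex.exp_sum]
  refine Finset.prod_congr rfl fun j _ => ?_
  cases w j <;> simp [stepWeight, Step.vec, Complex.exp_neg]

theorem mgfSum_eq_weightSum {n : ℕ} (x y s : ℂ) {S : TwoSidedWalk n → ℝ}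
    (h : ∀ w, s * (S w : ℂ) = x * w.X + y * w.Y) :
    mgfSum S s = weightSum (stepWeight (Complex.exp y) (Complex.exp x)) (fun σ => 1 ^ σ.dist) n := by
  rw [← sum_twoSidedWalk, mgfSum]
  refine Finset.sum_congr rfl fun w _ => ?_
  rw [prod_stepWeight, one_pow, mul_one, h]
  rfl

/-! ### The singularity as a function of the exponential weights -/

section Curves

/-- If `f` vanishes near `0`, so do its first two derivatives. -/
theorem second_derivative_eq_zero {f f' : ℂ → ℂ} {f'' : ℂ} (h0 : ∀ᶠ s in 𝓝 0, f s = 0)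
    (h1 : ∀ᶠ s in 𝓝 0, HasDerivAt f (f' s) s) (h2 : HasDerivAt f' f'' 0) :
    f' 0 = 0 ∧ f'' = 0 := by
  have e1 : ∀ᶠ s in 𝓝 0, f' s = 0 := by
    filter_upwards [h0.eventually_nhds, h1] with s hs hs1
    rw [← hs1.deriv, EventuallyEq.deriv_eq (show f =ᶠ[𝓝 s] fun _ => 0 from hs)]
    simp
  refine ⟨e1.self_of_nhds, ?_⟩
  rw [← h2.deriv, EventuallyEq.deriv_eq (show f' =ᶠ[𝓝 0] fun _ => 0 from e1)]
  simp

/-- The logarithm of `ρ(0) / ρ(s)` and its first two derivatives. -/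
theorem exists_log {r : ℂ → ℂ} (hr : AnalyticAt ℂ r 0) (h0 : r 0 ≠ 0) :
    ∃ ℓ : ℂ → ℂ, AnalyticAt ℂ ℓ 0 ∧ ℓ 0 = 0 ∧ deriv ℓ 0 = -(deriv r 0 / r 0) ∧
      deriv (deriv ℓ) 0 = (deriv r 0 / r 0) ^ 2 - deriv (deriv r) 0 / r 0 ∧
      ∀ᶠ s in 𝓝 0, ∀ n : ℕ, r s ^ n = r 0 ^ n * Complex.exp (-(n * ℓ s)) := by
  have han : AnalyticAt ℂ (fun s => r s / r 0) 0 := hr.div analyticAt_const h0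
  have hlog : AnalyticAt ℂ (fun s => Complex.log (r s / r 0)) 0 :=
    han.clog (by simp [div_self h0])
  have hder : ∀ᶠ s in 𝓝 0, HasDerivAt (fun s => -Complex.log (r s / r 0)) (-(deriv r s / r s)) s := by
    have hs : ∀ᶠ s in 𝓝 0, r s / r 0 ∈ Complex.slitPlane :=
      han.continuousAt.eventually (Complex.isOpen_slitPlane.mem_nhds (by simp [div_self h0]))
    filter_upwards [hs, hr.eventually_analyticAt, hr.continuousAt.eventually_ne h0] with s h1 h2 h3
    refine ((h2.differentiableAt.hasDerivAt.div_const (r 0)).clog h1).neg.congr_deriv ?_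
    field_simp
  refine ⟨fun s => -Complex.log (r s / r 0), hlog.neg, by simp [div_self h0],
    hder.self_of_nhds.deriv, ?_, ?_⟩
  · rw [EventuallyEq.deriv_eq (hder.mono fun s hs => hs.deriv)]
    have h1 := hr.differentiableAt.hasDerivAt
    have h2 := hr.deriv.differentiableAt.hasDerivAt
    rw [(h2.fun_div h1 h0).fun_neg.deriv]
    field_simp
    ring
  · filter_upwards [hr.continuousAt.eventually_ne h0] with s hs n
    rw [mul_neg, neg_neg, Complex.exp_nat_mul, Complex.exp_log (div_ne_zero hs h0), div_pow,
      mul_div_cancel₀ _ (pow_ne_zero n h0)]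

variable {ρ : ℝ}

/-- The generating function of 2-sided walks, weighted by an exponential of the endpoint, has
coefficients that are uniformly asymptotic to quasi-powers. -/
theorem exists_quasiPowers (hρ : ρ ∈ Set.Ioo (0.4030317 : ℝ) 0.4030318)
    (hcubic : 1 - 2 * ρ - 2 * ρ ^ 2 + 2 * ρ ^ 3 = 0) {ξ η : ℂ}
    {S : ∀ n, TwoSidedWalk n → ℝ} (hS : ∀ n w, (S n w : ℂ) = ξ * w.X + η * w.Y) :
    ∃ r : ℂ → ℂ, AnalyticAt ℂ r 0 ∧ r 0 = ρ ∧
      (∀ᶠ s in 𝓝 0, walkDen (Complex.exp (s * η)) (Complex.exp (s * ξ)) (r s) = 0) ∧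
      ∃ (c : ℂ → ℂ) (U : Set ℂ), U ∈ 𝓝 0 ∧ c 0 ≠ 0 ∧ ContinuousAt c 0 ∧
        TendstoUniformlyOn (fun n s => mgfSum (S n) s * r s ^ n) c atTop U := by
  have hmem := singularity_mem_ball hρ
  have hexp : ∀ (z : ℂ) (p : ℂ × ℂ), AnalyticAt ℂ (fun p : ℂ × ℂ => Complex.exp (p.1 * z)) p :=
    fun z p => (analyticAt_fst.mul analyticAt_const).cexp
  obtain ⟨r, hr, hr0, hroot, U, hU, hlim⟩ := exists_tendstoUniformlyOn_coeff (x₀ := 0) (ρ₀ := ρ)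
    (N := fun s t => walkNum (Complex.exp (s * η)) (Complex.exp (s * ξ)) 1 t)
    (D := fun s t => walkDen (Complex.exp (s * η)) (Complex.exp (s * ξ)) t)
    (a := fun n s => mgfSum (S n) s)
    (singularity_ne_zero hρ) hmem
    (fun t ht => analyticAt_walkNum (α := fun p : ℂ × ℂ => Complex.exp (p.1 * η))
      (β := fun p : ℂ × ℂ => Complex.exp (p.1 * ξ)) (κ := fun _ => 1) (τ := Prod.snd)
      (hexp _ _) (hexp _ _) analyticAt_const analyticAt_snd (by simp) (by simp) (by simp) ht)
    (fun t ht => analyticAt_walkDen (α := fun p : ℂ × ℂ => Complex.exp (p.1 * η))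
      (β := fun p : ℂ × ℂ => Complex.exp (p.1 * ξ)) (τ := Prod.snd)
      (hexp _ _) (hexp _ _) analyticAt_snd (by simp) (by simp) ht)
    (fun t ht => by simpa using walkDen_one_eq_zero_iff hρ hcubic ht)
    (by simpa using deriv_walkDen_one_ne_zero hρ hcubic)
    (Eventually.of_forall fun s => by
      have e : ∀ n, mgfSum (S n) s = weightSum (stepWeight (Complex.exp (s * η))
          (Complex.exp (s * ξ))) (fun σ => 1 ^ σ.dist) n := fun n =>
        mgfSum_eq_weightSum (s * ξ) (s * η) s fun w => by
          rw [hS]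
          ring
      simp only [e]
      exact eventually_hasSum_weightSum (Complex.exp_ne_zero _) (Complex.exp_ne_zero _)
        one_ne_zero)
  refine ⟨r, hr, hr0, hroot.mono fun s h => h.2, _, interior U, interior_mem_nhds.2 hU, ?_, ?_,
    hlim.mono interior_subset⟩
  · simp only [zero_mul, Complex.exp_zero, hr0]
    rw [residue_eq hρ hcubic]
    obtain ⟨h1, h2⟩ := hρ
    have n1 : ρ * (3 * ρ - 1) / ((3 * ρ + 1) * (5 * ρ - 2)) * (1 - 2 * ρ) ≠ 0 := by
      refine mul_ne_zero (div_ne_zero (mul_ne_zero ?_ ?_) (mul_ne_zero ?_ ?_)) ?_ <;> nlinarith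
    have n2 : (1 - 2 * (ρ : ℂ) * 1) ≠ 0 := by
      have : 1 - 2 * ρ * 1 ≠ 0 := by nlinarith
      exact_mod_cast this
    exact div_ne_zero (Complex.ofReal_ne_zero.2 n1) n2
  -- The limit c is continuous as a uniform limit of continuous functions.
  · have hcont : ContinuousOn (fun s => -walkNum (Complex.exp (s * η)) (Complex.exp (s * ξ)) 1 (r s) /
        (r s * deriv (walkDen (Complex.exp (s * η)) (Complex.exp (s * ξ))) (r s)))
        (interior U ∩ interior {s | AnalyticAt ℂ r s}) := by
      refine (hlim.mono fun s hs => interior_subset hs.1).continuousOn (Frequently.of_forall ?_)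
      intro n s hs
      exact ((hasDerivAt_mgfSum (S n) s).continuousAt.mul
        ((interior_subset hs.2).continuousAt.pow n)).continuousWithinAt
    exact hcont.continuousAt (inter_mem (interior_mem_nhds.2 hU)
      (interior_mem_nhds.2 ((isOpen_analyticAt ℂ r).mem_nhds hr)))

end Curves

end SquareWalk

/-! ### Limit laws for the endpoint; drift and variances -/

namespace SquareWalk

open Metric

section LimitLaws

variable {ρ : ℝ}

theorem quasiPowers_limits (hρ : ρ ∈ Set.Ioo (0.4030317 : ℝ) 0.4030318)
    (hcubic : 1 - 2 * ρ - 2 * ρ ^ 2 + 2 * ρ ^ 3 = 0) {ξ η : ℂ}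
    {S : ∀ n, TwoSidedWalk n → ℝ} (hS : ∀ n w, (S n w : ℂ) = ξ * w.X + η * w.Y) {m v : ℝ}
    (hv : 0 < v)
    (h : ∀ r : ℂ → ℂ, AnalyticAt ℂ r 0 → r 0 = ρ →
      (∀ᶠ s in 𝓝 0, walkDen (Complex.exp (s * η)) (Complex.exp (s * ξ)) (r s) = 0) →
      -(deriv r 0 / ρ) = m ∧ (deriv r 0 / ρ) ^ 2 - deriv (deriv r) 0 / ρ = v) :
    (∃ x, Tendsto (fun n : ℕ => (∫ w, S n w ∂(unif n)) - m * n) atTop (𝓝 x)) ∧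
    (∃ y, Tendsto (fun n : ℕ => Var[S n; unif n] - v * n) atTop (𝓝 y)) ∧
    TendstoInDistribution (fun (n : ℕ) (w : TwoSidedWalk n) => (S n w - m * n) / (√v * √n))
      atTop (id : ℝ → ℝ) unif (gaussianReal 0 1) := by
  obtain ⟨r, hr, hr0, hroot, c, U, hU, hc, hcc, hlim⟩ := exists_quasiPowers hρ hcubic hS
  obtain ⟨h1, h2⟩ := h r hr hr0 hroot
  have hρ0 := singularity_ne_zero hρ
  obtain ⟨ℓ, hℓ, hℓ0, hℓ1, hℓ2, hpow⟩ := exists_log hr (hr0 ▸ hρ0)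
  rw [hr0] at hℓ1 hℓ2 hpow
  have hg : TendstoUniformlyOn (fun n s => mgfSum (S n) s * (ρ : ℂ) ^ n *
      Complex.exp (-(n * ℓ s))) c atTop (U ∩ {s | ∀ n : ℕ, r s ^ n =
        (ρ : ℂ) ^ n * Complex.exp (-(n * ℓ s))}) := by
    refine (hlim.mono Set.inter_subset_left).congr (Eventually.of_forall fun n s hs => ?_)
    simp only
    rw [hs.2 n, mul_assoc]
  have hU' := inter_mem hU hpow
  have hA : ∀ n, (ρ : ℂ) ^ n ≠ 0 := fun n => pow_ne_zero n hρ0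
  have hm' := hℓ1.trans h1
  have hv' := hℓ2.trans h2
  have hlims := tendsto_integral_sub hℓ hℓ0 hm' hv' hA hU' hg hc
  exact ⟨hlims.1, hlims.2,
    tendstoInDistribution_of_quasiPowers hℓ hℓ0 hm' hv' hv hA hU' hg hcc hc⟩

/-- Both weights equal e^s, so the determinant is again V(2 - V) and V = 2 along the whole curve.
The kernel becomes the explicit equation 1 - 2r² = 2e^s(r - r³), which is differentiated twice at s
= 0. -/
theorem derivatives_sum (hρ : ρ ∈ Set.Ioo (0.4030317 : ℝ) 0.4030318)
    {r : ℂ → ℂ} (hr : AnalyticAt ℂ r 0)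
    (hr0 : r 0 = ρ)
    (hroot : ∀ᶠ s in 𝓝 0, walkDen (Complex.exp (s * 1)) (Complex.exp (s * 1)) (r s) = 0) :
    -(deriv r 0 / ρ) = ((ρ + 1) / (3 * ρ + 1) : ℝ) ∧
    (deriv r 0 / ρ) ^ 2 - deriv (deriv r) 0 / ρ =
      (4 * (ρ + 1) ^ 2 * ρ / ((3 * ρ + 1) ^ 3 * (1 - ρ)) : ℝ) := by
  have h0 : ∀ᶠ s in 𝓝 0, 1 - 2 * (r s * r s) -
      2 * (Complex.exp s * (r s - r s * (r s * r s))) = 0 := by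
    filter_upwards [hroot] with s hs
    rw [mul_one] at hs
    have hV : growth (Complex.exp s) (r s) = 2 := by
      have h1 : growth (Complex.exp s) (r s) * (growth (Complex.exp s) (r s) - 2) = 0 := by
        rw [walkDen] at hs
        linear_combination -hs
      rcases mul_eq_zero.1 h1 with h2 | h2
      · exact absurd h2 (growth_ne_zero _ _)
      · linear_combination h2
    have := growth_kernel (Complex.exp s) (r s)
    rw [hV] at this
    linear_combination this
  have hder : ∀ {s}, AnalyticAt ℂ r s → HasDerivAt r (deriv r s) s :=
    fun hs => hs.differentiableAt.hasDerivAt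
  have h1 : ∀ᶠ s in 𝓝 0, HasDerivAt (fun s => 1 - 2 * (r s * r s) -
      2 * (Complex.exp s * (r s - r s * (r s * r s))))
      (-4 * (r s * deriv r s) - 2 * (Complex.exp s * (r s - r s * (r s * r s))) -
        2 * (Complex.exp s * (deriv r s - 3 * (r s * (r s * deriv r s))))) s := by
    filter_upwards [hr.eventually_analyticAt] with s hs
    have hd := hder hs
    exact ((((hd.fun_mul hd).const_mul 2).const_sub 1).fun_sub
      (((Complex.hasDerivAt_exp s).fun_mul
        (hd.fun_sub (hd.fun_mul (hd.fun_mul hd)))).const_mul 2)).congr_deriv (by ring)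
  have hd := hder hr
  have hd2 := hr.deriv.differentiableAt.hasDerivAt
  have he := Complex.hasDerivAt_exp 0
  obtain ⟨e1, e2⟩ := second_derivative_eq_zero h0 h1
    ((((hd.fun_mul hd2).const_mul (-4)).fun_sub
      ((he.fun_mul (hd.fun_sub (hd.fun_mul (hd.fun_mul hd)))).const_mul 2)).fun_sub
      ((he.fun_mul (hd2.fun_sub ((hd.fun_mul (hd.fun_mul hd2)).const_mul 3))).const_mul 2))
  simp only [hr0, Complex.exp_zero] at e1 e2
  generalize deriv (deriv r) 0 = r2 at *
  generalize deriv r 0 = r1 at *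
  obtain ⟨l1, l2⟩ := hρ
  have n0 : (ρ : ℂ) ≠ 0 := by exact_mod_cast (show ρ ≠ 0 by nlinarith)
  have n1 : 1 - (ρ : ℂ) ≠ 0 := by exact_mod_cast (show 1 - ρ ≠ 0 by nlinarith)
  have n2 : (ρ : ℂ) * 3 + 1 ≠ 0 := by exact_mod_cast (show ρ * 3 + 1 ≠ 0 by nlinarith)
  have n2' : 3 * (ρ : ℂ) + 1 ≠ 0 := by rwa [mul_comm]
  have hr1 : r1 = -(ρ * ((ρ + 1) / (3 * ρ + 1))) := by
    have : r1 * (3 * ρ + 1) = -(ρ * (ρ + 1)) := by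
      refine mul_left_cancel₀ n1 ?_
      linear_combination -e1 / 2
    field_simp
    linear_combination this
  have hr2 : r2 = (-4 * r1 ^ 2 + 12 * ρ * r1 ^ 2 - 2 * (ρ - ρ ^ 3) - 4 * r1 * (1 - 3 * ρ ^ 2)) /
      (2 * (1 - ρ) * (3 * ρ + 1)) := by
    rw [eq_div_iff (mul_ne_zero (mul_ne_zero two_ne_zero n1) n2')]
    linear_combination -e2
  rw [hr2, hr1]
  push_cast
  constructor
  · field_simp
  · field_simp
    ring

/-- The weights are e^(-s) and e^s. With x = V_a - 1, vanishing of the determinant means V_b = 1 +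
1/x. The two kernel equations, the second multiplied by x², form a polynomial system for x and r,
differentiated twice at s = 0. -/
theorem derivatives_difference (hρ : ρ ∈ Set.Ioo (0.4030317 : ℝ) 0.4030318)
    (hcubic : 1 - 2 * ρ - 2 * ρ ^ 2 + 2 * ρ ^ 3 = 0) {r : ℂ → ℂ} (hr : AnalyticAt ℂ r 0)
    (hr0 : r 0 = ρ)
    (hroot : ∀ᶠ s in 𝓝 0, walkDen (Complex.exp (s * -1)) (Complex.exp (s * 1)) (r s) = 0) :
    -(deriv r 0 / ρ) = (0 : ℝ) ∧
    (deriv r 0 / ρ) ^ 2 - deriv (deriv r) 0 / ρ =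
      (ρ * (ρ ^ 2 - 2) * (1 + ρ) / ((ρ ^ 2 + ρ - 1) * (3 * ρ - 1) * (1 + 3 * ρ)) : ℝ) := by
  obtain ⟨x, hxdef⟩ : ∃ x : ℂ → ℂ, x = fun s => growth (Complex.exp (-s)) (r s) - 1 := ⟨_, rfl⟩
  have hx : AnalyticAt ℂ x 0 := by
    rw [hxdef]
    exact (analyticAt_growth_one (f := fun s => Complex.exp (-s)) (g := r)
      analyticAt_id.neg.cexp hr (by simp)
      (by rw [hr0]; exact ball_subset_closedBall (singularity_mem_ball hρ))).sub analyticAt_const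
  have hx0 : x 0 = 1 := by
    simp only [hxdef, neg_zero, Complex.exp_zero, hr0, growth_one_singularity hρ hcubic]
    norm_num
  have hF : ∀ᶠ s in 𝓝 0,
      x s - r s * r s * x s - r s * r s * (x s * x s) -
        Complex.exp (-s) * ((1 + x s) * (r s - r s * (r s * r s))) = 0 ∧
      x s - r s * r s * x s - r s * r s -
        Complex.exp s * ((x s + x s * x s) * (r s - r s * (r s * r s))) = 0 := by
    filter_upwards [hroot] with s hs
    have e1 := growth_kernel (Complex.exp (-s)) (r s)
    have e2 := growth_kernel (Complex.exp s) (r s)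
    have hxs : growth (Complex.exp (-s)) (r s) = 1 + x s := by
      rw [hxdef]
      ring
    rw [mul_one, mul_neg, mul_one, walkDen, hxs, add_sub_cancel_left] at hs
    rw [hxs] at e1
    generalize growth (Complex.exp s) (r s) = y at *
    refine ⟨by linear_combination e1, ?_⟩
    generalize Complex.exp s = E at *
    generalize x s = X at *
    generalize r s = T at *
    have hy : X * y = 1 + X := by linear_combination -hs
    linear_combination X ^ 2 * e2 -
      (X + T ^ 2 * X - T ^ 2 * (X * y + 1 + X) - E * (T - T ^ 3) * X) * hy
  have h1 : ∀ᶠ s in 𝓝 0, HasDerivAt (fun s => x s - r s * r s * x s - r s * r s * (x s * x s) -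
        Complex.exp (-s) * ((1 + x s) * (r s - r s * (r s * r s))))
      (deriv x s - (2 * (r s * deriv r s) * x s + r s * r s * deriv x s) -
        (2 * (r s * deriv r s) * (x s * x s) + r s * r s * (2 * (x s * deriv x s))) -
        Complex.exp (-s) * ((deriv x s - (1 + x s)) * (r s - r s * (r s * r s)) +
          (1 + x s) * (deriv r s - 3 * (r s * (r s * deriv r s))))) s ∧
      HasDerivAt (fun s => x s - r s * r s * x s - r s * r s -
        Complex.exp s * ((x s + x s * x s) * (r s - r s * (r s * r s))))
      (deriv x s - (2 * (r s * deriv r s) * x s + r s * r s * deriv x s) -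
        2 * (r s * deriv r s) -
        Complex.exp s * ((deriv x s + 2 * (x s * deriv x s) + (x s + x s * x s)) *
            (r s - r s * (r s * r s)) +
          (x s + x s * x s) * (deriv r s - 3 * (r s * (r s * deriv r s))))) s := by
    filter_upwards [hr.eventually_analyticAt, hx.eventually_analyticAt] with s hrs hxs
    have hd := hrs.differentiableAt.hasDerivAt
    have hdx := hxs.differentiableAt.hasDerivAt
    have hK := hd.fun_sub (hd.fun_mul (hd.fun_mul hd))
    have hP := hd.fun_mul hd
    exact ⟨(((hdx.fun_sub (hP.fun_mul hdx)).fun_sub (hP.fun_mul (hdx.fun_mul hdx))).fun_sub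
        ((hasDerivAt_neg s).cexp.fun_mul ((hdx.const_add 1).fun_mul hK))).congr_deriv (by ring),
      (((hdx.fun_sub (hP.fun_mul hdx)).fun_sub hP).fun_sub
        ((Complex.hasDerivAt_exp s).fun_mul
          ((hdx.fun_add (hdx.fun_mul hdx)).fun_mul hK))).congr_deriv (by ring)⟩
  have hd := hr.differentiableAt.hasDerivAt
  have hdx := hx.differentiableAt.hasDerivAt
  have hd2 := hr.deriv.differentiableAt.hasDerivAt
  have hdx2 := hx.deriv.differentiableAt.hasDerivAt
  have hK := hd.fun_sub (hd.fun_mul (hd.fun_mul hd))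
  have hK2 := hd2.fun_sub ((hd.fun_mul (hd.fun_mul hd2)).const_mul 3)
  have hP := hd.fun_mul hd
  have hP2 := (hd.fun_mul hd2).const_mul 2
  have hxx := hdx.fun_mul hdx
  have hxx2 := (hdx.fun_mul hdx2).const_mul 2
  obtain ⟨e1, e2⟩ := second_derivative_eq_zero (hF.mono fun s hs => hs.1) (h1.mono fun s hs => hs.1)
    (((hdx2.fun_sub ((hP2.fun_mul hdx).fun_add (hP.fun_mul hdx2))).fun_sub
      ((hP2.fun_mul hxx).fun_add (hP.fun_mul hxx2))).fun_sub
      ((hasDerivAt_neg 0).cexp.fun_mul (((hdx2.fun_sub (hdx.const_add 1)).fun_mul hK).fun_add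
        ((hdx.const_add 1).fun_mul hK2))))
  obtain ⟨e3, e4⟩ := second_derivative_eq_zero (hF.mono fun s hs => hs.2) (h1.mono fun s hs => hs.2)
    (((hdx2.fun_sub ((hP2.fun_mul hdx).fun_add (hP.fun_mul hdx2))).fun_sub hP2).fun_sub
      ((Complex.hasDerivAt_exp 0).fun_mul ((((hdx2.fun_add hxx2).fun_add
        (hdx.fun_add hxx)).fun_mul hK).fun_add ((hdx.fun_add hxx).fun_mul hK2))))
  simp only [hr0, hx0, neg_zero, Complex.exp_zero] at e1 e2 e3 e4
  clear hd hdx hd2 hdx2 hK hK2 hP hP2 hxx hxx2 h1 hF hroot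
  generalize deriv (deriv r) 0 = r2 at *
  generalize deriv r 0 = r1 at *
  generalize deriv (deriv x) 0 = x2 at *
  generalize deriv x 0 = x1 at *
  have hc : 1 - 2 * (ρ : ℂ) - 2 * ρ ^ 2 + 2 * ρ ^ 3 = 0 := by exact_mod_cast hcubic
  obtain ⟨l1, l2⟩ := hρ
  have n0 : (ρ : ℂ) ≠ 0 := by exact_mod_cast (show ρ ≠ 0 by nlinarith)
  have n1 : 2 * (ρ : ℂ) + 1 - 3 * ρ ^ 2 ≠ 0 := by
    exact_mod_cast (show 2 * ρ + 1 - 3 * ρ ^ 2 ≠ 0 by nlinarith)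
  have n2 : 1 + 3 * (ρ : ℂ) ≠ 0 := by exact_mod_cast (show 1 + 3 * ρ ≠ 0 by nlinarith)
  have n3 : 4 * (ρ : ℂ) ^ 2 - 1 ≠ 0 := by
    exact_mod_cast (show 4 * ρ ^ 2 - 1 ≠ 0 by nlinarith)
  have n4 : (ρ : ℂ) ^ 2 + ρ - 1 ≠ 0 := by
    exact_mod_cast (show ρ ^ 2 + ρ - 1 ≠ 0 by nlinarith)
  have n5 : 3 * (ρ : ℂ) - 1 ≠ 0 := by exact_mod_cast (show 3 * ρ - 1 ≠ 0 by nlinarith)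
  have n6 : 1 - (ρ : ℂ) ≠ 0 := by exact_mod_cast (show 1 - ρ ≠ 0 by nlinarith)
  push_cast
  clear hx hx0 hxdef hr hr0 hcubic
  generalize (ρ : ℂ) = z at *
  -- In the sum of the two first-order relations the coefficient of x' is twice the cubic. The
  -- vanishing of r' reflects the symmetry s ↦ -s.
  have hr1 : r1 = 0 := by
    refine mul_left_cancel₀ n1 ?_
    linear_combination -(e1 + e3) / 4 + x1 / 2 * hc
  subst hr1
  have hx1 : x1 * (4 * z ^ 2 - 1) = 2 * (1 - 2 * z ^ 2) := by
    linear_combination -(e1 - e3) - (x1 + 2) * hc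
  -- The second derivative of x drops out of the sum for the same reason.
  have h4 : 2 * (2 * r2 * ((1 - z) * (3 * z + 1))) =
      -(2 * x1 ^ 2 * (z ^ 2 + z - z ^ 3) + 4 * (z - z ^ 3) + 4 * x1 * (z - z ^ 3)) := by
    linear_combination -(e2 + e4) + 2 * x2 * hc
  have hr2 : r2 * ((3 * z + 1) * (4 * z ^ 2 - 1) ^ 2) = -(z * (1 + z)) := by
    refine mul_left_cancel₀ n6 ?_
    linear_combination (4 * z ^ 2 - 1) ^ 2 / 4 * h4 -
      ((z ^ 2 + z - z ^ 3) * (x1 * (4 * z ^ 2 - 1) + 2 * (1 - 2 * z ^ 2)) / 2 +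
        (z - z ^ 3) * (4 * z ^ 2 - 1)) * hx1 - (1 - 2 * z ^ 2) * (2 * z ^ 2) * hc
  refine ⟨by simp, ?_⟩
  rw [eq_div_iff (mul_ne_zero (mul_ne_zero n4 n5) n2), zero_div]
  refine mul_left_cancel₀ (mul_ne_zero n0 (pow_ne_zero 2 n3)) ?_
  have hz : z * (r2 / z) = r2 := mul_div_cancel₀ r2 n0
  linear_combination (-(4 * z ^ 2 - 1) ^ 2 * (z ^ 2 + z - 1) * (3 * z - 1) * (1 + 3 * z)) * hz -
    (z ^ 2 + z - 1) * (3 * z - 1) * hr2 -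
    z * (1 + z) * (8 * z ^ 4 + 8 * z ^ 3 - 4 * z ^ 2 - 1) * hc

end LimitLaws

end SquareWalk

/-! ### The distance to the north-east corner -/

namespace SquareWalk

open Metric

section CornerDistance

variable {ρ : ℝ}

/-- The polynomial that counts 2-sided walks by their distance to the north-east corner. -/
noncomputable def distPoly (n : ℕ) (q : ℂ) : ℂ := ∑ w : TwoSidedWalk n, q ^ w.neDist.toNat

theorem distPoly_one (n : ℕ) : distPoly n 1 = numTwoSided n := by
  simp [distPoly, numTwoSided_eq]

theorem distPoly_eq_weightSum (n : ℕ) (q : ℂ) :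
    distPoly n q = weightSum (stepWeight 1 1) (fun σ => q ^ σ.dist) n := by
  rw [← sum_twoSidedWalk, distPoly]
  refine Finset.sum_congr rfl fun w _ => ?_
  rw [Finset.prod_eq_one, one_mul]
  intro j _
  cases w.1 j <;> simp [stepWeight]

theorem differentiable_distPoly (n : ℕ) : Differentiable ℂ (distPoly n) := by
  unfold distPoly
  fun_prop

theorem eventually_hasSum_numTwoSided : ∀ᶠ t in 𝓝 0,
    HasSum (fun n => (numTwoSided n : ℂ) * t ^ n) (walkNum 1 1 1 t / walkDen 1 1 t) := by
  have := eventually_hasSum_weightSum (a := 1) (b := 1) (q := 1) one_ne_zero one_ne_zero one_ne_zero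
  simpa only [← distPoly_eq_weightSum, distPoly_one] using this

theorem one_sub_mul_singularity_ne_zero (hρ : ρ ∈ Set.Ioo (0.4030317 : ℝ) 0.4030318) {q : ℂ}
    (hq : ‖q‖ ≤ 1) : 1 - 2 * (ρ : ℂ) * q ≠ 0 := by
  intro h
  have h1 : ‖2 * (ρ : ℂ) * q‖ = 1 := by
    rw [← sub_eq_zero.1 h, norm_one]
  obtain ⟨l1, l2⟩ := hρ
  rw [norm_mul, norm_mul, Complex.norm_real, Real.norm_of_nonneg (by linarith)] at h1
  norm_num at h1
  nlinarith

/-- The limit of `p_n ρ ^ n`, multiplied by the limit `1 - 2 ρ` of the probability of ending at the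
north-east corner. -/
noncomputable def ampl (ρ : ℝ) : ℝ := ρ * (3 * ρ - 1) / ((3 * ρ + 1) * (5 * ρ - 2)) * (1 - 2 * ρ)

/-- The denominator does not involve q, so the pole stays at ρ and only the residue varies. On |q| =
1 the numerator is analytic in the disc, by `one_sub_mul_growth_ne_zero`. -/
theorem exists_tendstoUniformlyOn_distPoly (hρ : ρ ∈ Set.Ioo (0.4030317 : ℝ) 0.4030318)
    (hcubic : 1 - 2 * ρ - 2 * ρ ^ 2 + 2 * ρ ^ 3 = 0) {q₀ : ℂ} (hq : ‖q₀‖ = 1) :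
    ∃ U ∈ 𝓝 q₀, TendstoUniformlyOn (fun n q => distPoly n q * (ρ : ℂ) ^ n)
      (fun q => (ampl ρ : ℂ) / (1 - 2 * ρ * q)) atTop U := by
  have hq0 : q₀ ≠ 0 := by
    rintro rfl
    simp at hq
  obtain ⟨r, -, -, hroot, U, hU, hlim⟩ := exists_tendstoUniformlyOn_coeff (x₀ := q₀) (ρ₀ := ρ)
    (N := fun q t => walkNum 1 1 q t) (D := fun _ t => walkDen 1 1 t) (a := distPoly)
    (singularity_ne_zero hρ) (singularity_mem_ball hρ)
    (fun t ht => analyticAt_walkNum (α := fun _ => 1) (β := fun _ => 1) (κ := Prod.fst)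
      (τ := Prod.snd) analyticAt_const analyticAt_const analyticAt_fst analyticAt_snd rfl rfl hq ht)
    (fun t ht => analyticAt_walkDen (α := fun _ => 1) (β := fun _ => 1) (τ := Prod.snd)
      analyticAt_const analyticAt_const analyticAt_snd rfl rfl ht)
    (fun t ht => walkDen_one_eq_zero_iff hρ hcubic ht)
    (deriv_walkDen_one_ne_zero hρ hcubic)
    ((eventually_ne_nhds hq0).mono fun q hq => by
      simpa only [← distPoly_eq_weightSum] using
        eventually_hasSum_weightSum one_ne_zero one_ne_zero hq)
  have hr : ∀ᶠ q in 𝓝 q₀, r q = ρ := hroot.mono fun q h =>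
    (walkDen_one_eq_zero_iff hρ hcubic (ball_subset_closedBall h.1)).1 h.2
  refine ⟨U ∩ {q | r q = ρ}, inter_mem hU hr, ?_⟩
  refine ((hlim.mono Set.inter_subset_left).congr (Eventually.of_forall fun n q hq => ?_)).congr_right
    fun q hq => ?_
  · simp only [hq.2.out]
  · simp only [hq.2.out]
    exact residue_eq hρ hcubic q

theorem tendsto_numTwoSided_mul (hρ : ρ ∈ Set.Ioo (0.4030317 : ℝ) 0.4030318)
    (hcubic : 1 - 2 * ρ - 2 * ρ ^ 2 + 2 * ρ ^ 3 = 0) :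
    Tendsto (fun n => (numTwoSided n : ℝ) * ρ ^ n) atTop
      (𝓝 (ρ * (3 * ρ - 1) / ((3 * ρ + 1) * (5 * ρ - 2)))) := by
  obtain ⟨U, hU, hlim⟩ := exists_tendstoUniformlyOn_distPoly hρ hcubic (norm_one (α := ℂ))
  have h := hlim.tendsto_at (mem_of_mem_nhds hU)
  simp only [distPoly_one, mul_one] at h
  have hne : 1 - 2 * ρ ≠ 0 := by
    have := hρ.2
    nlinarith
  have e : ((ampl ρ : ℝ) : ℂ) / (1 - 2 * ρ) =
      ((ρ * (3 * ρ - 1) / ((3 * ρ + 1) * (5 * ρ - 2)) : ℝ) : ℂ) := by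
    have : ampl ρ / (1 - 2 * ρ) = ρ * (3 * ρ - 1) / ((3 * ρ + 1) * (5 * ρ - 2)) :=
      mul_div_cancel_right₀ _ hne
    rw [← this]
    push_cast
    rfl
  rw [e] at h
  refine tendsto_ofReal_iff.1 (h.congr fun n => ?_)
  push_cast
  rfl

/-- The coefficients of `distPoly` count the walks at distance `k` from the corner. -/
theorem hasSum_distPoly (n : ℕ) (q : ℂ) : HasSum (fun k : ℕ =>
    (∑ w : TwoSidedWalk n, if w.neDist = k then (1 : ℂ) else 0) * q ^ k) (distPoly n q) := by
  simp only [Finset.sum_mul]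
  refine hasSum_sum fun w _ => ?_
  have hw := w.neDist_nonneg
  convert hasSum_ite_eq w.neDist.toNat (q ^ w.neDist.toNat) using 2 with k
  have : w.neDist = k ↔ k = w.neDist.toNat := by omega
  by_cases h : k = w.neDist.toNat
  · rw [if_pos (this.2 h), if_pos h, h, one_mul]
  · rw [if_neg (mt this.1 h), if_neg h, zero_mul]

/-- The convergence is uniform on the unit circle by compactness, and Cauchy's estimate on that
circle transfers it to each coefficient in q. -/
theorem tendsto_sum_neDist_eq (hρ : ρ ∈ Set.Ioo (0.4030317 : ℝ) 0.4030318)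
    (hcubic : 1 - 2 * ρ - 2 * ρ ^ 2 + 2 * ρ ^ 3 = 0) (k : ℕ) :
    Tendsto (fun n => (∑ w : TwoSidedWalk n, if w.neDist = k then (1 : ℝ) else 0) * ρ ^ n) atTop
      (𝓝 (ampl ρ * (2 * ρ) ^ k)) := by
  have hunif : TendstoUniformlyOn (fun n q => distPoly n q * (ρ : ℂ) ^ n)
      (fun q => (ampl ρ : ℂ) / (1 - 2 * ρ * q)) atTop (sphere 0 1) := by
    rw [← tendstoLocallyUniformlyOn_iff_tendstoUniformlyOn_of_compact (isCompact_sphere 0 1)]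
    intro u hu q hq
    obtain ⟨U, hU, hlim⟩ := exists_tendstoUniformlyOn_distPoly hρ hcubic
      (mem_sphere_zero_iff_norm.1 hq)
    exact ⟨U, mem_nhdsWithin_of_mem_nhds hU, hlim u hu⟩
  have key : Tendsto (fun n => (∑ w : TwoSidedWalk n, if w.neDist = k then (1 : ℂ) else 0) *
      (ρ : ℂ) ^ n) atTop (𝓝 ((ampl ρ : ℂ) * (2 * ρ) ^ k)) := by
    rw [Metric.tendsto_nhds]
    intro ε hε
    filter_upwards [Metric.tendstoUniformlyOn_iff.1 hunif (ε / 2) (half_pos hε)] with n hn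
    -- The limit has its pole at 1/(2ρ) > 1, so the difference is analytic on the closed unit disc.
    have han : AnalyticOnNhd ℂ (fun q => distPoly n q * (ρ : ℂ) ^ n -
        (ampl ρ : ℂ) / (1 - 2 * ρ * q)) (closedBall 0 1) := fun q hq =>
      (((differentiable_distPoly n).analyticAt q).mul analyticAt_const).sub
        (analyticAt_const.div (analyticAt_const.sub (analyticAt_const.mul analyticAt_id))
          (one_sub_mul_singularity_ne_zero hρ (mem_closedBall_zero_iff.1 hq)))
    have hbound := han.norm_coeff_le one_pos (C := ε / 2)
      (a := fun k : ℕ => (∑ w : TwoSidedWalk n, if w.neDist = k then (1 : ℂ) else 0) *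
        (ρ : ℂ) ^ n - (ampl ρ : ℂ) * (2 * ρ) ^ k)
      (fun q hq => by
        have := (hn q hq).le
        rwa [dist_comm, dist_eq_norm] at this)
      (by
        filter_upwards [ball_mem_nhds (0 : ℂ) one_pos] with q hq
        have hlt : ‖2 * (ρ : ℂ) * q‖ < 1 := by
          have hq' := mem_ball_zero_iff.1 hq
          obtain ⟨l1, l2⟩ := hρ
          rw [norm_mul, norm_mul, Complex.norm_real, Real.norm_of_nonneg (by linarith)]
          norm_num
          nlinarith [norm_nonneg q]
        have h1 := (hasSum_distPoly n q).mul_right ((ρ : ℂ) ^ n)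
        have h2 := (hasSum_geometric_of_norm_lt_one hlt).mul_left (ampl ρ : ℂ)
        rw [← div_eq_mul_inv] at h2
        refine (congrArg (HasSum · _) (funext fun j => ?_)).mpr (h1.sub h2)
        rw [mul_pow]
        ring) k
    rw [dist_eq_norm]
    rw [one_pow, div_one] at hbound
    linarith
  refine tendsto_ofReal_iff.1 ?_
  push_cast
  refine key.congr fun n => congrArg (· * _) (Finset.sum_congr rfl fun w _ => ?_)
  split_ifs <;> simp

theorem div_numTwoSided (hρ : ρ ≠ 0) (x : ℝ) (n : ℕ) :
    x / numTwoSided n = x * ρ ^ n / (numTwoSided n * ρ ^ n) :=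
  (mul_div_mul_right _ _ (pow_ne_zero n hρ)).symm

theorem kappa_ne_zero (hρ : ρ ∈ Set.Ioo (0.4030317 : ℝ) 0.4030318) :
    ρ * (3 * ρ - 1) / ((3 * ρ + 1) * (5 * ρ - 2)) ≠ 0 := by
  obtain ⟨h1, h2⟩ := hρ
  refine div_ne_zero (mul_ne_zero ?_ ?_) (mul_ne_zero ?_ ?_) <;> nlinarith

theorem tendsto_unif_neDist (hρ : ρ ∈ Set.Ioo (0.4030317 : ℝ) 0.4030318)
    (hcubic : 1 - 2 * ρ - 2 * ρ ^ 2 + 2 * ρ ^ 3 = 0) (k : ℕ) :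
    Tendsto (fun n => (unif n).real {w | w.neDist = (k : ℤ)}) atTop
      (𝓝 ((1 - 2 * ρ) * (2 * ρ) ^ k)) := by
  have hρ0 : ρ ≠ 0 := by exact_mod_cast singularity_ne_zero hρ
  have h := (tendsto_sum_neDist_eq hρ hcubic k).div (tendsto_numTwoSided_mul hρ hcubic)
    (kappa_ne_zero hρ)
  rw [ampl, mul_assoc, mul_div_cancel_left₀ _ (kappa_ne_zero hρ)] at h
  refine h.congr fun n => ?_
  rw [Pi.div_apply, ← div_numTwoSided hρ0, ← integral_indicator_one (.of_discrete), integral_unif]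
  simp [Set.indicator_apply]

/-- The expectation is the logarithmic derivative of `distPoly n` at q = 1, and uniform convergence
near 1 allows differentiation of the limit. -/
theorem tendsto_integral_neDist (hρ : ρ ∈ Set.Ioo (0.4030317 : ℝ) 0.4030318)
    (hcubic : 1 - 2 * ρ - 2 * ρ ^ 2 + 2 * ρ ^ 3 = 0) :
    Tendsto (fun n => ∫ w, (w.neDist : ℝ) ∂(unif n)) atTop (𝓝 (2 * ρ / (1 - 2 * ρ))) := by
  have hρ0 : ρ ≠ 0 := by exact_mod_cast singularity_ne_zero hρ
  have hne : 1 - 2 * ρ ≠ 0 := by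
    have := hρ.2
    nlinarith
  obtain ⟨U, hU, hlim⟩ := exists_tendstoUniformlyOn_distPoly hρ hcubic (norm_one (α := ℂ))
  have hloc := (hlim.mono interior_subset).tendstoLocallyUniformlyOn.deriv
    (Eventually.of_forall fun n => ((differentiable_distPoly n).mul_const _).differentiableOn)
    isOpen_interior
  have h1 := hloc.tendsto_at (mem_interior_iff_mem_nhds.2 hU)
  have hd : HasDerivAt (fun q : ℂ => (ampl ρ : ℂ) / (1 - 2 * ρ * q))
      ((ampl ρ * (2 * ρ) / (1 - 2 * ρ) ^ 2 : ℝ) : ℂ) 1 := by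
    have := (hasDerivAt_const (1 : ℂ) (ampl ρ : ℂ)).fun_div
      (((hasDerivAt_id' (1 : ℂ)).const_mul (2 * (ρ : ℂ))).const_sub 1)
      (one_sub_mul_singularity_ne_zero hρ norm_one.le)
    refine this.congr_deriv ?_
    push_cast
    ring
  rw [hd.deriv] at h1
  have hderiv : ∀ n, deriv (fun q => distPoly n q * (ρ : ℂ) ^ n) 1 =
      (((∑ w : TwoSidedWalk n, (w.neDist : ℝ)) * ρ ^ n : ℝ) : ℂ) := fun n => by
    have : HasDerivAt (fun q => distPoly n q * (ρ : ℂ) ^ n)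
        ((∑ w : TwoSidedWalk n, (w.neDist.toNat : ℂ) * 1 ^ (w.neDist.toNat - 1)) * (ρ : ℂ) ^ n) 1 :=
      (HasDerivAt.fun_sum fun w _ => hasDerivAt_pow w.neDist.toNat (1 : ℂ)).mul_const _
    rw [this.deriv]
    push_cast
    refine congrArg (· * _) (Finset.sum_congr rfl fun w _ => ?_)
    rw [one_pow, mul_one]
    exact_mod_cast congrArg (Int.cast : ℤ → ℂ) (Int.toNat_of_nonneg w.neDist_nonneg)
  simp only [Function.comp_def, hderiv] at h1
  have h2 := (tendsto_ofReal_iff.1 h1).div (tendsto_numTwoSided_mul hρ hcubic) (kappa_ne_zero hρ)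
  have e : ampl ρ * (2 * ρ) / (1 - 2 * ρ) ^ 2 / (ρ * (3 * ρ - 1) / ((3 * ρ + 1) * (5 * ρ - 2))) =
      2 * ρ / (1 - 2 * ρ) := by
    have hk := kappa_ne_zero hρ
    rw [ampl]
    generalize ρ * (3 * ρ - 1) / ((3 * ρ + 1) * (5 * ρ - 2)) = κ at *
    field_simp
  rw [e] at h2
  refine h2.congr fun n => ?_
  rw [Pi.div_apply, ← div_numTwoSided hρ0, integral_unif]

end CornerDistance

/-! ### Symmetry in the diagonal -/

section Reflection

variable {n : ℕ}

theorem vertex_swap (w : Fin n → Step) (i : ℕ) :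
    vertex (fun j => (w j).swap) i = (vertex w i).swap := by
  ext <;> simp [vertex, Prod.fst_sum, Prod.snd_sum, Step.vec_swap]

theorem IsTwoSided.swap {w : Fin n → Step} (h : IsTwoSided w) :
    IsTwoSided fun j => (w j).swap := by
  refine ⟨fun i j hj k hk he => h.1 i j hj k hk ?_, fun m hm => ?_⟩
  · rw [vertex_swap, vertex_swap, Step.vec_swap] at he
    refine Prod.swap_injective ?_
    rw [he]
    ext <;> simp
  · have := (h.2 m hm).symm
    simpa [vertex_swap, neCorner] using this

/-- The reflection in the diagonal. -/
def TwoSidedWalk.swapEquiv : TwoSidedWalk n ≃ TwoSidedWalk n where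
  toFun w := ⟨_, w.2.swap⟩
  invFun w := ⟨_, w.2.swap⟩
  left_inv _ := Subtype.ext (funext fun _ => Step.swap_swap _)
  right_inv _ := Subtype.ext (funext fun _ => Step.swap_swap _)

theorem integral_X_sub_Y (n : ℕ) : ∫ w, ((w.X : ℝ) - (w.Y : ℝ)) ∂(unif n) = 0 := by
  have h : ∑ w : TwoSidedWalk n, (w.X : ℝ) = ∑ w : TwoSidedWalk n, (w.Y : ℝ) := by
    rw [← Equiv.sum_comp TwoSidedWalk.swapEquiv]
    refine Finset.sum_congr rfl fun w _ => ?_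
    have : (TwoSidedWalk.swapEquiv w).X = w.Y := congrArg Prod.fst (vertex_swap w.1 n)
    rw [this]
  rw [integral_unif, Finset.sum_sub_distrib, h, sub_self, zero_div]

end Reflection

end SquareWalk

/-! ### The length generating function -/

namespace SquareWalk

open Metric

section LengthGeneratingFunction

variable {ρ : ℝ}

theorem analyticAt_walkNum_one {t : ℂ} (ht : t ∈ closedBall (0 : ℂ) (81 / 200)) :
    AnalyticAt ℂ (walkNum 1 1 1) t :=
  analyticAt_walkNum (α := fun _ => 1) (β := fun _ => 1) (κ := fun _ => 1) (τ := fun t => t)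
    analyticAt_const analyticAt_const analyticAt_const analyticAt_id rfl rfl norm_one ht

theorem analyticAt_walkDen_one {t : ℂ} (ht : t ∈ closedBall (0 : ℂ) (81 / 200)) :
    AnalyticAt ℂ (walkDen 1 1) t :=
  analyticAt_walkDen (α := fun _ => 1) (β := fun _ => 1) (τ := fun t => t)
    analyticAt_const analyticAt_const analyticAt_id rfl rfl ht

theorem analyticAt_lengthGF (hρ : ρ ∈ Set.Ioo (0.4030317 : ℝ) 0.4030318)
    (hcubic : 1 - 2 * ρ - 2 * ρ ^ 2 + 2 * ρ ^ 3 = 0) {t : ℂ}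
    (ht : t ∈ closedBall (0 : ℂ) (81 / 200)) (hne : t ≠ ρ) :
    AnalyticAt ℂ (fun t => walkNum 1 1 1 t / walkDen 1 1 t) t :=
  (analyticAt_walkNum_one ht).div (analyticAt_walkDen_one ht)
    (mt (walkDen_one_eq_zero_iff hρ hcubic ht).1 hne)

/-- The closed form is analytic for |t| < ρ, so its Taylor series converges there; the coefficients
are identified from the expansion valid for small t. -/
theorem hasSum_lengthGF (hρ : ρ ∈ Set.Ioo (0.4030317 : ℝ) 0.4030318)
    (hcubic : 1 - 2 * ρ - 2 * ρ ^ 2 + 2 * ρ ^ 3 = 0) {z : ℂ} (hz : ‖z‖ < ρ) :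
    HasSum (fun n => (numTwoSided n : ℂ) * z ^ n) (walkNum 1 1 1 z / walkDen 1 1 z) := by
  have hsub : ∀ t ∈ ball (0 : ℂ) ρ, t ∈ closedBall (0 : ℂ) (81 / 200) ∧ t ≠ ρ := by
    intro t ht
    have ht' := mem_ball_zero_iff.1 ht
    refine ⟨mem_closedBall_zero_iff.2 (by linarith [hρ.2]), ?_⟩
    rintro rfl
    rw [Complex.norm_real, Real.norm_eq_abs] at ht'
    exact (le_abs_self ρ).not_gt ht'
  have h := Complex.hasSum_taylorSeries_on_ball (c := 0) (r := ρ)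
    (f := fun t => walkNum 1 1 1 t / walkDen 1 1 t)
    (fun t ht => (analyticAt_lengthGF hρ hcubic (hsub t ht).1
      (hsub t ht).2).differentiableAt.differentiableWithinAt) (mem_ball_zero_iff.2 hz)
  have h0 := hsub 0 (mem_ball_self ((norm_nonneg z).trans_lt hz))
  refine (congrArg (HasSum · _) (funext fun n => ?_)).mpr h
  rw [(analyticAt_lengthGF hρ hcubic h0.1 h0.2).coeff_eq_iteratedDeriv
    eventually_hasSum_numTwoSided n, sub_zero, smul_eq_mul, smul_eq_mul]
  ring

theorem walkNum_one_singularity_ne_zero (hρ : ρ ∈ Set.Ioo (0.4030317 : ℝ) 0.4030318)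
    (hcubic : 1 - 2 * ρ - 2 * ρ ^ 2 + 2 * ρ ^ 3 = 0) : walkNum 1 1 1 ρ ≠ 0 := by
  intro h
  have h1 := residue_eq hρ hcubic 1
  rw [h, neg_zero, zero_div, eq_comm, div_eq_zero_iff] at h1
  rcases h1 with h1 | h1
  · have hne : 1 - 2 * ρ ≠ 0 := by
      have := hρ.2
      nlinarith
    exact mul_ne_zero (kappa_ne_zero hρ) hne (Complex.ofReal_eq_zero.1 h1)
  · exact one_sub_mul_singularity_ne_zero hρ norm_one.le h1

/-- The numerator is nonzero at ρ because the residue is, and the denominator has a simple zero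
there. -/
theorem lengthGF_simplePole (hρ : ρ ∈ Set.Ioo (0.4030317 : ℝ) 0.4030318)
    (hcubic : 1 - 2 * ρ - 2 * ρ ^ 2 + 2 * ρ ^ 3 = 0) :
    MeromorphicAt (fun t => walkNum 1 1 1 t / walkDen 1 1 t) (ρ : ℂ) ∧
      meromorphicOrderAt (fun t => walkNum 1 1 1 t / walkDen 1 1 t) (ρ : ℂ) = -1 := by
  have hmem := singularity_mem_ball hρ
  have hmem' := ball_subset_closedBall hmem
  have hzero := (walkDen_one_eq_zero_iff hρ hcubic hmem').2 rfl
  have hslope : dslope (walkDen 1 1) ρ ρ ≠ 0 := by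
    rw [dslope_same]
    exact deriv_walkDen_one_ne_zero hρ hcubic
  have hmer := (analyticAt_walkNum_one hmem').meromorphicAt.div
    (analyticAt_walkDen_one hmem').meromorphicAt
  refine ⟨hmer, (meromorphicOrderAt_eq_int_iff (n := -1) hmer).2
    ⟨fun t => walkNum 1 1 1 t / dslope (walkDen 1 1) ρ t,
      (analyticAt_walkNum_one hmem').div
        (AnalyticOnNhd.dslope_closedBall hmem (fun t ht => analyticAt_walkDen_one ht) _ hmem') hslope,
      div_ne_zero (walkNum_one_singularity_ne_zero hρ hcubic) hslope, ?_⟩⟩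
  filter_upwards [self_mem_nhdsWithin] with t ht
  rw [dslope_of_ne _ ht, slope_def_field, hzero, sub_zero, zpow_neg_one, smul_eq_mul, Pi.div_apply]
  have : t - ρ ≠ 0 := sub_ne_zero.2 ht
  field_simp

end LengthGeneratingFunction

/-! ### Numerical values and the asymptotics of the counting sequence -/

section Constants

variable {ρ : ℝ}

theorem bounds_basic (hρ : ρ ∈ Set.Ioo (0.4030317 : ℝ) 0.4030318) :
    1 / ρ ∈ Set.Ioo (2.48 : ℝ) 2.49 ∧
    ρ * (3 * ρ - 1) / ((3 * ρ + 1) * (5 * ρ - 2)) ∈ Set.Ioo (2.51 : ℝ) 2.52 ∧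
    2 * ρ / (1 - 2 * ρ) ∈ Set.Ioo (4.15 : ℝ) 4.16 ∧
    (ρ + 1) / (3 * ρ + 1) ∈ Set.Ioo (0.63 : ℝ) 0.64 := by
  obtain ⟨h1, h2⟩ := hρ
  have p1 : 0 < (3 * ρ + 1) * (5 * ρ - 2) := mul_pos (by linarith) (by linarith)
  refine ⟨⟨?_, ?_⟩, ⟨?_, ?_⟩, ⟨?_, ?_⟩, ⟨?_, ?_⟩⟩
  all_goals first
    | (rw [lt_div_iff₀ (by linarith)]; nlinarith)
    | (rw [div_lt_iff₀ (by linarith)]; nlinarith)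

theorem bounds_variance_sum (hρ : ρ ∈ Set.Ioo (0.4030317 : ℝ) 0.4030318) :
    4 * (ρ + 1) ^ 2 * ρ / ((3 * ρ + 1) ^ 3 * (1 - ρ)) ∈ Set.Ioo (0.49 : ℝ) 0.50 := by
  obtain ⟨h1, h2⟩ := hρ
  have p1 : 0 < (3 * ρ + 1) ^ 3 * (1 - ρ) := mul_pos (pow_pos (by linarith) 3) (by linarith)
  have a1 : 0.16243 < ρ ^ 2 := by nlinarith
  have a2 : ρ ^ 2 < 0.16244 := by nlinarith
  have b1 : 0.06546 < ρ ^ 3 := by nlinarith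
  have b2 : ρ ^ 3 < 0.06548 := by nlinarith
  have c1 : 0.02638 < ρ ^ 4 := by nlinarith
  have c2 : ρ ^ 4 < 0.02639 := by nlinarith
  constructor
  · rw [lt_div_iff₀ p1]
    nlinarith
  · rw [div_lt_iff₀ p1]
    nlinarith

theorem bounds_variance_difference (hρ : ρ ∈ Set.Ioo (0.4030317 : ℝ) 0.4030318) :
    ρ * (ρ ^ 2 - 2) * (1 + ρ) / ((ρ ^ 2 + ρ - 1) * (3 * ρ - 1) * (1 + 3 * ρ)) ∈
      Set.Ioo (5.17 : ℝ) 5.18 := by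
  obtain ⟨h1, h2⟩ := hρ
  have a1 : 0.16243 < ρ ^ 2 := by nlinarith
  have a2 : ρ ^ 2 < 0.16244 := by nlinarith
  have b1 : 0.06546 < ρ ^ 3 := by nlinarith
  have b2 : ρ ^ 3 < 0.06548 := by nlinarith
  have c1 : 0.02638 < ρ ^ 4 := by nlinarith
  have c2 : ρ ^ 4 < 0.02639 := by nlinarith
  have p1 : 0 < (1 - ρ - ρ ^ 2) * (3 * ρ - 1) * (1 + 3 * ρ) :=
    mul_pos (mul_pos (by linarith) (by linarith)) (by linarith)
  have e : ρ * (ρ ^ 2 - 2) * (1 + ρ) / ((ρ ^ 2 + ρ - 1) * (3 * ρ - 1) * (1 + 3 * ρ)) =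
      ρ * (2 - ρ ^ 2) * (1 + ρ) / ((1 - ρ - ρ ^ 2) * (3 * ρ - 1) * (1 + 3 * ρ)) := by
    rw [← neg_div_neg_eq]
    congr 1 <;> ring
  rw [e]
  constructor
  · rw [lt_div_iff₀ p1]
    nlinarith
  · rw [div_lt_iff₀ p1]
    nlinarith

theorem isEquivalent_numTwoSided (hρ : ρ ∈ Set.Ioo (0.4030317 : ℝ) 0.4030318)
    (hcubic : 1 - 2 * ρ - 2 * ρ ^ 2 + 2 * ρ ^ 3 = 0) :
    (fun n => (numTwoSided n : ℝ)) ~[atTop]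
      fun n => ρ * (3 * ρ - 1) / ((3 * ρ + 1) * (5 * ρ - 2)) * (1 / ρ) ^ n := by
  have hρ0 : ρ ≠ 0 := by exact_mod_cast singularity_ne_zero hρ
  have hk := kappa_ne_zero hρ
  rw [isEquivalent_iff_tendsto_one (Eventually.of_forall fun n =>
    mul_ne_zero hk (pow_ne_zero n (one_div_ne_zero hρ0)))]
  have h := (tendsto_numTwoSided_mul hρ hcubic).div_const
    (ρ * (3 * ρ - 1) / ((3 * ρ + 1) * (5 * ρ - 2)))
  rw [div_self hk] at h
  refine h.congr fun n => ?_
  rw [Pi.div_apply]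
  generalize ρ * (3 * ρ - 1) / ((3 * ρ + 1) * (5 * ρ - 2)) = κ at *
  rw [one_div, inv_pow]
  field_simp

end Constants

end SquareWalk

theorem proposition3p2 :
    ∃ ρ μ κ m v v' : ℝ,
      -- the constants, with their numerical values truncated to the displayed digits
      (1 - 2 * ρ - 2 * ρ ^ 2 + 2 * ρ ^ 3 = 0 ∧ ρ ∈ Set.Ioo (0.403 : ℝ) 0.404) ∧
      (μ = 1 / ρ ∧ μ ∈ Set.Ioo (2.48 : ℝ) 2.49) ∧
      (κ = ρ * (3 * ρ - 1) / ((3 * ρ + 1) * (5 * ρ - 2)) ∧ κ ∈ Set.Ioo (2.51 : ℝ) 2.52) ∧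
      (2 * ρ / (1 - 2 * ρ) ∈ Set.Ioo (4.15 : ℝ) 4.16) ∧
      (m = (ρ + 1) / (3 * ρ + 1) ∧ m ∈ Set.Ioo (0.63 : ℝ) 0.64) ∧
      (v = 4 * (ρ + 1) ^ 2 * ρ / ((3 * ρ + 1) ^ 3 * (1 - ρ)) ∧ v ∈ Set.Ioo (0.49 : ℝ) 0.50) ∧
      (v' = ρ * (ρ ^ 2 - 2) * (1 + ρ) / ((ρ ^ 2 + ρ - 1) * (3 * ρ - 1) * (1 + 3 * ρ)) ∧
        v' ∈ Set.Ioo (5.17 : ℝ) 5.18) ∧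
      -- the length generating function has `ρ` as its unique singularity of minimal modulus,
      -- and this singularity is a simple pole
      (∃ (F : ℂ → ℂ) (R : ℝ), ρ < R ∧
        (∀ z : ℂ, ‖z‖ < ρ → HasSum (fun n : ℕ => (SquareWalk.numTwoSided n : ℂ) * z ^ n) (F z)) ∧
        AnalyticOnNhd ℂ F (Metric.ball 0 R \ {(ρ : ℂ)}) ∧
        MeromorphicAt F (ρ : ℂ) ∧ meromorphicOrderAt F (ρ : ℂ) = -1) ∧
      -- the number of `n`-step walks
      ((fun n : ℕ => (SquareWalk.numTwoSided n : ℝ)) ~[atTop] fun n : ℕ => κ * μ ^ n) ∧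
      -- the distance to the north-east corner is asymptotically geometric
      (∀ k : ℕ, Tendsto (fun n : ℕ => (SquareWalk.unif n).real {w | w.neDist = (k : ℤ)}) atTop
        (𝓝 ((1 - 2 * ρ) * (2 * ρ) ^ k))) ∧
      Tendsto (fun n : ℕ => ∫ w, (w.neDist : ℝ) ∂(SquareWalk.unif n)) atTop
        (𝓝 (2 * ρ / (1 - 2 * ρ))) ∧
      -- the sum of the coordinates of the endpoint
      ((fun n : ℕ => ∫ w, ((w.X : ℝ) + (w.Y : ℝ)) ∂(SquareWalk.unif n)) ~[atTop]
        fun n : ℕ => m * n) ∧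
      ((fun n : ℕ => Var[fun w => (w.X : ℝ) + (w.Y : ℝ); SquareWalk.unif n]) ~[atTop]
        fun n : ℕ => v * n) ∧
      TendstoInDistribution
        (fun (n : ℕ) (w : SquareWalk.TwoSidedWalk n) =>
          ((w.X : ℝ) + (w.Y : ℝ) - m * n) / (√v * √n))
        atTop (id : ℝ → ℝ) SquareWalk.unif (gaussianReal 0 1) ∧
      -- the difference of the coordinates of the endpoint
      (∀ n : ℕ, ∫ w, ((w.X : ℝ) - (w.Y : ℝ)) ∂(SquareWalk.unif n) = 0) ∧
      ((fun n : ℕ => Var[fun w => (w.X : ℝ) - (w.Y : ℝ); SquareWalk.unif n]) ~[atTop]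
        fun n : ℕ => v' * n) ∧
      TendstoInDistribution
        (fun (n : ℕ) (w : SquareWalk.TwoSidedWalk n) =>
          ((w.X : ℝ) - (w.Y : ℝ)) / (√v' * √n))
        atTop (id : ℝ → ℝ) SquareWalk.unif (gaussianReal 0 1) := by
  obtain ⟨ρ, hρ, hcubic⟩ := SquareWalk.exists_singularity
  obtain ⟨bμ, bκ, bd, bm⟩ := SquareWalk.bounds_basic hρ
  have bv := SquareWalk.bounds_variance_sum hρ
  have bv' := SquareWalk.bounds_variance_difference hρ
  obtain ⟨⟨x, hx⟩, ⟨y, hy⟩, hsum⟩ := SquareWalk.quasiPowers_limits hρ hcubic (ξ := 1) (η := 1)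
    (S := fun n w => (w.X : ℝ) + (w.Y : ℝ)) (fun n w => by push_cast; ring)
    (by linarith [bv.1]) fun r hr hr0 hroot => SquareWalk.derivatives_sum hρ hr hr0 hroot
  obtain ⟨-, ⟨y', hy'⟩, hdiff⟩ := SquareWalk.quasiPowers_limits hρ hcubic (ξ := 1) (η := -1)
    (S := fun n w => (w.X : ℝ) - (w.Y : ℝ)) (fun n w => by push_cast; ring)
    (by linarith [bv'.1]) fun r hr hr0 hroot =>
      SquareWalk.derivatives_difference hρ hcubic hr hr0 hroot
  -- The difference has drift 0, so the centring term disappears.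
  simp only [zero_mul, sub_zero] at hdiff
  obtain ⟨hmer, hord⟩ := SquareWalk.lengthGF_simplePole hρ hcubic
  refine ⟨ρ, _, _, _, _, _, ⟨hcubic, ⟨by linarith [hρ.1], by linarith [hρ.2]⟩⟩, ⟨rfl, bμ⟩, ⟨rfl, bκ⟩,
    bd, ⟨rfl, bm⟩, ⟨rfl, bv⟩, ⟨rfl, bv'⟩,
    ⟨fun t => SquareWalk.walkNum 1 1 1 t / SquareWalk.walkDen 1 1 t, 81 / 200,
      by linarith [hρ.2], fun z hz => SquareWalk.hasSum_lengthGF hρ hcubic hz,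
      fun z hz => SquareWalk.analyticAt_lengthGF hρ hcubic (Metric.ball_subset_closedBall hz.1) hz.2,
      hmer, hord⟩,
    SquareWalk.isEquivalent_numTwoSided hρ hcubic, SquareWalk.tendsto_unif_neDist hρ hcubic,
    SquareWalk.tendsto_integral_neDist hρ hcubic,
    SquareWalk.isEquivalent_of_tendsto_sub (by linarith [bm.1] : (0 : ℝ) < _).ne' hx,
    SquareWalk.isEquivalent_of_tendsto_sub (by linarith [bv.1] : (0 : ℝ) < _).ne' hy, hsum,
    SquareWalk.integral_X_sub_Y,
    SquareWalk.isEquivalent_of_tendsto_sub (by linarith [bv'.1] : (0 : ℝ) < _).ne' hy', hdiff⟩
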